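/- Let $n\ge 1$. Let $\mathfrak{tr}_n$ be the Lie algebra over $\mathbb{Q}$ with generators $r_{ij}$, $1\le i\ne j\le n$, and relations $r_{ij}=-r_{ji}$; $[r_{ij},r_{ik}]+[r_{ij},r_{jk}]+[r_{ik},r_{jk}]=0$ for distinct $i,j,k$; $[r_{ij},r_{kl}]=0$ for distinct $i,j,k,l$. Let $FA_N$ be the free algebra over $\mathbb{Q}$ on $x_1,\dots,x_N$, graded by $\bigoplus_{i=1}^N\mathbb{Z}_{\ge 0}\delta_i$ with $\deg x_i=\delta_i$, on which the symmetric group $\mathfrak{S}_N$ acts by permuting the generators, and let $$U_n^{\mathrm{univ}}=(U(\mathfrak{g})^{\otimes n})_{\mathrm{univ}}=\bigoplus_{N\ge 0}\Big((FA_N^{\otimes n})_{\delta_1+\cdots+\delta_N}\otimes (FA_N^{\otimes n})_{\delta_1+\cdots+\delta_N}\Big)_{\mathfrak{S}_N},$$ where the index $\delta_1+\cdots+\delta_N$ denotes the part of that degree and the index $\mathfrak{S}_N$ denotes coinvariants of the diagonal action. The class of $(u_1\otimes\cdots\otimes u_n)\otimes(v_1\otimes\cdots\otimes v_n)$, with $u_s,v_s$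 monomials, is written as the normally ordered expression $u_1(a)v_1(b)\otimes\cdots\otimes u_n(a)v_n(b)$ in letters $a_1,\dots,a_N,b_1,\dots,b_N$ (one substitutes $x_i=a_i$ in the $u_s$ and $x_i=b_i$ in the $v_s$). The product of two such classes, of degrees $N$ and $M$, is obtained by adding $N$ to all labels in the second expression, concatenating the two expressions in each of the $n$ tensor factors, and moving all letters $a$ to the left of all letters $b$ by means of the rule coming from the classical Yang–Baxter equation, $$b_i a_j = a_j b_i-\{a_i\mapsto[a_i,a_j]\}\,b_i-a_j\,\{b_j\mapsto[b_i,b_j]\},$$ where $\{c\mapsto[c',c'']\}$ means that the letter $c$, wherever it stands, is replaced by $c'c''-c''c'$. This makes $U_n^{\mathrm{univ}}$ a graded associative unital $\mathbb{Q}$-algebra. For $i\neq j$ let $r_{ij}^{\mathrm{univ}}\in U_n^{\mathrm{univ}}$ be the class, of degree $N=1$, of $$(1^{\otimes i-1}\otimes x_1\otimes 1^{\otimes n-i})\otimes(1^{\otimes j-1}\otimes x_1\otimes 1^{\otimes n-j}).$$ Then there is an algebra homomorphism $U(\mathfrak{tr}_n)\to U_n^{\mathrm{univ}}$ with $r_{ij}\mapsto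 r_{ij}^{\mathrm{univ}}$ for $1\le i<j\le n$ (it is unique, since these $r_{ij}$ generate), and it is injective. -/

import Mathlib

open scoped TensorProduct DirectSum

namespace UnivYB

/-- The pure tensor in `(FA_N)^{⊗ n}` whose `s`-th factor is the word `u s` in the free generators
`x_1, …, x_N` of the free algebra `FA_N`. -/
noncomputable def monomial {n N : ℕ} (u : Fin n → List (Fin N)) :
    ⨂[ℚ] _ : Fin n, FreeAlgebra ℚ (Fin N) :=
  PiTensorProduct.tprod ℚ fun s => ((u s).map (FreeAlgebra.ι ℚ)).prod

/-- An `n`-tuple of words has multidegree `δ_1 + ⋯ + δ_N`: every letter occurs exactly once. -/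
def IsMultilinear {n N : ℕ} (u : Fin n → List (Fin N)) : Prop :=
  ∀ i, ∑ s, (u s).count i = 1

/-- The part of multidegree `δ_1 + ⋯ + δ_N` of `(FA_N)^{⊗ n}`. -/
noncomputable def multilinearPart (n N : ℕ) :
    Submodule ℚ (⨂[ℚ] _ : Fin n, FreeAlgebra ℚ (Fin N)) :=
  Submodule.span ℚ {x | ∃ u, IsMultilinear u ∧ x = monomial u}

/-- The action of a permutation of the generators on `(FA_N)^{⊗ n}`. -/
noncomputable def permTensor {n N : ℕ} (σ : Equiv.Perm (Fin N)) :
    (⨂[ℚ] _ : Fin n, FreeAlgebra ℚ (Fin N)) →ₗ[ℚ] ⨂[ℚ] _ : Fin n, FreeAlgebra ℚ (Fin N) :=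
  PiTensorProduct.map fun _ =>
    (FreeAlgebra.lift ℚ (fun i => FreeAlgebra.ι ℚ (σ i))).toLinearMap

theorem permTensor_monomial {n N : ℕ} (σ : Equiv.Perm (Fin N)) (u : Fin n → List (Fin N)) :
    permTensor σ (monomial u) = monomial fun s => (u s).map σ := by
  simp only [permTensor, monomial, PiTensorProduct.map_tprod]
  congr 1
  funext s
  simp [map_list_prod, List.map_map, Function.comp_def]

theorem IsMultilinear.perm {n N : ℕ} {u : Fin n → List (Fin N)} (hu : IsMultilinear u)
    (σ : Equiv.Perm (Fin N)) : IsMultilinear fun s => (u s).map σ := by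
  intro i
  rw [← hu (σ.symm i)]
  refine Finset.sum_congr rfl fun s _ => ?_
  conv_lhs => rw [← σ.apply_symm_apply i]
  exact List.count_map_of_injective _ _ σ.injective _

theorem permTensor_mem {n N : ℕ} (σ : Equiv.Perm (Fin N)) :
    ∀ x ∈ multilinearPart n N, permTensor σ x ∈ multilinearPart n N := by
  intro x hx
  induction hx using Submodule.span_induction with
  | mem x hx =>
    obtain ⟨u, hu, rfl⟩ := hx
    rw [permTensor_monomial]
    exact Submodule.subset_span ⟨_, hu.perm σ, rfl⟩
  | zero => simp
  | add x y _ _ h1 h2 => rw [map_add]; exact add_mem h1 h2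
  | smul c x _ h => rw [map_smul]; exact Submodule.smul_mem _ _ h

theorem permTensor_one {n N : ℕ} :
    permTensor (n := n) (1 : Equiv.Perm (Fin N)) = LinearMap.id := by
  have : FreeAlgebra.lift ℚ (fun i : Fin N => FreeAlgebra.ι ℚ ((1 : Equiv.Perm (Fin N)) i)) =
      AlgHom.id ℚ _ := by ext; simp
  simp only [permTensor, this]
  exact PiTensorProduct.map_id

theorem permTensor_mul {n N : ℕ} (σ τ : Equiv.Perm (Fin N)) :
    permTensor (n := n) (σ * τ) = permTensor σ ∘ₗ permTensor τ := by
  have : FreeAlgebra.lift ℚ (fun i : Fin N => FreeAlgebra.ι ℚ ((σ * τ) i)) =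
      (FreeAlgebra.lift ℚ (fun i => FreeAlgebra.ι ℚ (σ i))).comp
      (FreeAlgebra.lift ℚ (fun i => FreeAlgebra.ι ℚ (τ i))) := by ext; simp
  simp only [permTensor, this, ← PiTensorProduct.map_comp]
  rfl

/-- The multilinear part `((FA_N)^{⊗ n})_{δ_1 + ⋯ + δ_N}`, as a rational vector space. -/
def FAMult (n N : ℕ) : Type := multilinearPart n N

noncomputable instance (n N : ℕ) : AddCommGroup (FAMult n N) :=
  inferInstanceAs (AddCommGroup (multilinearPart n N))

noncomputable instance (n N : ℕ) : Module ℚ (FAMult n N) :=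
  inferInstanceAs (Module ℚ (multilinearPart n N))

/-- The inclusion of the multilinear part in `(FA_N)^{⊗ n}`. -/
noncomputable def FAMult.incl (n N : ℕ) :
    FAMult n N →ₗ[ℚ] ⨂[ℚ] _ : Fin n, FreeAlgebra ℚ (Fin N) :=
  (multilinearPart n N).subtype

theorem FAMult.incl_injective (n N : ℕ) : Function.Injective (FAMult.incl n N) :=
  Subtype.val_injective

/-- The representation of `𝔖_N` on the multilinear part, by permutation of the generators. -/
noncomputable def permRep (n N : ℕ) : Representation ℚ (Equiv.Perm (Fin N)) (FAMult n N) where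
  toFun σ := (permTensor σ).restrict (permTensor_mem σ)
  map_one' := by
    apply LinearMap.ext
    intro x
    exact Subtype.ext (LinearMap.congr_fun permTensor_one x.1)
  map_mul' σ τ := by
    apply LinearMap.ext
    intro x
    exact Subtype.ext (LinearMap.congr_fun (permTensor_mul σ τ) x.1)

/-- The degree `N` part of `U_n^univ`: the coinvariants of the diagonal action of `𝔖_N`. -/
abbrev UnivDeg (n N : ℕ) : Type :=
  Representation.Coinvariants ((permRep n N).tprod (permRep n N))

/-- The graded vector space `U_n^univ`. -/
def Univ (n : ℕ) : Type := ⨁ N, UnivDeg n N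

noncomputable instance (n : ℕ) : AddCommGroup (Univ n) :=
  inferInstanceAs (AddCommGroup (⨁ N, UnivDeg n N))

noncomputable instance (n : ℕ) : Module ℚ (Univ n) :=
  inferInstanceAs (Module ℚ (⨁ N, UnivDeg n N))

/-- The multilinear tuples of words, as a type. -/
abbrev MWord (n N : ℕ) : Type := {u : Fin n → List (Fin N) // IsMultilinear u}

noncomputable def MWord.mono {n N : ℕ} (u : MWord n N) : FAMult n N :=
  ⟨monomial u.1, Submodule.subset_span ⟨u.1, u.2, rfl⟩⟩

def MWord.perm {n N : ℕ} (σ : Equiv.Perm (Fin N)) (u : MWord n N) : MWord n N :=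
  ⟨_, u.2.perm σ⟩

theorem permRep_mono {n N : ℕ} (σ : Equiv.Perm (Fin N)) (u : MWord n N) :
    permRep n N σ u.mono = (u.perm σ).mono :=
  Subtype.ext (permTensor_monomial σ u.1)

theorem basisFreeMonoid_ofList {N : ℕ} (l : List (Fin N)) :
    FreeAlgebra.basisFreeMonoid ℚ (Fin N) (FreeMonoid.ofList l) =
      (l.map (FreeAlgebra.ι ℚ)).prod := by
  simp [FreeAlgebra.basisFreeMonoid, FreeAlgebra.equivMonoidAlgebraFreeMonoid,
    FreeMonoid.lift_apply]

theorem linearIndependent_monomial (n N : ℕ) :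
    LinearIndependent ℚ (monomial : (Fin n → List (Fin N)) → _) := by
  have h := (Basis.piTensorProduct
    (fun _ : Fin n => FreeAlgebra.basisFreeMonoid ℚ (Fin N))).linearIndependent.comp
    (fun (u : Fin n → List (Fin N)) s => FreeMonoid.ofList (u s))
    (fun u v huv => funext fun s => FreeMonoid.ofList.injective (congrFun huv s))
  have e : (monomial : (Fin n → List (Fin N)) → _) = 
      (Basis.piTensorProduct (fun _ : Fin n => FreeAlgebra.basisFreeMonoid ℚ (Fin N))) ∘
        (fun (u : Fin n → List (Fin N)) s => FreeMonoid.ofList (u s)) := by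
    funext u
    rw [Function.comp_apply, Basis.piTensorProduct_apply, monomial]
    simp only [basisFreeMonoid_ofList]
  rw [e]
  exact h

/-- The tuples of words of multidegree `δ_1 + ⋯ + δ_N` form a basis. -/
noncomputable def monoBasis (n N : ℕ) : Module.Basis (MWord n N) ℚ (FAMult n N) :=
  Module.Basis.mk (v := MWord.mono)
    (by
      have h := (linearIndependent_monomial n N).comp
        (Subtype.val : MWord n N → _) Subtype.val_injective
      exact LinearIndependent.of_comp (FAMult.incl n N) h)
    (by
      rintro ⟨x, hx⟩ -
      induction hx using Submodule.span_induction with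
      | mem x hx =>
        obtain ⟨u, hu, rfl⟩ := hx
        exact Submodule.subset_span ⟨⟨u, hu⟩, rfl⟩
      | zero => exact Submodule.zero_mem _
      | add x y hx hy h1 h2 => exact Submodule.add_mem _ h1 h2
      | smul c x hx h => exact Submodule.smul_mem _ c h)

@[simp]
theorem monoBasis_apply {n N : ℕ} (u : MWord n N) : monoBasis n N u = u.mono := by
  simp [monoBasis]

/-- The class in `U_n^univ` of a pair of `n`-tuples of words. -/
noncomputable def cls {n N : ℕ} (u v : MWord n N) : Univ n :=
  DirectSum.lof ℚ ℕ (UnivDeg n) N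
    (Representation.Coinvariants.mk ((permRep n N).tprod (permRep n N)) (u.mono ⊗ₜ[ℚ] v.mono))

theorem cls_perm {n N : ℕ} (σ : Equiv.Perm (Fin N)) (u v : MWord n N) :
    cls (u.perm σ) (v.perm σ) = cls u v := by
  unfold cls
  congr 1
  rw [← Representation.Coinvariants.mk_self_apply _ σ (u.mono ⊗ₜ[ℚ] v.mono)]
  simp [permRep_mono]

/-- Linear maps out of `U_n^univ` from `𝔖_N`-invariant functions of pairs of tuples of words. -/
noncomputable def liftUniv {n : ℕ} {E : Type*} [AddCommGroup E] [Module ℚ E]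
    (g : ∀ N, MWord n N → MWord n N → E)
    (hg : ∀ N σ u v, g N (u.perm σ) (v.perm σ) = g N u v) : Univ n →ₗ[ℚ] E :=
  DirectSum.toModule ℚ ℕ E fun N =>
    Representation.Coinvariants.lift _
      (TensorProduct.lift ((monoBasis n N).constr ℚ fun u => (monoBasis n N).constr ℚ (g N u)))
      (fun σ => by
        apply ((monoBasis n N).tensorProduct (monoBasis n N)).ext
        rintro ⟨u, v⟩
        have h : ∀ u v : MWord n N,
            ((monoBasis n N).constr ℚ fun u => (monoBasis n N).constr ℚ (g N u)) u.mono v.mono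
              = g N u v := by
          intro u v
          rw [← monoBasis_apply, ← monoBasis_apply, Module.Basis.constr_basis,
            Module.Basis.constr_basis]
        simp [permRep_mono, h, hg])

theorem liftUniv_cls {n : ℕ} {E : Type*} [AddCommGroup E] [Module ℚ E]
    (g : ∀ N, MWord n N → MWord n N → E) (hg) {N : ℕ} (u v : MWord n N) :
    liftUniv g hg (cls u v) = g N u v := by
  unfold liftUniv cls
  erw [DirectSum.toModule_lof]
  rw [Representation.Coinvariants.lift_mk, TensorProduct.lift.tmul, ← monoBasis_apply,
    ← monoBasis_apply, Module.Basis.constr_basis, Module.Basis.constr_basis]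

theorem Univ.hom_ext {n : ℕ} {E : Type*} [AddCommGroup E] [Module ℚ E] {f g : Univ n →ₗ[ℚ] E}
    (h : ∀ (N : ℕ) (u v : MWord n N), f (cls u v) = g (cls u v)) : f = g := by
  apply DirectSum.linearMap_ext
  intro N
  apply Representation.Coinvariants.hom_ext
  apply ((monoBasis n N).tensorProduct (monoBasis n N)).ext
  rintro ⟨u, v⟩
  rw [Module.Basis.tensorProduct_apply, monoBasis_apply, monoBasis_apply]
  exact h N u v


/-! ### Words in the letters `a_i`, `b_i` and moves of letters

The class of `(u_1 ⊗ ⋯ ⊗ u_n) ⊗ (v_1 ⊗ ⋯ ⊗ v_n)` in `U_n^univ` stands for the universal expression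
`∑ u_1(a) v_1(b) ⊗ ⋯ ⊗ u_n(a) v_n(b)` in `A^{⊗ n}`, where `r = ∑ a_i ⊗ b_i` is a solution of the
classical Yang-Baxter equation in `A ⊗ A`; the letters `a_i` and `b_i` with the same label `i` come
from the same copy of `r`. To multiply two such expressions one concatenates them slot by slot, and
moves all letters `a` to the left of all letters `b`. The Yang-Baxter equation
`[r_12, r_13] + [r_12, r_23] + [r_13, r_23] = 0` for the copies `i` and `j` of `r` reads
`[a_i, a_j] ⊗ b_i ⊗ b_j + a_i ⊗ [b_i, a_j] ⊗ b_j + a_i ⊗ a_j ⊗ [b_i, b_j] = 0`,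
which gives the reordering rule
`b_i a_j = a_j b_i - {a_i ↦ [a_i, a_j]} b_i - a_j {b_j ↦ [b_i, b_j]}`.
A family of words in the letters `a_i`, `b_i`, indexed by the slots, represents a pure tensor.
-/

/-- The letters `a_1, …, a_N` and `b_1, …, b_N`. -/
inductive Letter (N : ℕ) : Type
  | a (i : Fin N) : Letter N
  | b (i : Fin N) : Letter N
  deriving DecidableEq, Fintype

/-- Substitute words for letters in a family of words. -/
def expand {κ α β : Type} (θ : α → List β) (w : κ → List α) : κ → List β :=
  fun s => (w s).flatMap θ

/-- Erase the letter `y`, and replace the letter `x` by the word `t`. -/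
def replace {κ α : Type} [DecidableEq α] (x y : α) (t : List α) (w : κ → List α) : κ → List α :=
  expand (fun z => if z = y then [] else if z = x then t else [z]) w

/-- Move the letter `y` to the place immediately after the letter `x`. -/
abbrev putAfter {κ α : Type} [DecidableEq α] (x y : α) (w : κ → List α) : κ → List α :=
  replace x y [x, y] w

/-- Move the letter `y` to the place immediately before the letter `x`. -/
abbrev putBefore {κ α : Type} [DecidableEq α] (x y : α) (w : κ → List α) : κ → List α :=
  replace x y [y, x] w

/-- Words that are put into normal order: every letter occurs exactly once, and `b_i` may
stand to the left of `a_j` in the same slot only if `i < j`. This class contains the concatenation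
of any two normally ordered words (the labels of the second word being shifted upwards), it is
preserved by the reordering rule, and the rule terminates on it. -/
structure Good {n N : ℕ} (w : Fin n → List (Letter N)) : Prop where
  count : ∀ x, ∑ s, (w s).count x = 1
  order : ∀ s i j, List.Sublist [.b i, .a j] (w s) → i < j

/-- In some slot `b_i` is immediately followed by `a_j`. For words in which every letter occurs
exactly once this says that taking `a_j` out and putting it back immediately after `b_i` does not
change the word. -/
def Redex {n N : ℕ} (i j : Fin N) (w : Fin n → List (Letter N)) : Prop :=
  putAfter (.b i) (.a j) w = w

theorem expand_expand {κ α β γ : Type} (θ : α → List β) (η : β → List γ) (w : κ → List α) :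
    expand η (expand θ w) = expand (fun z => (θ z).flatMap η) w := by
  funext s
  exact List.flatMap_assoc

theorem expand_singleton {κ α : Type} (w : κ → List α) : expand (fun z => [z]) w = w := by
  funext s
  simp [expand]

theorem pair_sublist_append {α : Type} {p q : α} {l m : List α}
    (h : List.Sublist [p, q] (l ++ m)) :
    List.Sublist [p, q] l ∨ (p ∈ l ∧ q ∈ m) ∨ List.Sublist [p, q] m := by
  obtain ⟨l1, l2, e, h1, h2⟩ := List.sublist_append_iff.1 h
  match l1, e with
  | [], e => simp at e; subst e; exact Or.inr (Or.inr h2)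
  | [x], e => 
    simp at e; obtain ⟨rfl, rfl⟩ := e
    exact Or.inr (Or.inl ⟨by simpa using h1, by simpa using h2⟩)
  | [x, y], e => simp at e; obtain ⟨rfl, rfl, rfl⟩ := e; exact Or.inl h1
  | x :: y :: z :: t, e => simp at e

theorem pair_sublist_flatMap {α β : Type} {p q : β} {θ : α → List β} :
    ∀ {l : List α}, List.Sublist [p, q] (l.flatMap θ) →
    (∃ x, List.Sublist [p, q] (θ x)) ∨
      ∃ x y, List.Sublist [x, y] l ∧ p ∈ θ x ∧ q ∈ θ y
  | [], h => by simp at h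
  | x :: l, h => by
    rw [List.flatMap_cons] at h
    rcases pair_sublist_append h with h | ⟨h1, h2⟩ | h
    · exact Or.inl ⟨x, h⟩
    · obtain ⟨y, hy, hq⟩ := List.mem_flatMap.1 h2
      exact Or.inr ⟨x, y, (List.singleton_sublist.2 hy).cons_cons x, h1, hq⟩
    · rcases pair_sublist_flatMap h with h | ⟨y, z, h, hp, hq⟩
      · exact Or.inl h
      · exact Or.inr ⟨y, z, h.cons x, hp, hq⟩

theorem sublist_flatMap {α β : Type} {θ : α → List β} {l m : List α} (h : List.Sublist l m) :
    List.Sublist (l.flatMap θ) (m.flatMap θ) := by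
  induction h with
  | slnil => exact List.Sublist.refl _
  | cons a _ ih =>
    rw [List.flatMap_cons]; exact ih.trans (List.sublist_append_right _ _)
  | cons_cons a _ ih =>
    rw [List.flatMap_cons, List.flatMap_cons]; exact (List.Sublist.refl _).append ih

section Counting

variable {n N : ℕ}

theorem sum_map_eq_sum_count {α : Type} [DecidableEq α] [Fintype α] (l : List α) (g : α → ℕ) :
    (l.map g).sum = ∑ x, l.count x * g x := by
  induction l with
  | nil => simp
  | cons a l ih =>
    simp only [List.map_cons, List.sum_cons, ih, List.count_cons, add_mul, Finset.sum_add_distrib]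
    simp [add_comm]

theorem count_expand {w : Fin n → List (Letter N)} (hw : ∀ x, ∑ s, (w s).count x = 1)
    (θ : Letter N → List (Letter N)) (z : Letter N) :
    ∑ s, (expand θ w s).count z = ∑ x, (θ x).count z := by
  simp only [expand, List.count_flatMap, sum_map_eq_sum_count]
  rw [Finset.sum_comm]
  refine Finset.sum_congr rfl fun x _ => ?_
  rw [← Finset.sum_mul]
  erw [hw]
  rw [one_mul]
  rfl

theorem count_replace {w : Fin n → List (Letter N)} (hw : ∀ x, ∑ s, (w s).count x = 1)
    {x y : Letter N} (hxy : x ≠ y) {t : List (Letter N)} (ht : t = [x, y] ∨ t = [y, x])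
    (z : Letter N) : ∑ s, (replace x y t w s).count z = 1 := by
  rw [replace, count_expand hw]
  have hc : ∀ z, t.count z = (if z = x then 1 else 0) + (if z = y then 1 else 0) := by
    intro z
    rcases ht with rfl | rfl <;>
      simp only [List.count_cons, List.count_nil, beq_iff_eq, eq_comm (a := z)] <;> omega
  by_cases hz : z = y
  · subst hz
    rw [Finset.sum_eq_single x]
    · simp [hxy, hc, hxy.symm]
    · intro b _ hb
      by_cases h : b = z <;> simp [h, hb]
    · simp
  · rw [Finset.sum_eq_single z]
    · by_cases h : z = x <;> simp [hz, h, hc, hxy]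
    · intro b _ hb
      by_cases h : b = y
      · simp [h]
      · by_cases h' : b = x
        · subst h'; simp [h, hc, hb.symm, hz]
        · simp [h, h', hb]
    · simp

/-- The inversions of a word. -/
noncomputable def inv (w : Fin n → List (Letter N)) : Finset (Fin N × Fin N) := by
  classical exact Finset.univ.filter fun p => ∃ s, List.Sublist [.b p.1, .a p.2] (w s)

theorem mem_inv {w : Fin n → List (Letter N)} {p : Fin N × Fin N} :
    p ∈ inv w ↔ ∃ s, List.Sublist [.b p.1, .a p.2] (w s) := by
  simp [inv]

theorem Good.lt {w : Fin n → List (Letter N)} (hw : Good w) {p : Fin N × Fin N}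
    (hp : p ∈ inv w) : p.1 < p.2 := by
  obtain ⟨s, hs⟩ := mem_inv.1 hp
  exact hw.order s _ _ hs

theorem Good.exists_mem {w : Fin n → List (Letter N)} (hw : Good w) (x : Letter N) :
    ∃ s, x ∈ w s := by
  by_contra h
  push Not at h
  have := hw.count x
  rw [Finset.sum_eq_zero (fun s _ => List.count_eq_zero.2 (h s))] at this
  omega

theorem Good.count_le {w : Fin n → List (Letter N)} (hw : Good w) (x : Letter N) (s : Fin n) :
    (w s).count x ≤ 1 := by
  rw [← hw.count x]
  exact Finset.single_le_sum (f := fun s => (w s).count x) (fun _ _ => Nat.zero_le _)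
    (Finset.mem_univ s)

theorem Good.slot_unique {w : Fin n → List (Letter N)} (hw : Good w) {x : Letter N} {s t : Fin n}
    (hs : x ∈ w s) (ht : x ∈ w t) : s = t := by
  by_contra h
  have h1 := hw.count x
  have h2 := Finset.add_le_sum (f := fun s => (w s).count x) (s := Finset.univ)
    (fun _ _ => Nat.zero_le _) (Finset.mem_univ s) (Finset.mem_univ t) h
  have h3 := List.count_pos_iff.2 hs
  have h4 := List.count_pos_iff.2 ht
  omega

theorem Redex.mem_inv {w : Fin n → List (Letter N)} (hw : Good w) {i j : Fin N}
    (h : Redex i j w) : (i, j) ∈ inv w := by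
  obtain ⟨s, hs⟩ := hw.exists_mem (.b i)
  refine UnivYB.mem_inv.2 ⟨s, ?_⟩
  rw [← h]
  have := sublist_flatMap (θ := fun z => if z = .a j then [] else if z = .b i then [.b i, .a j]
    else [z]) (List.singleton_sublist.2 hs)
  exact List.Sublist.trans (by simp) this

/-- The termination measure of normal ordering. -/
noncomputable def weight (w : Fin n → List (Letter N)) : ℕ :=
  ∑ p ∈ inv w, 2 ^ (p.1 : ℕ) * 2 ^ (N - p.2 : ℕ)

theorem sum_pow_lt (i : Fin N) :
    ∑ k ∈ Finset.univ.filter (fun k : Fin N => k < i), 2 ^ (k : ℕ) < 2 ^ (i : ℕ) := by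
  have := Nat.geomSum_lt (m := 2) (n := i)
    (s := (Finset.univ.filter (fun k : Fin N => k < i)).map Fin.valEmbedding) le_rfl (by simp)
  simpa using this

theorem sum_pow_sub_lt (j : Fin N) :
    ∑ k ∈ Finset.univ.filter (fun k : Fin N => j < k), 2 ^ (N - k : ℕ) < 2 ^ (N - j : ℕ) := by
  have := Nat.geomSum_lt (m := 2) (n := N - j)
    (s := (Finset.univ.filter (fun k : Fin N => j < k)).map
      ⟨fun k : Fin N => N - (k : ℕ), fun a b h => by
        have := a.2; have := b.2; ext; dsimp only at h; omega⟩) le_rfl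
    (by
      simp only [Finset.mem_map, Finset.mem_filter, Finset.mem_univ, true_and]
      rintro _ ⟨a, ha, rfl⟩
      have h1 := a.2
      have h2 : (j : ℕ) < a := ha
      change N - (a : ℕ) < _
      omega)
  rw [Finset.sum_map] at this
  exact this

theorem weight_lt {w w' : Fin n → List (Letter N)} {p : Fin N × Fin N} (hp : p ∈ inv w)
    (T : Finset (Fin N × Fin N)) (hT : ∑ q ∈ T, 2 ^ (q.1 : ℕ) * 2 ^ (N - q.2 : ℕ) <
      2 ^ (p.1 : ℕ) * 2 ^ (N - p.2 : ℕ))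
    (h : ∀ q ∈ inv w', (q ∈ inv w ∧ q ≠ p) ∨ q ∈ T) : weight w' < weight w := by
  have h1 : inv w' ⊆ (inv w).erase p ∪ T := by
    intro q hq
    rw [Finset.mem_union, Finset.mem_erase]
    have := h q hq
    tauto
  have h2 := Finset.add_sum_erase (inv w)
    (fun q : Fin N × Fin N => 2 ^ (q.1 : ℕ) * 2 ^ (N - q.2 : ℕ)) hp
  unfold weight
  rw [← h2]
  calc _ ≤ ∑ q ∈ (inv w).erase p ∪ T, 2 ^ (q.1 : ℕ) * 2 ^ (N - q.2 : ℕ) :=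
        Finset.sum_le_sum_of_subset h1
    _ ≤ ∑ q ∈ (inv w).erase p, 2 ^ (q.1 : ℕ) * 2 ^ (N - q.2 : ℕ) +
        ∑ q ∈ T, 2 ^ (q.1 : ℕ) * 2 ^ (N - q.2 : ℕ) := by
        rw [← Finset.sum_union_inter]; exact Nat.le_add_right _ _
    _ < _ := by rw [add_comm]; exact Nat.add_lt_add_right hT _

theorem step_swap {w : Fin n → List (Letter N)} (hw : Good w) {i j : Fin N} (h : Redex i j w) :
    Good (putBefore (.b i) (.a j) w) ∧ weight (putBefore (.b i) (.a j) w) < weight w := by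
  have hij := hw.lt (h.mem_inv hw)
  have key : ∀ q ∈ inv (putBefore (.b i) (.a j) w), q ∈ inv w ∧ q ≠ (i, j) := by
    rintro ⟨k, l⟩ hq
    obtain ⟨s, hs⟩ := mem_inv.1 hq
    rcases pair_sublist_flatMap hs with ⟨x, hx⟩ | ⟨x, y, hxy, hx, hy⟩
    · exfalso
      split_ifs at hx
      · simp at hx
      · have := List.Sublist.eq_of_length hx rfl
        simp at this
      · exact absurd hx.length_le (by simp)
    · have hx' : x = .b k := by
        split_ifs at hx <;> simp_all
      subst hx'
      have hy' : (y = .a l ∧ l ≠ j) ∨ (y = .b i ∧ l = j) := by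
        split_ifs at hy with h1 h2
        · simp at hy
        · simp at hy; exact Or.inr ⟨h2, hy⟩
        · simp at hy; subst hy; exact Or.inl ⟨rfl, by simpa using h1⟩
      rcases hy' with ⟨rfl, hl⟩ | ⟨rfl, rfl⟩
      · exact ⟨mem_inv.2 ⟨s, hxy⟩, by simp [hl]⟩
      · have hki : k ≠ i := by
          rintro rfl
          have := hxy.count_le (.b k)
          have := hw.count_le (.b k) s
          simp only [List.count_cons_self, List.count_nil] at *
          omega
        refine ⟨mem_inv.2 ⟨s, ?_⟩, by simp [hki]⟩
        rw [← h]
        have := sublist_flatMap (θ := fun z => if z = .a l then [] else if z = .b i then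
          [.b i, .a l] else [z]) hxy
        refine List.Sublist.trans ?_ this
        simp [hki]
  refine ⟨⟨count_replace hw.count (by simp) (Or.inr rfl), fun s k l hs => ?_⟩, ?_⟩
  · exact hw.lt (key (k, l) (mem_inv.2 ⟨s, hs⟩)).1
  · exact weight_lt (h.mem_inv hw) ∅ (by simp) fun q hq => Or.inl (key q hq)

theorem step_left {w : Fin n → List (Letter N)} (hw : Good w) {i j : Fin N} (h : Redex i j w)
    {t : List (Letter N)} (ht : t = [.a i, .a j] ∨ t = [.a j, .a i]) :
    Good (replace (.a i) (.a j) t w) ∧ weight (replace (.a i) (.a j) t w) < weight w := by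
  have hij := hw.lt (h.mem_inv hw)
  have hmt : ∀ x, x ∈ t ↔ x = .a i ∨ x = .a j := by
    intro x; rcases ht with rfl | rfl <;> simp [or_comm]
  have key : ∀ q ∈ inv (replace (.a i) (.a j) t w),
      (q ∈ inv w ∧ q.2 ≠ j) ∨ (q.2 = j ∧ (q.1, i) ∈ inv w) := by
    rintro ⟨k, l⟩ hq
    obtain ⟨s, hs⟩ := mem_inv.1 hq
    rcases pair_sublist_flatMap hs with ⟨x, hx⟩ | ⟨x, y, hxy, hx, hy⟩
    · exfalso
      split_ifs at hx
      · simp at hx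
      · have := hx.subset (List.mem_cons_self)
        rw [hmt] at this
        simp at this
      · exact absurd hx.length_le (by simp)
    · have hx' : x = .b k := by
        split_ifs at hx
        · simp at hx
        · rw [hmt] at hx; simp at hx
        · simp at hx; exact hx.symm
      subst hx'
      have hy' : (y = .a l ∧ l ≠ j) ∨ (y = .a i ∧ l = j) := by
        split_ifs at hy with h1 h2
        · simp at hy
        · rw [hmt] at hy
          subst h2
          have hne : i ≠ j := hij.ne
          simp at hy
          rcases hy with rfl | rfl
          · exact Or.inl ⟨rfl, hne⟩
          · exact Or.inr ⟨rfl, rfl⟩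
        · simp at hy; subst hy; exact Or.inl ⟨rfl, by simpa using h1⟩
      rcases hy' with ⟨rfl, hl⟩ | ⟨rfl, rfl⟩
      · exact Or.inl ⟨mem_inv.2 ⟨s, hxy⟩, hl⟩
      · exact Or.inr ⟨rfl, mem_inv.2 ⟨s, hxy⟩⟩
  refine ⟨⟨count_replace hw.count (by simpa using hij.ne) ht, fun s k l hs => ?_⟩, ?_⟩
  · rcases key (k, l) (mem_inv.2 ⟨s, hs⟩) with ⟨h1, -⟩ | ⟨h1, h2⟩
    · exact hw.lt h1
    · simp at h1; subst h1; exact (hw.lt h2).trans hij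
  · refine weight_lt (h.mem_inv hw)
      ((Finset.univ.filter (fun k : Fin N => k < i)).map ⟨fun k => (k, j), fun a b h => by
        simpa using h⟩) ?_ fun q hq => ?_
    · rw [Finset.sum_map]
      change ∑ k ∈ Finset.univ.filter (fun k : Fin N => k < i), 2 ^ (k : ℕ) * 2 ^ (N - j : ℕ) < _
      rw [← Finset.sum_mul]
      exact Nat.mul_lt_mul_of_pos_right (sum_pow_lt i) (Nat.two_pow_pos _)
    · rcases key q hq with ⟨h1, h2⟩ | ⟨h1, h2⟩
      · exact Or.inl ⟨h1, fun h => h2 (by rw [h])⟩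
      · right
        have := hw.lt h2
        simp only [Finset.mem_map, Finset.mem_filter, Finset.mem_univ, true_and]
        exact ⟨q.1, this, Prod.ext rfl h1.symm⟩

theorem step_right {w : Fin n → List (Letter N)} (hw : Good w) {i j : Fin N} (h : Redex i j w)
    {t : List (Letter N)} (ht : t = [.b j, .b i] ∨ t = [.b i, .b j]) :
    Good (replace (.b j) (.b i) t w) ∧ weight (replace (.b j) (.b i) t w) < weight w := by
  have hij := hw.lt (h.mem_inv hw)
  have hmt : ∀ x, x ∈ t ↔ x = .b i ∨ x = .b j := by
    intro x; rcases ht with rfl | rfl <;> simp [or_comm]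
  have key : ∀ q ∈ inv (replace (.b j) (.b i) t w),
      (q ∈ inv w ∧ q.1 ≠ i) ∨ (q.1 = i ∧ (j, q.2) ∈ inv w) := by
    rintro ⟨k, l⟩ hq
    obtain ⟨s, hs⟩ := mem_inv.1 hq
    rcases pair_sublist_flatMap hs with ⟨x, hx⟩ | ⟨x, y, hxy, hx, hy⟩
    · exfalso
      split_ifs at hx
      · simp at hx
      · have := hx.subset (List.mem_cons_of_mem _ (List.mem_cons_self))
        rw [hmt] at this
        simp at this
      · exact absurd hx.length_le (by simp)
    · have hy' : y = .a l := by
        split_ifs at hy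
        · simp at hy
        · rw [hmt] at hy; simp at hy
        · simp at hy; exact hy.symm
      subst hy'
      have hx' : (x = .b k ∧ k ≠ i) ∨ (x = .b j ∧ k = i) := by
        split_ifs at hx with h1 h2
        · simp at hx
        · rw [hmt] at hx
          subst h2
          have hne : i ≠ j := hij.ne
          simp at hx
          rcases hx with rfl | rfl
          · exact Or.inr ⟨rfl, rfl⟩
          · exact Or.inl ⟨rfl, hne.symm⟩
        · simp at hx; subst hx; exact Or.inl ⟨rfl, by simpa using h1⟩
      rcases hx' with ⟨rfl, hl⟩ | ⟨rfl, rfl⟩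
      · exact Or.inl ⟨mem_inv.2 ⟨s, hxy⟩, hl⟩
      · exact Or.inr ⟨rfl, mem_inv.2 ⟨s, hxy⟩⟩
  refine ⟨⟨count_replace hw.count (by simpa using hij.ne.symm) ht, fun s k l hs => ?_⟩, ?_⟩
  · rcases key (k, l) (mem_inv.2 ⟨s, hs⟩) with ⟨h1, -⟩ | ⟨h1, h2⟩
    · exact hw.lt h1
    · simp at h1; subst h1; exact hij.trans (hw.lt h2)
  · refine weight_lt (h.mem_inv hw)
      ((Finset.univ.filter (fun k : Fin N => j < k)).map ⟨fun k => (i, k), fun a b h => by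
        simpa using h⟩) ?_ fun q hq => ?_
    · rw [Finset.sum_map]
      change ∑ k ∈ Finset.univ.filter (fun k : Fin N => j < k), 2 ^ (i : ℕ) * 2 ^ (N - k : ℕ) < _
      rw [← Finset.mul_sum]
      exact Nat.mul_lt_mul_of_pos_left (sum_pow_sub_lt j) (Nat.two_pow_pos _)
    · rcases key q hq with ⟨h1, h2⟩ | ⟨h1, h2⟩
      · exact Or.inl ⟨h1, fun h => h2 (by rw [h])⟩
      · right
        have := hw.lt h2
        simp only [Finset.mem_map, Finset.mem_filter, Finset.mem_univ, true_and]
        exact ⟨q.2, this, Prod.ext h1.symm rfl⟩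

end Counting

/-! ### Normal ordering -/

/-- The word formed by the letters `a`. -/
def aPart {n N : ℕ} (w : Fin n → List (Letter N)) : Fin n → List (Fin N) :=
  fun s => (w s).filterMap fun | .a i => some i | .b _ => none

/-- The word formed by the letters `b`. -/
def bPart {n N : ℕ} (w : Fin n → List (Letter N)) : Fin n → List (Fin N) :=
  fun s => (w s).filterMap fun | .a _ => none | .b i => some i

theorem Good.aPart {n N : ℕ} {w : Fin n → List (Letter N)} (hw : Good w) :
    IsMultilinear (aPart w) := by
  intro i
  rw [← hw.count (.a i)]
  refine Finset.sum_congr rfl fun s _ => ?_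
  unfold UnivYB.aPart
  induction w s with
  | nil => rfl
  | cons x l ih => cases x <;> simp [List.count_cons, ih]

theorem Good.bPart {n N : ℕ} {w : Fin n → List (Letter N)} (hw : Good w) :
    IsMultilinear (bPart w) := by
  intro i
  rw [← hw.count (.b i)]
  refine Finset.sum_congr rfl fun s _ => ?_
  unfold UnivYB.bPart
  induction w s with
  | nil => rfl
  | cons x l ih => cases x <;> simp [List.count_cons, ih]

/-- The function `f`, extended by linearity to sums of words, at the right-hand side of the
reordering rule `b_i a_j = a_j b_i - {a_i ↦ [a_i, a_j]} b_i - a_j {b_j ↦ [b_i, b_j]}`: in the second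
term `a_j` is taken out of its place and `a_i` is replaced, where it stands, by
`a_i a_j - a_j a_i`; in the third term `b_i` is taken out of its place and `b_j` is replaced,
where it stands, by `b_i b_j - b_j b_i`. -/
def ruleSum {n N : ℕ} {E : Type*} [AddCommGroup E] (f : (Fin n → List (Letter N)) → E)
    (i j : Fin N) (w : Fin n → List (Letter N)) : E :=
  f (putBefore (.b i) (.a j) w)
    - (f (putAfter (.a i) (.a j) w) - f (putBefore (.a i) (.a j) w))
    - (f (putBefore (.b j) (.b i) w) - f (putAfter (.b j) (.b i) w))

open Classical in
/-- Normal ordering: as long as some `b_i` is immediately followed by some `a_j`, apply the rule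
`b_i a_j = a_j b_i - {a_i ↦ [a_i, a_j]} b_i - a_j {b_j ↦ [b_i, b_j]}`; if all letters `a` are to the
left of all letters `b` in every slot, take the class in `U_n^univ`. The result does not depend on
the choice of `i` and `j`, see `normalOrder_rule`. The value on words that are not `Good` is junk and
never used. -/
noncomputable def normalOrder {n N : ℕ} (w : Fin n → List (Letter N)) : Univ n :=
  if hw : Good w then
    if h : ∃ p : Fin N × Fin N, Redex p.1 p.2 w then
      normalOrder (putBefore (.b h.choose.1) (.a h.choose.2) w)
        - (normalOrder (putAfter (.a h.choose.1) (.a h.choose.2) w)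
          - normalOrder (putBefore (.a h.choose.1) (.a h.choose.2) w))
        - (normalOrder (putBefore (.b h.choose.2) (.b h.choose.1) w)
          - normalOrder (putAfter (.b h.choose.2) (.b h.choose.1) w))
    else cls ⟨aPart w, hw.aPart⟩ ⟨bPart w, hw.bPart⟩
  else 0
termination_by weight w
decreasing_by
  · exact (step_swap hw h.choose_spec).2
  · exact (step_left hw h.choose_spec (Or.inl rfl)).2
  · exact (step_left hw h.choose_spec (Or.inr rfl)).2
  · exact (step_right hw h.choose_spec (Or.inr rfl)).2
  · exact (step_right hw h.choose_spec (Or.inl rfl)).2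

theorem normalOrder_irred {n N : ℕ} {w : Fin n → List (Letter N)} (hw : Good w)
    (h : ¬ ∃ p : Fin N × Fin N, Redex p.1 p.2 w) :
    normalOrder w = cls ⟨aPart w, hw.aPart⟩ ⟨bPart w, hw.bPart⟩ := by
  rw [normalOrder, dif_pos hw, dif_neg h]

theorem normalOrder_choice {n N : ℕ} {w : Fin n → List (Letter N)} (hw : Good w)
    (h : ∃ p : Fin N × Fin N, Redex p.1 p.2 w) :
    ∃ i j, Redex i j w ∧ normalOrder w = ruleSum normalOrder i j w :=
  ⟨_, _, h.choose_spec, by rw [normalOrder, dif_pos hw, dif_pos h]; rfl⟩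

/-! ### Confluence -/

def Letter.map {m N : ℕ} (e : Fin m → Fin N) : Letter m → Letter N
  | .a i => .a (e i)
  | .b i => .b (e i)

theorem Letter.map_injective {m N : ℕ} {e : Fin m → Fin N} (he : Function.Injective e) :
    Function.Injective (Letter.map e) := by
  intro x y h
  cases x <;> cases y <;> simp_all [Letter.map, he.eq_iff]

/-- Rename the labels of all letters. -/
def relabel {κ : Type} {m N : ℕ} (e : Fin m → Fin N) (w : κ → List (Letter m)) :
    κ → List (Letter N) :=
  fun s => (w s).map (Letter.map e)

open Classical in
/-- Substitution in `w` for the letters with labels in the range of `e`. -/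
noncomputable def instWord {n m N : ℕ} (e : Fin m → Fin N) (w : Fin n → List (Letter N))
    (X : Letter m → List (Letter m)) : Fin n → List (Letter N) :=
  expand (fun z => if h : ∃ y, Letter.map e y = z then (X h.choose).map (Letter.map e) else [z]) w

theorem replace_map {α β : Type} [DecidableEq α] [DecidableEq β] {f : α → β}
    (hf : Function.Injective f) (x y : α) (t l : List α) :
    (l.map f).flatMap (fun z => if z = f y then [] else if z = f x then t.map f else [z]) =
      (l.flatMap (fun z => if z = y then [] else if z = x then t else [z])).map f := by
  rw [List.flatMap_map, List.map_flatMap]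
  refine List.flatMap_congr fun z _ => ?_
  simp only [hf.eq_iff]
  split_ifs <;> simp

theorem instWord_replace {n m N : ℕ} {e : Fin m → Fin N} (he : Function.Injective e)
    (w : Fin n → List (Letter N)) (X : Letter m → List (Letter m))
    (x y : Letter m) (t : List (Letter m)) :
    replace (Letter.map e x) (Letter.map e y) (t.map (Letter.map e)) (instWord e w X) =
      instWord e w (replace x y t X) := by
  unfold replace
  rw [instWord, expand_expand, instWord]
  congr 1
  funext z
  by_cases h : ∃ y, Letter.map e y = z
  · simp only [dif_pos h]
    exact replace_map (Letter.map_injective he) x y t _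
  · have h1 : z ≠ Letter.map e x := fun hx => h ⟨x, hx.symm⟩
    have h2 : z ≠ Letter.map e y := fun hx => h ⟨y, hx.symm⟩
    simp [dif_neg h, h1, h2]

theorem instWord_id {n m N : ℕ} (e : Fin m → Fin N) (w : Fin n → List (Letter N)) :
    instWord e w (fun z => [z]) = w := by
  conv_rhs => rw [← expand_singleton w]
  unfold instWord
  congr 1
  funext z
  by_cases h : ∃ y, Letter.map e y = z
  · simp only [dif_pos h, List.map_cons, List.map_nil, h.choose_spec]
  · simp only [dif_neg h]

/-- The words obtained from `w` by substitution that are strictly below `w`. -/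
def Below {n m N : ℕ} (e : Fin m → Fin N) (w : Fin n → List (Letter N))
    (X : Letter m → List (Letter m)) : Prop :=
  Good (instWord e w X) ∧ weight (instWord e w X) < weight w

/-- The reordering rule holds for all words strictly below `w`. -/
def RuleBelow {n N : ℕ} (w : Fin n → List (Letter N)) : Prop :=
  ∀ w' : Fin n → List (Letter N), Good w' → weight w' < weight w → ∀ i j, Redex i j w' →
    normalOrder w' = ruleSum normalOrder i j w'

/-- Normal ordering is invariant under relabelling for all words strictly below `w`. -/
def RelabelBelow {n N : ℕ} (w : Fin n → List (Letter N)) : Prop :=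
  ∀ (w' : Fin n → List (Letter N)) (σ : Equiv.Perm (Fin N)), Good w' → weight w' < weight w →
    Good (relabel σ w') → weight (relabel σ w') < weight w →
    normalOrder (relabel σ w') = normalOrder w'

theorem below_relabel {n m N : ℕ} {e : Fin m → Fin N} (he : Function.Injective e)
    {w : Fin n → List (Letter N)} (ih : RelabelBelow w) (τ : Equiv.Perm (Fin m))
    (X X' : Letter m → List (Letter m)) (hX : Below e w X) (hX' : Below e w X')
    (h : relabel τ X = X') :
    normalOrder (instWord e w X) = normalOrder (instWord e w X') := by
  have key : relabel (τ.viaFintypeEmbedding ⟨e, he⟩) (instWord e w X) = instWord e w X' := by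
    have h1 : ∀ x, Letter.map (τ.viaFintypeEmbedding ⟨e, he⟩) (Letter.map e x) =
        Letter.map e (Letter.map τ x) := by
      intro x
      have := fun i => Equiv.Perm.viaFintypeEmbedding_apply_image (e := τ) (f := ⟨e, he⟩) i
      cases x <;> simp_all [Letter.map]
    funext s
    unfold relabel instWord expand
    rw [List.map_flatMap]
    refine List.flatMap_congr fun z _ => ?_
    by_cases hz : ∃ y, Letter.map e y = z
    · simp only [dif_pos hz, ← h, relabel, List.map_map]
      refine List.map_congr_left fun x _ => h1 x
    · simp only [dif_neg hz, List.map_cons, List.map_nil]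
      cases z with
      | a i =>
        have : i ∉ Set.range e := by
          rintro ⟨y, rfl⟩
          exact hz ⟨.a y, rfl⟩
        simp only [Letter.map]
        rw [Equiv.Perm.viaFintypeEmbedding_apply_notMem_range _ _ this]
      | b i =>
        have : i ∉ Set.range e := by
          rintro ⟨y, rfl⟩
          exact hz ⟨.b y, rfl⟩
        simp only [Letter.map]
        rw [Equiv.Perm.viaFintypeEmbedding_apply_notMem_range _ _ this]
  have := ih _ (τ.viaFintypeEmbedding ⟨e, he⟩) hX.1 hX.2
  rw [key] at this
  exact (this hX'.1 hX'.2).symm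

theorem below_step {n m N : ℕ} {e : Fin m → Fin N} (he : Function.Injective e)
    {w : Fin n → List (Letter N)} (X X1 X2 X3 X4 X5 : Letter m → List (Letter m)) (p q : Fin m)
    (hX : Good (instWord e w X) ∧ weight (instWord e w X) ≤ weight w)
    (h : putAfter (.b p) (.a q) X = X ∧ putBefore (.b p) (.a q) X = X1 ∧
      putAfter (.a p) (.a q) X = X2 ∧ putBefore (.a p) (.a q) X = X3 ∧
      putBefore (.b q) (.b p) X = X4 ∧ putAfter (.b q) (.b p) X = X5) :
    (Below e w X1 ∧ Below e w X2 ∧ Below e w X3 ∧ Below e w X4 ∧ Below e w X5) ∧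
      Redex (e p) (e q) (instWord e w X) ∧
      ruleSum normalOrder (e p) (e q) (instWord e w X) =
        normalOrder (instWord e w X1)
          - (normalOrder (instWord e w X2) - normalOrder (instWord e w X3))
          - (normalOrder (instWord e w X4) - normalOrder (instWord e w X5)) := by
  obtain ⟨h0, h1, h2, h3, h4, h5⟩ := h
  have e0 := (instWord_replace he w X (.b p) (.a q) [.b p, .a q]).trans (congrArg _ h0)
  have e1 := (instWord_replace he w X (.b p) (.a q) [.a q, .b p]).trans (congrArg _ h1)
  have e2 := (instWord_replace he w X (.a p) (.a q) [.a p, .a q]).trans (congrArg _ h2)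
  have e3 := (instWord_replace he w X (.a p) (.a q) [.a q, .a p]).trans (congrArg _ h3)
  have e4 := (instWord_replace he w X (.b q) (.b p) [.b p, .b q]).trans (congrArg _ h4)
  have e5 := (instWord_replace he w X (.b q) (.b p) [.b q, .b p]).trans (congrArg _ h5)
  have hr : Redex (e p) (e q) (instWord e w X) := e0
  refine ⟨⟨?_, ?_, ?_, ?_, ?_⟩, hr, ?_⟩
  · have := step_swap hX.1 hr
    unfold Below
    rw [← e1]
    exact ⟨this.1, this.2.trans_le hX.2⟩
  · have := step_left hX.1 hr (Or.inl rfl)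
    unfold Below
    rw [← e2]
    exact ⟨this.1, this.2.trans_le hX.2⟩
  · have := step_left hX.1 hr (Or.inr rfl)
    unfold Below
    rw [← e3]
    exact ⟨this.1, this.2.trans_le hX.2⟩
  · have := step_right hX.1 hr (Or.inr rfl)
    unfold Below
    rw [← e4]
    exact ⟨this.1, this.2.trans_le hX.2⟩
  · have := step_right hX.1 hr (Or.inl rfl)
    unfold Below
    rw [← e5]
    exact ⟨this.1, this.2.trans_le hX.2⟩
  · rw [← e1, ← e2, ← e3, ← e4, ← e5]
    rfl

theorem below_rule {n m N : ℕ} {e : Fin m → Fin N} (he : Function.Injective e)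
    {w : Fin n → List (Letter N)} (ih : RuleBelow w)
    (X X1 X2 X3 X4 X5 : Letter m → List (Letter m)) (p q : Fin m) (hX : Below e w X)
    (h : putAfter (.b p) (.a q) X = X ∧ putBefore (.b p) (.a q) X = X1 ∧
      putAfter (.a p) (.a q) X = X2 ∧ putBefore (.a p) (.a q) X = X3 ∧
      putBefore (.b q) (.b p) X = X4 ∧ putAfter (.b q) (.b p) X = X5) :
    (Below e w X1 ∧ Below e w X2 ∧ Below e w X3 ∧ Below e w X4 ∧ Below e w X5) ∧
      normalOrder (instWord e w X) = normalOrder (instWord e w X1)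
          - (normalOrder (instWord e w X2) - normalOrder (instWord e w X3))
          - (normalOrder (instWord e w X4) - normalOrder (instWord e w X5)) := by
  obtain ⟨h1, h2, h3⟩ := below_step he X X1 X2 X3 X4 X5 p q ⟨hX.1, hX.2.le⟩ h
  exact ⟨h1, (ih _ hX.1 hX.2 _ _ h2).trans h3⟩

/-- A substitution for three labels. -/
def K3 (A P Q B : List (Letter 3)) : Letter 3 → List (Letter 3)
  | .a i => if i = 0 then A else []
  | .b i => if i = 0 then P else if i = 1 then Q else B

/-- A substitution for four labels. -/
def K4 (A A' P B Q B' : List (Letter 4)) : Letter 4 → List (Letter 4)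
  | .a i => if i = 0 then A else if i = 2 then A' else []
  | .b i => if i = 0 then P else if i = 1 then B else if i = 2 then Q else B'

theorem chain_identity {E : Type*} [AddCommGroup E]
    {y0 y1 y2 y3 y4 y5 y6 y7 y8 y9 y10 y11 y12 y13 y14 y15 y16 y17 y18 y19 y20 y21 y22 y23 y24
    y25 y26 y27 y28 y29 y30 y31 y32 y33 y34 y35 y36 y37 y38 y39 y40 y41 y42 y43 y44 y45 y46
    y47 y48 y49 y50 y51 y52 y53 y54 y55 y56 y57 y58 y59 y60 y61 y62 y63 y64 y65 y66 y67 y68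
    y69 y70 y71 y72 y73 y74 : E}
    (e2 : y0 = y10 - (y11 - y12) - (y13 - y14))
    (e3 : y1 = y15 - (y16 - y17) - (y18 - y19))
    (e4 : y2 = y20 - (y21 - y22) - (y23 - y24))
    (e5 : y3 = y25 - (y26 - y27) - (y28 - y29))
    (e6 : y4 = y30 - (y31 - y32) - (y33 - y34))
    (e7 : y5 = y10 - (y15 - y20) - (y35 - y36))
    (e8 : y6 = y37 - (y38 - y39) - (y26 - y40))
    (e9 : y7 = y41 - (y42 - y43) - (y44 - y45))
    (e10 : y8 = y13 - (y18 - y23) - (y46 - y47))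
    (e11 : y9 = y14 - (y19 - y24) - (y48 - y49))
    (e12 : y25 = y35 - (y50 - y51) - (y52 - y53))
    (e13 : y28 = y54 - (y55 - y56) - (y47 - y57))
    (e14 : y29 = y58 - (y59 - y60) - (y61 - y48))
    (e15 : y30 = y36 - (y40 - y62) - (y54 - y58))
    (e16 : y33 = y52 - (y63 - y44) - (y46 - y61))
    (e17 : y34 = y53 - (y64 - y45) - (y57 - y49))
    (e18 : y37 = y11 - (y65 - y66) - (y63 - y64))
    (e19 : y38 = y67 - (y17 - y68) - (y69 - y70))
    (e20 : y39 = y71 - (y72 - y21) - (y73 - y74))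
    (e21 : y41 = y12 - (y67 - y71) - (y27 - y62))
    (e22 : y42 = y65 - (y16 - y72) - (y50 - y31))
    (e23 : y43 = y66 - (y68 - y22) - (y51 - y32))
    (r0 : y55 = y74)
    (r1 : y56 = y70)
    (r2 : y59 = y73)
    (r3 : y60 = y69)
    : y0 - (y1 - y2) - (y3 - y4) =
      y5 - (y6 - y7) - (y8 - y9) := by
  simp only [e2, e3, e4, e5, e6, e7, e8, e9, e10, e11, e12, e13, e14, e15, e16, e17, e18, e19, e20, e21, e22, e23,
    r0, r1, r2, r3]
  abel

theorem confluent_chain {n N : ℕ} {w : Fin n → List (Letter N)} (hw : Good w)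
    (ih : RuleBelow w) (ih' : RelabelBelow w) {i j k : Fin N} (h1 : Redex i j w) (h2 : Redex j k w) :
    ruleSum normalOrder i j w = ruleSum normalOrder j k w := by
  have hij := hw.lt (h1.mem_inv hw)
  have hjk := hw.lt (h2.mem_inv hw)
  have hik := hij.trans hjk
  let e : Fin 3 → Fin N := ![i, j, k]
  have he : Function.Injective e := by
    intro x y h
    fin_cases x <;> fin_cases y <;> simp_all [e, Fin.ext_iff] <;> omega
  have hX : instWord e w (K3 [.a 0] [.b 0, .a 1] [.b 1, .a 2] [.b 2]) = w := by
    have e1 := instWord_replace he w (fun z => [z]) (.b 0) (.a 1) [.b 0, .a 1]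
    have e2 := instWord_replace he w (putAfter (.b 0) (.a 1) (fun z => [z])) (.b 1) (.a 2)
      [.b 1, .a 2]
    rw [instWord_id] at e1
    rw [← e1] at e2
    have e3 : replace (.b 1) (.a 2) [.b 1, .a 2] (putAfter (.b 0) (.a 1) (fun z => [z])) =
      K3 [.a 0] [.b 0, .a 1] [.b 1, .a 2] [.b 2] := by decide
    rw [e3] at e2
    rw [← e2]
    refine Eq.trans ?_ h2
    exact congrArg _ h1
  have s : Good (instWord e w (K3 [.a 0] [.b 0, .a 1] [.b 1, .a 2] [.b 2])) ∧
      weight (instWord e w (K3 [.a 0] [.b 0, .a 1] [.b 1, .a 2] [.b 2])) ≤ weight w := by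
    rw [hX]; exact ⟨hw, le_rfl⟩
  have R0 := @below_step n 3 N e he w
  have R := @below_rule n 3 N e he w ih
  have Q := @below_relabel n 3 N e he w ih' (finRotate 3)
  obtain ⟨⟨s0_0, s0_1, s0_2, s0_3, s0_4⟩, -, e0⟩ := R0 (K3 [.a 0] [.b 0, .a 1] [.b 1, .a 2] [.b 2]) (K3 [.a 0] [.a 1, .b 0] [.b 1, .a 2] [.b 2])
    (K3 [.a 0, .a 1] [.b 0] [.b 1, .a 2] [.b 2])
    (K3 [.a 1, .a 0] [.b 0] [.b 1, .a 2] [.b 2])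
    (K3 [.a 0] [.a 1] [.b 0, .b 1, .a 2] [.b 2])
    (K3 [.a 0] [.a 1] [.b 1, .b 0, .a 2] [.b 2])
    0 1 s (by decide)
  obtain ⟨⟨s1_0, s1_1, s1_2, s1_3, s1_4⟩, -, e1⟩ := R0 (K3 [.a 0] [.b 0, .a 1] [.b 1, .a 2] [.b 2]) (K3 [.a 0] [.b 0, .a 1] [.a 2, .b 1] [.b 2])
    (K3 [.a 0] [.b 0, .a 1, .a 2] [.b 1] [.b 2])
    (K3 [.a 0] [.b 0, .a 2, .a 1] [.b 1] [.b 2])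
    (K3 [.a 0] [.b 0, .a 1] [.a 2] [.b 1, .b 2])
    (K3 [.a 0] [.b 0, .a 1] [.a 2] [.b 2, .b 1])
    1 2 s (by decide)
  obtain ⟨⟨s2_0, s2_1, s2_2, s2_3, s2_4⟩, e2⟩ := R (K3 [.a 0] [.a 1, .b 0] [.b 1, .a 2] [.b 2]) (K3 [.a 0] [.a 1, .b 0] [.a 2, .b 1] [.b 2])
    (K3 [.a 0] [.a 1, .a 2, .b 0] [.b 1] [.b 2])
    (K3 [.a 0] [.a 2, .a 1, .b 0] [.b 1] [.b 2])
    (K3 [.a 0] [.a 1, .b 0] [.a 2] [.b 1, .b 2])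
    (K3 [.a 0] [.a 1, .b 0] [.a 2] [.b 2, .b 1])
    1 2 s0_0 (by decide)
  obtain ⟨⟨s3_0, s3_1, s3_2, s3_3, s3_4⟩, e3⟩ := R (K3 [.a 0, .a 1] [.b 0] [.b 1, .a 2] [.b 2]) (K3 [.a 0, .a 1] [.b 0] [.a 2, .b 1] [.b 2])
    (K3 [.a 0, .a 1, .a 2] [.b 0] [.b 1] [.b 2])
    (K3 [.a 0, .a 2, .a 1] [.b 0] [.b 1] [.b 2])
    (K3 [.a 0, .a 1] [.b 0] [.a 2] [.b 1, .b 2])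
    (K3 [.a 0, .a 1] [.b 0] [.a 2] [.b 2, .b 1])
    1 2 s0_1 (by decide)
  obtain ⟨⟨s4_0, s4_1, s4_2, s4_3, s4_4⟩, e4⟩ := R (K3 [.a 1, .a 0] [.b 0] [.b 1, .a 2] [.b 2]) (K3 [.a 1, .a 0] [.b 0] [.a 2, .b 1] [.b 2])
    (K3 [.a 1, .a 2, .a 0] [.b 0] [.b 1] [.b 2])
    (K3 [.a 2, .a 1, .a 0] [.b 0] [.b 1] [.b 2])
    (K3 [.a 1, .a 0] [.b 0] [.a 2] [.b 1, .b 2])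
    (K3 [.a 1, .a 0] [.b 0] [.a 2] [.b 2, .b 1])
    1 2 s0_2 (by decide)
  obtain ⟨⟨s5_0, s5_1, s5_2, s5_3, s5_4⟩, e5⟩ := R (K3 [.a 0] [.a 1] [.b 0, .b 1, .a 2] [.b 2]) (K3 [.a 0] [.a 1] [.b 0, .a 2, .b 1] [.b 2])
    (K3 [.a 0] [.a 1, .a 2] [.b 0, .b 1] [.b 2])
    (K3 [.a 0] [.a 2, .a 1] [.b 0, .b 1] [.b 2])
    (K3 [.a 0] [.a 1] [.b 0, .a 2] [.b 1, .b 2])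
    (K3 [.a 0] [.a 1] [.b 0, .a 2] [.b 2, .b 1])
    1 2 s0_3 (by decide)
  obtain ⟨⟨s6_0, s6_1, s6_2, s6_3, s6_4⟩, e6⟩ := R (K3 [.a 0] [.a 1] [.b 1, .b 0, .a 2] [.b 2]) (K3 [.a 0] [.a 1] [.b 1, .a 2, .b 0] [.b 2])
    (K3 [.a 0, .a 2] [.a 1] [.b 1, .b 0] [.b 2])
    (K3 [.a 2, .a 0] [.a 1] [.b 1, .b 0] [.b 2])
    (K3 [.a 0] [.a 1] [.b 1, .a 2] [.b 0, .b 2])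
    (K3 [.a 0] [.a 1] [.b 1, .a 2] [.b 2, .b 0])
    0 2 s0_4 (by decide)
  obtain ⟨⟨-, -, -, s7_3, s7_4⟩, e7⟩ := R (K3 [.a 0] [.b 0, .a 1] [.a 2, .b 1] [.b 2]) (K3 [.a 0] [.a 1, .b 0] [.a 2, .b 1] [.b 2])
    (K3 [.a 0, .a 1] [.b 0] [.a 2, .b 1] [.b 2])
    (K3 [.a 1, .a 0] [.b 0] [.a 2, .b 1] [.b 2])
    (K3 [.a 0] [.a 1] [.a 2, .b 0, .b 1] [.b 2])
    (K3 [.a 0] [.a 1] [.a 2, .b 1, .b 0] [.b 2])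
    0 1 s1_0 (by decide)
  obtain ⟨⟨s8_0, s8_1, s8_2, -, s8_4⟩, e8⟩ := R (K3 [.a 0] [.b 0, .a 1, .a 2] [.b 1] [.b 2]) (K3 [.a 0] [.a 1, .b 0, .a 2] [.b 1] [.b 2])
    (K3 [.a 0, .a 1] [.b 0, .a 2] [.b 1] [.b 2])
    (K3 [.a 1, .a 0] [.b 0, .a 2] [.b 1] [.b 2])
    (K3 [.a 0] [.a 1, .a 2] [.b 0, .b 1] [.b 2])
    (K3 [.a 0] [.a 1, .a 2] [.b 1, .b 0] [.b 2])
    0 1 s1_1 (by decide)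
  obtain ⟨⟨s9_0, s9_1, s9_2, s9_3, s9_4⟩, e9⟩ := R (K3 [.a 0] [.b 0, .a 2, .a 1] [.b 1] [.b 2]) (K3 [.a 0] [.a 2, .b 0, .a 1] [.b 1] [.b 2])
    (K3 [.a 0, .a 2] [.b 0, .a 1] [.b 1] [.b 2])
    (K3 [.a 2, .a 0] [.b 0, .a 1] [.b 1] [.b 2])
    (K3 [.a 0] [.a 2, .a 1] [.b 1] [.b 0, .b 2])
    (K3 [.a 0] [.a 2, .a 1] [.b 1] [.b 2, .b 0])
    0 2 s1_2 (by decide)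
  obtain ⟨⟨-, -, -, s10_3, s10_4⟩, e10⟩ := R (K3 [.a 0] [.b 0, .a 1] [.a 2] [.b 1, .b 2]) (K3 [.a 0] [.a 1, .b 0] [.a 2] [.b 1, .b 2])
    (K3 [.a 0, .a 1] [.b 0] [.a 2] [.b 1, .b 2])
    (K3 [.a 1, .a 0] [.b 0] [.a 2] [.b 1, .b 2])
    (K3 [.a 0] [.a 1] [.a 2] [.b 0, .b 1, .b 2])
    (K3 [.a 0] [.a 1] [.a 2] [.b 1, .b 0, .b 2])
    0 1 s1_3 (by decide)
  obtain ⟨⟨-, -, -, s11_3, s11_4⟩, e11⟩ := R (K3 [.a 0] [.b 0, .a 1] [.a 2] [.b 2, .b 1]) (K3 [.a 0] [.a 1, .b 0] [.a 2] [.b 2, .b 1])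
    (K3 [.a 0, .a 1] [.b 0] [.a 2] [.b 2, .b 1])
    (K3 [.a 1, .a 0] [.b 0] [.a 2] [.b 2, .b 1])
    (K3 [.a 0] [.a 1] [.a 2] [.b 2, .b 0, .b 1])
    (K3 [.a 0] [.a 1] [.a 2] [.b 2, .b 1, .b 0])
    0 1 s1_4 (by decide)
  obtain ⟨⟨-, s12_1, s12_2, s12_3, s12_4⟩, e12⟩ := R (K3 [.a 0] [.a 1] [.b 0, .a 2, .b 1] [.b 2]) (K3 [.a 0] [.a 1] [.a 2, .b 0, .b 1] [.b 2])
    (K3 [.a 0, .a 2] [.a 1] [.b 0, .b 1] [.b 2])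
    (K3 [.a 2, .a 0] [.a 1] [.b 0, .b 1] [.b 2])
    (K3 [.a 0] [.a 1] [.a 2, .b 1] [.b 0, .b 2])
    (K3 [.a 0] [.a 1] [.a 2, .b 1] [.b 2, .b 0])
    0 2 s5_0 (by decide)
  obtain ⟨⟨s13_0, s13_1, s13_2, -, s13_4⟩, e13⟩ := R (K3 [.a 0] [.a 1] [.b 0, .a 2] [.b 1, .b 2]) (K3 [.a 0] [.a 1] [.a 2, .b 0] [.b 1, .b 2])
    (K3 [.a 0, .a 2] [.a 1] [.b 0] [.b 1, .b 2])
    (K3 [.a 2, .a 0] [.a 1] [.b 0] [.b 1, .b 2])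
    (K3 [.a 0] [.a 1] [.a 2] [.b 1, .b 0, .b 2])
    (K3 [.a 0] [.a 1] [.a 2] [.b 1, .b 2, .b 0])
    0 2 s5_3 (by decide)
  obtain ⟨⟨s14_0, s14_1, s14_2, s14_3, -⟩, e14⟩ := R (K3 [.a 0] [.a 1] [.b 0, .a 2] [.b 2, .b 1]) (K3 [.a 0] [.a 1] [.a 2, .b 0] [.b 2, .b 1])
    (K3 [.a 0, .a 2] [.a 1] [.b 0] [.b 2, .b 1])
    (K3 [.a 2, .a 0] [.a 1] [.b 0] [.b 2, .b 1])
    (K3 [.a 0] [.a 1] [.a 2] [.b 0, .b 2, .b 1])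
    (K3 [.a 0] [.a 1] [.a 2] [.b 2, .b 0, .b 1])
    0 2 s5_4 (by decide)
  obtain ⟨⟨-, -, s15_2, -, -⟩, e15⟩ := R (K3 [.a 0] [.a 1] [.b 1, .a 2, .b 0] [.b 2]) (K3 [.a 0] [.a 1] [.a 2, .b 1, .b 0] [.b 2])
    (K3 [.a 0] [.a 1, .a 2] [.b 1, .b 0] [.b 2])
    (K3 [.a 0] [.a 2, .a 1] [.b 1, .b 0] [.b 2])
    (K3 [.a 0] [.a 1] [.a 2, .b 0] [.b 1, .b 2])
    (K3 [.a 0] [.a 1] [.a 2, .b 0] [.b 2, .b 1])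
    1 2 s6_0 (by decide)
  obtain ⟨⟨-, s16_1, -, -, -⟩, e16⟩ := R (K3 [.a 0] [.a 1] [.b 1, .a 2] [.b 0, .b 2]) (K3 [.a 0] [.a 1] [.a 2, .b 1] [.b 0, .b 2])
    (K3 [.a 0] [.a 1, .a 2] [.b 1] [.b 0, .b 2])
    (K3 [.a 0] [.a 2, .a 1] [.b 1] [.b 0, .b 2])
    (K3 [.a 0] [.a 1] [.a 2] [.b 0, .b 1, .b 2])
    (K3 [.a 0] [.a 1] [.a 2] [.b 0, .b 2, .b 1])
    1 2 s6_3 (by decide)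
  obtain ⟨⟨-, s17_1, -, -, -⟩, e17⟩ := R (K3 [.a 0] [.a 1] [.b 1, .a 2] [.b 2, .b 0]) (K3 [.a 0] [.a 1] [.a 2, .b 1] [.b 2, .b 0])
    (K3 [.a 0] [.a 1, .a 2] [.b 1] [.b 2, .b 0])
    (K3 [.a 0] [.a 2, .a 1] [.b 1] [.b 2, .b 0])
    (K3 [.a 0] [.a 1] [.a 2] [.b 1, .b 2, .b 0])
    (K3 [.a 0] [.a 1] [.a 2] [.b 2, .b 1, .b 0])
    1 2 s6_4 (by decide)
  obtain ⟨⟨-, s18_1, s18_2, -, -⟩, e18⟩ := R (K3 [.a 0] [.a 1, .b 0, .a 2] [.b 1] [.b 2]) (K3 [.a 0] [.a 1, .a 2, .b 0] [.b 1] [.b 2])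
    (K3 [.a 0, .a 2] [.a 1, .b 0] [.b 1] [.b 2])
    (K3 [.a 2, .a 0] [.a 1, .b 0] [.b 1] [.b 2])
    (K3 [.a 0] [.a 1, .a 2] [.b 1] [.b 0, .b 2])
    (K3 [.a 0] [.a 1, .a 2] [.b 1] [.b 2, .b 0])
    0 2 s8_0 (by decide)
  obtain ⟨⟨s19_0, -, s19_2, s19_3, s19_4⟩, e19⟩ := R (K3 [.a 0, .a 1] [.b 0, .a 2] [.b 1] [.b 2]) (K3 [.a 0, .a 1] [.a 2, .b 0] [.b 1] [.b 2])
    (K3 [.a 0, .a 2, .a 1] [.b 0] [.b 1] [.b 2])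
    (K3 [.a 2, .a 0, .a 1] [.b 0] [.b 1] [.b 2])
    (K3 [.a 0, .a 1] [.a 2] [.b 1] [.b 0, .b 2])
    (K3 [.a 0, .a 1] [.a 2] [.b 1] [.b 2, .b 0])
    0 2 s8_1 (by decide)
  obtain ⟨⟨s20_0, s20_1, -, s20_3, s20_4⟩, e20⟩ := R (K3 [.a 1, .a 0] [.b 0, .a 2] [.b 1] [.b 2]) (K3 [.a 1, .a 0] [.a 2, .b 0] [.b 1] [.b 2])
    (K3 [.a 1, .a 0, .a 2] [.b 0] [.b 1] [.b 2])
    (K3 [.a 1, .a 2, .a 0] [.b 0] [.b 1] [.b 2])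
    (K3 [.a 1, .a 0] [.a 2] [.b 1] [.b 0, .b 2])
    (K3 [.a 1, .a 0] [.a 2] [.b 1] [.b 2, .b 0])
    0 2 s8_2 (by decide)
  obtain ⟨⟨-, -, -, -, -⟩, e21⟩ := R (K3 [.a 0] [.a 2, .b 0, .a 1] [.b 1] [.b 2]) (K3 [.a 0] [.a 2, .a 1, .b 0] [.b 1] [.b 2])
    (K3 [.a 0, .a 1] [.a 2, .b 0] [.b 1] [.b 2])
    (K3 [.a 1, .a 0] [.a 2, .b 0] [.b 1] [.b 2])
    (K3 [.a 0] [.a 2, .a 1] [.b 0, .b 1] [.b 2])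
    (K3 [.a 0] [.a 2, .a 1] [.b 1, .b 0] [.b 2])
    0 1 s9_0 (by decide)
  obtain ⟨⟨-, -, -, -, -⟩, e22⟩ := R (K3 [.a 0, .a 2] [.b 0, .a 1] [.b 1] [.b 2]) (K3 [.a 0, .a 2] [.a 1, .b 0] [.b 1] [.b 2])
    (K3 [.a 0, .a 1, .a 2] [.b 0] [.b 1] [.b 2])
    (K3 [.a 1, .a 0, .a 2] [.b 0] [.b 1] [.b 2])
    (K3 [.a 0, .a 2] [.a 1] [.b 0, .b 1] [.b 2])
    (K3 [.a 0, .a 2] [.a 1] [.b 1, .b 0] [.b 2])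
    0 1 s9_1 (by decide)
  obtain ⟨⟨-, -, -, -, -⟩, e23⟩ := R (K3 [.a 2, .a 0] [.b 0, .a 1] [.b 1] [.b 2]) (K3 [.a 2, .a 0] [.a 1, .b 0] [.b 1] [.b 2])
    (K3 [.a 2, .a 0, .a 1] [.b 0] [.b 1] [.b 2])
    (K3 [.a 2, .a 1, .a 0] [.b 0] [.b 1] [.b 2])
    (K3 [.a 2, .a 0] [.a 1] [.b 0, .b 1] [.b 2])
    (K3 [.a 2, .a 0] [.a 1] [.b 1, .b 0] [.b 2])
    0 1 s9_2 (by decide)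
  rw [hX] at e0 e1
  change ruleSum normalOrder i j w = _ at e0
  change ruleSum normalOrder j k w = _ at e1
  rw [e0, e1]
  have r0 := Q (K3 [.a 0, .a 2] [.a 1] [.b 0] [.b 1, .b 2])
    (K3 [.a 1, .a 0] [.a 2] [.b 1] [.b 2, .b 0]) s13_1 s20_4 (by decide)
  have r1 := Q (K3 [.a 2, .a 0] [.a 1] [.b 0] [.b 1, .b 2])
    (K3 [.a 0, .a 1] [.a 2] [.b 1] [.b 2, .b 0]) s13_2 s19_4 (by decide)
  have r2 := Q (K3 [.a 0, .a 2] [.a 1] [.b 0] [.b 2, .b 1])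
    (K3 [.a 1, .a 0] [.a 2] [.b 1] [.b 0, .b 2]) s14_1 s20_3 (by decide)
  have r3 := Q (K3 [.a 2, .a 0] [.a 1] [.b 0] [.b 2, .b 1])
    (K3 [.a 0, .a 1] [.a 2] [.b 1] [.b 0, .b 2]) s14_2 s19_3 (by decide)
  exact chain_identity e2 e3 e4 e5 e6 e7 e8 e9 e10 e11 e12 e13 e14 e15 e16 e17 e18 e19 e20 e21 e22 e23 r0 r1 r2 r3

theorem disjoint_identity {E : Type*} [AddCommGroup E]
    {y0 y1 y2 y3 y4 y5 y6 y7 y8 y9 y10 y11 y12 y13 y14 y15 y16 y17 y18 y19 y20 y21 y22 y23 y24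
    y25 y26 y27 y28 y29 y30 y31 y32 y33 y34 : E}
    (e2 : y0 = y10 - (y11 - y12) - (y13 - y14))
    (e3 : y1 = y15 - (y16 - y17) - (y18 - y19))
    (e4 : y2 = y20 - (y21 - y22) - (y23 - y24))
    (e5 : y3 = y25 - (y26 - y27) - (y28 - y29))
    (e6 : y4 = y30 - (y31 - y32) - (y33 - y34))
    (e7 : y5 = y10 - (y15 - y20) - (y25 - y30))
    (e8 : y6 = y11 - (y16 - y21) - (y26 - y31))
    (e9 : y7 = y12 - (y17 - y22) - (y27 - y32))
    (e10 : y8 = y13 - (y18 - y23) - (y28 - y33))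
    (e11 : y9 = y14 - (y19 - y24) - (y29 - y34))
    : y0 - (y1 - y2) - (y3 - y4) =
      y5 - (y6 - y7) - (y8 - y9) := by
  simp only [e2, e3, e4, e5, e6, e7, e8, e9, e10, e11]
  abel

theorem confluent_disjoint {n N : ℕ} {w : Fin n → List (Letter N)} (hw : Good w)
    (ih : RuleBelow w) {i j k l : Fin N} (h1 : Redex i j w) (h2 : Redex k l w) (hik : i ≠ k)
    (hil : i ≠ l) (hjk : j ≠ k) (hjl : j ≠ l) :
    ruleSum normalOrder i j w = ruleSum normalOrder k l w := by
  have hij := hw.lt (h1.mem_inv hw)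
  have hkl := hw.lt (h2.mem_inv hw)
  let e : Fin 4 → Fin N := ![i, j, k, l]
  have he : Function.Injective e := by
    intro x y h
    fin_cases x <;> fin_cases y <;> simp_all [e, Fin.ext_iff] <;> omega
  have hX : instWord e w
      (K4 [.a 0] [.a 2] [.b 0, .a 1] [.b 1] [.b 2, .a 3] [.b 3]) = w := by
    have e1 := instWord_replace he w (fun z => [z]) (.b 0) (.a 1) [.b 0, .a 1]
    have e2 := instWord_replace he w (putAfter (.b 0) (.a 1) (fun z => [z])) (.b 2) (.a 3)
      [.b 2, .a 3]
    rw [instWord_id] at e1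
    rw [← e1] at e2
    have e3 : replace (.b 2) (.a 3) [.b 2, .a 3] (putAfter (.b 0) (.a 1) (fun z => [z])) =
      K4 [.a 0] [.a 2] [.b 0, .a 1] [.b 1] [.b 2, .a 3] [.b 3] := by decide
    rw [e3] at e2
    rw [← e2]
    refine Eq.trans ?_ h2
    exact congrArg _ h1
  have s : Good (instWord e w (K4 [.a 0] [.a 2] [.b 0, .a 1] [.b 1] [.b 2, .a 3] [.b 3])) ∧
      weight (instWord e w (K4 [.a 0] [.a 2] [.b 0, .a 1] [.b 1] [.b 2, .a 3] [.b 3]))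
        ≤ weight w := by
    rw [hX]; exact ⟨hw, le_rfl⟩
  have R0 := @below_step n 4 N e he w
  have R := @below_rule n 4 N e he w ih
  obtain ⟨⟨s0_0, s0_1, s0_2, s0_3, s0_4⟩, -, e0⟩ := R0 (K4 [.a 0] [.a 2] [.b 0, .a 1] [.b 1] [.b 2, .a 3] [.b 3]) (K4 [.a 0] [.a 2] [.a 1, .b 0] [.b 1] [.b 2, .a 3] [.b 3])
    (K4 [.a 0, .a 1] [.a 2] [.b 0] [.b 1] [.b 2, .a 3] [.b 3])
    (K4 [.a 1, .a 0] [.a 2] [.b 0] [.b 1] [.b 2, .a 3] [.b 3])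
    (K4 [.a 0] [.a 2] [.a 1] [.b 0, .b 1] [.b 2, .a 3] [.b 3])
    (K4 [.a 0] [.a 2] [.a 1] [.b 1, .b 0] [.b 2, .a 3] [.b 3])
    0 1 s (by decide)
  obtain ⟨⟨s1_0, s1_1, s1_2, s1_3, s1_4⟩, -, e1⟩ := R0 (K4 [.a 0] [.a 2] [.b 0, .a 1] [.b 1] [.b 2, .a 3] [.b 3]) (K4 [.a 0] [.a 2] [.b 0, .a 1] [.b 1] [.a 3, .b 2] [.b 3])
    (K4 [.a 0] [.a 2, .a 3] [.b 0, .a 1] [.b 1] [.b 2] [.b 3])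
    (K4 [.a 0] [.a 3, .a 2] [.b 0, .a 1] [.b 1] [.b 2] [.b 3])
    (K4 [.a 0] [.a 2] [.b 0, .a 1] [.b 1] [.a 3] [.b 2, .b 3])
    (K4 [.a 0] [.a 2] [.b 0, .a 1] [.b 1] [.a 3] [.b 3, .b 2])
    2 3 s (by decide)
  obtain ⟨⟨s2_0, s2_1, s2_2, s2_3, s2_4⟩, e2⟩ := R (K4 [.a 0] [.a 2] [.a 1, .b 0] [.b 1] [.b 2, .a 3] [.b 3]) (K4 [.a 0] [.a 2] [.a 1, .b 0] [.b 1] [.a 3, .b 2] [.b 3])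
    (K4 [.a 0] [.a 2, .a 3] [.a 1, .b 0] [.b 1] [.b 2] [.b 3])
    (K4 [.a 0] [.a 3, .a 2] [.a 1, .b 0] [.b 1] [.b 2] [.b 3])
    (K4 [.a 0] [.a 2] [.a 1, .b 0] [.b 1] [.a 3] [.b 2, .b 3])
    (K4 [.a 0] [.a 2] [.a 1, .b 0] [.b 1] [.a 3] [.b 3, .b 2])
    2 3 s0_0 (by decide)
  obtain ⟨⟨s3_0, s3_1, s3_2, s3_3, s3_4⟩, e3⟩ := R (K4 [.a 0, .a 1] [.a 2] [.b 0] [.b 1] [.b 2, .a 3] [.b 3]) (K4 [.a 0, .a 1] [.a 2] [.b 0] [.b 1] [.a 3, .b 2] [.b 3])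
    (K4 [.a 0, .a 1] [.a 2, .a 3] [.b 0] [.b 1] [.b 2] [.b 3])
    (K4 [.a 0, .a 1] [.a 3, .a 2] [.b 0] [.b 1] [.b 2] [.b 3])
    (K4 [.a 0, .a 1] [.a 2] [.b 0] [.b 1] [.a 3] [.b 2, .b 3])
    (K4 [.a 0, .a 1] [.a 2] [.b 0] [.b 1] [.a 3] [.b 3, .b 2])
    2 3 s0_1 (by decide)
  obtain ⟨⟨s4_0, s4_1, s4_2, s4_3, s4_4⟩, e4⟩ := R (K4 [.a 1, .a 0] [.a 2] [.b 0] [.b 1] [.b 2, .a 3] [.b 3]) (K4 [.a 1, .a 0] [.a 2] [.b 0] [.b 1] [.a 3, .b 2] [.b 3])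
    (K4 [.a 1, .a 0] [.a 2, .a 3] [.b 0] [.b 1] [.b 2] [.b 3])
    (K4 [.a 1, .a 0] [.a 3, .a 2] [.b 0] [.b 1] [.b 2] [.b 3])
    (K4 [.a 1, .a 0] [.a 2] [.b 0] [.b 1] [.a 3] [.b 2, .b 3])
    (K4 [.a 1, .a 0] [.a 2] [.b 0] [.b 1] [.a 3] [.b 3, .b 2])
    2 3 s0_2 (by decide)
  obtain ⟨⟨s5_0, s5_1, s5_2, s5_3, s5_4⟩, e5⟩ := R (K4 [.a 0] [.a 2] [.a 1] [.b 0, .b 1] [.b 2, .a 3] [.b 3]) (K4 [.a 0] [.a 2] [.a 1] [.b 0, .b 1] [.a 3, .b 2] [.b 3])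
    (K4 [.a 0] [.a 2, .a 3] [.a 1] [.b 0, .b 1] [.b 2] [.b 3])
    (K4 [.a 0] [.a 3, .a 2] [.a 1] [.b 0, .b 1] [.b 2] [.b 3])
    (K4 [.a 0] [.a 2] [.a 1] [.b 0, .b 1] [.a 3] [.b 2, .b 3])
    (K4 [.a 0] [.a 2] [.a 1] [.b 0, .b 1] [.a 3] [.b 3, .b 2])
    2 3 s0_3 (by decide)
  obtain ⟨⟨s6_0, s6_1, s6_2, s6_3, s6_4⟩, e6⟩ := R (K4 [.a 0] [.a 2] [.a 1] [.b 1, .b 0] [.b 2, .a 3] [.b 3]) (K4 [.a 0] [.a 2] [.a 1] [.b 1, .b 0] [.a 3, .b 2] [.b 3])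
    (K4 [.a 0] [.a 2, .a 3] [.a 1] [.b 1, .b 0] [.b 2] [.b 3])
    (K4 [.a 0] [.a 3, .a 2] [.a 1] [.b 1, .b 0] [.b 2] [.b 3])
    (K4 [.a 0] [.a 2] [.a 1] [.b 1, .b 0] [.a 3] [.b 2, .b 3])
    (K4 [.a 0] [.a 2] [.a 1] [.b 1, .b 0] [.a 3] [.b 3, .b 2])
    2 3 s0_4 (by decide)
  obtain ⟨⟨-, -, -, -, -⟩, e7⟩ := R (K4 [.a 0] [.a 2] [.b 0, .a 1] [.b 1] [.a 3, .b 2] [.b 3]) (K4 [.a 0] [.a 2] [.a 1, .b 0] [.b 1] [.a 3, .b 2] [.b 3])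
    (K4 [.a 0, .a 1] [.a 2] [.b 0] [.b 1] [.a 3, .b 2] [.b 3])
    (K4 [.a 1, .a 0] [.a 2] [.b 0] [.b 1] [.a 3, .b 2] [.b 3])
    (K4 [.a 0] [.a 2] [.a 1] [.b 0, .b 1] [.a 3, .b 2] [.b 3])
    (K4 [.a 0] [.a 2] [.a 1] [.b 1, .b 0] [.a 3, .b 2] [.b 3])
    0 1 s1_0 (by decide)
  obtain ⟨⟨-, -, -, -, -⟩, e8⟩ := R (K4 [.a 0] [.a 2, .a 3] [.b 0, .a 1] [.b 1] [.b 2] [.b 3]) (K4 [.a 0] [.a 2, .a 3] [.a 1, .b 0] [.b 1] [.b 2] [.b 3])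
    (K4 [.a 0, .a 1] [.a 2, .a 3] [.b 0] [.b 1] [.b 2] [.b 3])
    (K4 [.a 1, .a 0] [.a 2, .a 3] [.b 0] [.b 1] [.b 2] [.b 3])
    (K4 [.a 0] [.a 2, .a 3] [.a 1] [.b 0, .b 1] [.b 2] [.b 3])
    (K4 [.a 0] [.a 2, .a 3] [.a 1] [.b 1, .b 0] [.b 2] [.b 3])
    0 1 s1_1 (by decide)
  obtain ⟨⟨-, -, -, -, -⟩, e9⟩ := R (K4 [.a 0] [.a 3, .a 2] [.b 0, .a 1] [.b 1] [.b 2] [.b 3]) (K4 [.a 0] [.a 3, .a 2] [.a 1, .b 0] [.b 1] [.b 2] [.b 3])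
    (K4 [.a 0, .a 1] [.a 3, .a 2] [.b 0] [.b 1] [.b 2] [.b 3])
    (K4 [.a 1, .a 0] [.a 3, .a 2] [.b 0] [.b 1] [.b 2] [.b 3])
    (K4 [.a 0] [.a 3, .a 2] [.a 1] [.b 0, .b 1] [.b 2] [.b 3])
    (K4 [.a 0] [.a 3, .a 2] [.a 1] [.b 1, .b 0] [.b 2] [.b 3])
    0 1 s1_2 (by decide)
  obtain ⟨⟨-, -, -, -, -⟩, e10⟩ := R (K4 [.a 0] [.a 2] [.b 0, .a 1] [.b 1] [.a 3] [.b 2, .b 3]) (K4 [.a 0] [.a 2] [.a 1, .b 0] [.b 1] [.a 3] [.b 2, .b 3])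
    (K4 [.a 0, .a 1] [.a 2] [.b 0] [.b 1] [.a 3] [.b 2, .b 3])
    (K4 [.a 1, .a 0] [.a 2] [.b 0] [.b 1] [.a 3] [.b 2, .b 3])
    (K4 [.a 0] [.a 2] [.a 1] [.b 0, .b 1] [.a 3] [.b 2, .b 3])
    (K4 [.a 0] [.a 2] [.a 1] [.b 1, .b 0] [.a 3] [.b 2, .b 3])
    0 1 s1_3 (by decide)
  obtain ⟨⟨-, -, -, -, -⟩, e11⟩ := R (K4 [.a 0] [.a 2] [.b 0, .a 1] [.b 1] [.a 3] [.b 3, .b 2]) (K4 [.a 0] [.a 2] [.a 1, .b 0] [.b 1] [.a 3] [.b 3, .b 2])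
    (K4 [.a 0, .a 1] [.a 2] [.b 0] [.b 1] [.a 3] [.b 3, .b 2])
    (K4 [.a 1, .a 0] [.a 2] [.b 0] [.b 1] [.a 3] [.b 3, .b 2])
    (K4 [.a 0] [.a 2] [.a 1] [.b 0, .b 1] [.a 3] [.b 3, .b 2])
    (K4 [.a 0] [.a 2] [.a 1] [.b 1, .b 0] [.a 3] [.b 3, .b 2])
    0 1 s1_4 (by decide)
  rw [hX] at e0 e1
  change ruleSum normalOrder i j w = _ at e0
  change ruleSum normalOrder k l w = _ at e1
  rw [e0, e1]
  exact disjoint_identity e2 e3 e4 e5 e6 e7 e8 e9 e10 e11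

theorem flatMap_eq_self {α : Type} {θ : α → List α} {l : List α} (h : ∀ z ∈ l, θ z = [z]) :
    l.flatMap θ = l := by
  rw [List.flatMap_congr h]; simp

theorem Redex.adjacent {n N : ℕ} {w : Fin n → List (Letter N)} (hw : Good w) {i j : Fin N}
    (h : Redex i j w) : ∃ s u v, w s = u ++ .b i :: .a j :: v := by
  obtain ⟨s, hs⟩ := hw.exists_mem (.b i)
  obtain ⟨u, v, huv⟩ := List.append_of_mem hs
  have hc := hw.count_le (.b i) s
  rw [huv] at hc
  simp only [List.count_append, List.count_cons_self] at hc
  have hu : .b i ∉ u := List.count_eq_zero.1 (by omega)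
  refine ⟨s, u, ?_⟩
  have h1 := congrFun h s
  simp only [putAfter, replace, expand, huv, List.flatMap_append, List.flatMap_cons] at h1
  simp only [reduceCtorEq, if_false, if_true, List.cons_append, List.nil_append] at h1
  set u' := u.flatMap fun z => if z = Letter.a j then [] else
    if z = .b i then [.b i, .a j] else [z]
  have hu' : .b i ∉ u' := by
    intro hm
    obtain ⟨z, hz, hz'⟩ := List.mem_flatMap.1 hm
    split_ifs at hz' with h2 h3
    · simp at hz'
    · exact hu (h3 ▸ hz)
    · simp at hz'; exact hu (hz' ▸ hz)
  have key : ∀ (p q r t : List (Letter N)) (x : Letter N), x ∉ p → x ∉ r →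
      p ++ x :: q = r ++ x :: t → q = t := by
    intro p
    induction p with
    | nil =>
      intro q r t x _ hr hh
      cases r with
      | nil => simpa using hh
      | cons y r => simp at hh hr; exact absurd hh.1 hr.1
    | cons y p ihp =>
      intro q r t x hp hr hh
      cases r with
      | nil => simp at hh hp; exact absurd hh.1.symm hp.1
      | cons z r =>
        simp at hh hp hr
        exact ihp q r t x hp.2 hr.2 hh.2
  have h2 := key _ _ _ _ _ hu' hu h1
  exact ⟨_, by rw [huv, ← h2]⟩

theorem Good.redex_of_adjacent {n N : ℕ} {w : Fin n → List (Letter N)} (hw : Good w)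
    {i j : Fin N} {s : Fin n} {u v : List (Letter N)} (h : w s = u ++ .b i :: .a j :: v) :
    Redex i j w := by
  have hi := hw.count_le (.b i) s
  have hj := hw.count_le (.a j) s
  rw [h] at hi hj
  simp [List.count_append] at hi hj
  have hiu : .b i ∉ u := List.count_eq_zero.1 (by omega)
  have hiv : .b i ∉ v := List.count_eq_zero.1 (by omega)
  have hju : .a j ∉ u := List.count_eq_zero.1 (by omega)
  have hjv : .a j ∉ v := List.count_eq_zero.1 (by omega)
  funext t
  by_cases ht : t = s
  · subst ht
    simp only [putAfter, replace, expand, h, List.flatMap_append, List.flatMap_cons]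
    rw [flatMap_eq_self, flatMap_eq_self]
    · simp
    · intro z hz
      rw [if_neg (by rintro rfl; exact hjv hz), if_neg (by rintro rfl; exact hiv hz)]
    · intro z hz
      rw [if_neg (by rintro rfl; exact hju hz), if_neg (by rintro rfl; exact hiu hz)]
  · refine flatMap_eq_self fun z hz => ?_
    rw [if_neg, if_neg]
    · rintro rfl
      exact ht (hw.slot_unique hz (by rw [h]; simp))
    · rintro rfl
      exact ht (hw.slot_unique hz (by rw [h]; simp))

theorem append_cons_unique {α : Type} {x : α} : ∀ {p q r t : List α}, x ∉ p → x ∉ r →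
    p ++ x :: q = r ++ x :: t → p = r ∧ q = t
  | [], q, [], t, _, _, h => by simpa using h
  | [], q, y :: r, t, _, hr, h => by simp at h hr; exact absurd h.1 hr.1
  | y :: p, q, [], t, hp, _, h => by simp at h hp; exact absurd h.1.symm hp.1
  | y :: p, q, z :: r, t, hp, hr, h => by
    simp at h hp hr
    obtain ⟨h1, h2⟩ := append_cons_unique hp.2 hr.2 h.2
    exact ⟨by rw [h.1, h1], h2⟩

theorem Good.not_mem_of_split {n N : ℕ} {w : Fin n → List (Letter N)} (hw : Good w) {s : Fin n}
    {x : Letter N} {u v : List (Letter N)} (h : w s = u ++ x :: v) : x ∉ u := by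
  have hc := hw.count_le x s
  rw [h] at hc
  simp only [List.count_append, List.count_cons_self] at hc
  exact List.count_eq_zero.1 (by omega)

theorem redex_right_unique {n N : ℕ} {w : Fin n → List (Letter N)} (hw : Good w) {i j k : Fin N}
    (h1 : Redex i j w) (h2 : Redex i k w) : j = k := by
  obtain ⟨s, u, v, h⟩ := h1.adjacent hw
  obtain ⟨t, u', v', h'⟩ := h2.adjacent hw
  obtain rfl := hw.slot_unique (x := .b i) (s := s) (t := t) (by simp [h]) (by simp [h'])
  have := (append_cons_unique (hw.not_mem_of_split h) (hw.not_mem_of_split h')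
    (h.symm.trans h')).2
  simpa using (List.cons.inj this).1

theorem redex_left_unique {n N : ℕ} {w : Fin n → List (Letter N)} (hw : Good w) {i j k : Fin N}
    (h1 : Redex i k w) (h2 : Redex j k w) : i = j := by
  obtain ⟨s, u, v, h⟩ := h1.adjacent hw
  obtain ⟨t, u', v', h'⟩ := h2.adjacent hw
  obtain rfl := hw.slot_unique (x := .a k) (s := s) (t := t) (by simp [h]) (by simp [h'])
  have e : w s = (u ++ [.b i]) ++ .a k :: v := by simp [h]
  have e' : w s = (u' ++ [.b j]) ++ .a k :: v' := by simp [h']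
  have := (append_cons_unique (hw.not_mem_of_split e) (hw.not_mem_of_split e')
    (e.symm.trans e')).1
  simpa using (List.append_inj_right' this rfl)

theorem relabel_replace {n N M : ℕ} {e : Fin N → Fin M} (he : Function.Injective e) (x y : Letter N)
    (t : List (Letter N)) (w : Fin n → List (Letter N)) :
    replace (Letter.map e x) (Letter.map e y) (t.map (Letter.map e)) (relabel e w) =
      relabel e (replace x y t w) := by
  funext s
  exact replace_map (Letter.map_injective he) x y t (w s)

theorem relabel_symm {n N : ℕ} (σ : Equiv.Perm (Fin N)) (w : Fin n → List (Letter N)) :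
    relabel σ.symm (relabel σ w) = w := by
  funext s
  simp only [relabel, List.map_map]
  refine List.map_id'' (fun x => ?_) _
  cases x <;> simp [Letter.map]

theorem Redex.relabel {n N M : ℕ} {e : Fin N → Fin M} (he : Function.Injective e) {i j : Fin N}
    {w : Fin n → List (Letter N)} (h : Redex i j w) : Redex (e i) (e j) (relabel e w) :=
  (relabel_replace he (.b i) (.a j) [.b i, .a j] w).trans (congrArg _ h)

/-- The five words that occur on the right-hand side of the reordering rule. -/
def Step {n N : ℕ} (i j : Fin N) (w w' : Fin n → List (Letter N)) : Prop :=
  w' = putBefore (.b i) (.a j) w ∨ w' = putAfter (.a i) (.a j) w ∨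
    w' = putBefore (.a i) (.a j) w ∨ w' = putBefore (.b j) (.b i) w ∨
    w' = putAfter (.b j) (.b i) w

theorem Step.good {n N : ℕ} {i j : Fin N} {w w' : Fin n → List (Letter N)} (hs : Step i j w w')
    (hw : Good w) (h : Redex i j w) : Good w' ∧ weight w' < weight w := by
  rcases hs with rfl | rfl | rfl | rfl | rfl
  · exact step_swap hw h
  · exact step_left hw h (Or.inl rfl)
  · exact step_left hw h (Or.inr rfl)
  · exact step_right hw h (Or.inr rfl)
  · exact step_right hw h (Or.inl rfl)

theorem Step.relabel {n N M : ℕ} {e : Fin N → Fin M} (he : Function.Injective e) {i j : Fin N}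
    {w w' : Fin n → List (Letter N)} (hs : Step i j w w') :
    Step (e i) (e j) (relabel e w) (relabel e w') := by
  unfold Step
  rcases hs with rfl | rfl | rfl | rfl | rfl
  · exact Or.inl (relabel_replace he _ _ [_, _] w).symm
  · exact Or.inr (Or.inl (relabel_replace he _ _ [_, _] w).symm)
  · exact Or.inr (Or.inr (Or.inl (relabel_replace he _ _ [_, _] w).symm))
  · exact Or.inr (Or.inr (Or.inr (Or.inl (relabel_replace he _ _ [_, _] w).symm)))
  · exact Or.inr (Or.inr (Or.inr (Or.inr (relabel_replace he _ _ [_, _] w).symm)))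

theorem ruleSum_congr {n n' N M : ℕ} {E : Type*} [AddCommGroup E]
    {f : (Fin n → List (Letter N)) → E} {g : (Fin n' → List (Letter M)) → E}
    (F : (Fin n → List (Letter N)) → (Fin n' → List (Letter M))) {i j : Fin N} {i' j' : Fin M}
    {w : Fin n → List (Letter N)} {w' : Fin n' → List (Letter M)}
    (h1 : F (putBefore (.b i) (.a j) w) = putBefore (.b i') (.a j') w')
    (h2 : F (putAfter (.a i) (.a j) w) = putAfter (.a i') (.a j') w')
    (h3 : F (putBefore (.a i) (.a j) w) = putBefore (.a i') (.a j') w')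
    (h4 : F (putBefore (.b j) (.b i) w) = putBefore (.b j') (.b i') w')
    (h5 : F (putAfter (.b j) (.b i) w) = putAfter (.b j') (.b i') w')
    (h : ∀ v, Step i j w v → f v = g (F v)) : ruleSum f i j w = ruleSum g i' j' w' := by
  unfold ruleSum
  rw [h _ (Or.inl rfl), h _ (Or.inr (Or.inl rfl)), h _ (Or.inr (Or.inr (Or.inl rfl))),
    h _ (Or.inr (Or.inr (Or.inr (Or.inl rfl)))), h _ (Or.inr (Or.inr (Or.inr (Or.inr rfl)))),
    h1, h2, h3, h4, h5]

theorem ruleSum_relabel {n N M : ℕ} {E : Type*} [AddCommGroup E]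
    {e : Fin N → Fin M} (he : Function.Injective e) {f : (Fin n → List (Letter N)) → E}
    {g : (Fin n → List (Letter M)) → E}
    {i j : Fin N} {w : Fin n → List (Letter N)}
    (h : ∀ v, Step i j w v → f v = g (relabel e v)) :
    ruleSum f i j w = ruleSum g (e i) (e j) (relabel e w) :=
  ruleSum_congr (relabel e) (relabel_replace he _ _ [_, _] w).symm
    (relabel_replace he _ _ [_, _] w).symm (relabel_replace he _ _ [_, _] w).symm
    (relabel_replace he _ _ [_, _] w).symm (relabel_replace he _ _ [_, _] w).symm h

theorem cls_relabel {n N : ℕ} {w : Fin n → List (Letter N)} (hw : Good w)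
    (σ : Equiv.Perm (Fin N)) (hσ : Good (relabel σ w)) :
    cls ⟨aPart (relabel σ w), hσ.aPart⟩ ⟨bPart (relabel σ w), hσ.bPart⟩ =
      cls ⟨aPart w, hw.aPart⟩ ⟨bPart w, hw.bPart⟩ := by
  refine Eq.trans ?_ (cls_perm σ _ _)
  congr 1
  · refine Subtype.ext (funext fun s => ?_)
    simp only [aPart, relabel, MWord.perm]
    induction w s with
    | nil => rfl
    | cons x l ih => cases x <;> simp [Letter.map, ih]
  · refine Subtype.ext (funext fun s => ?_)
    simp only [bPart, relabel, MWord.perm]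
    induction w s with
    | nil => rfl
    | cons x l ih => cases x <;> simp [Letter.map, ih]

theorem normalOrder_main {n N : ℕ} (k : ℕ) : ∀ w : Fin n → List (Letter N), Good w →
    weight w < k → (∀ i j, Redex i j w → normalOrder w = ruleSum normalOrder i j w) ∧
      ∀ σ : Equiv.Perm (Fin N), Good (relabel σ w) → weight (relabel σ w) < k →
        normalOrder (relabel σ w) = normalOrder w := by
  induction k with
  | zero => intro w _ h; omega
  | succ k ih =>
    have rule : ∀ w : Fin n → List (Letter N), Good w → weight w < k + 1 →
        ∀ i j, Redex i j w → normalOrder w = ruleSum normalOrder i j w := by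
      intro w hw hk i j h
      have ih1 : RuleBelow w := fun w' hw' hlt => (ih w' hw' (by omega)).1
      have ih2 : RelabelBelow w := fun w' σ hw' hlt hσ hlt' =>
        (ih w' hw' (by omega)).2 σ hσ (by omega)
      obtain ⟨k, l, h', e⟩ := normalOrder_choice hw ⟨(i, j), h⟩
      rw [e]
      by_cases hik : i = k
      · subst hik
        rw [redex_right_unique hw h h']
      by_cases hjl : j = l
      · subst hjl
        rw [redex_left_unique hw h h']
      by_cases hil : i = l
      · subst hil
        exact confluent_chain hw ih1 ih2 h' h
      by_cases hjk : j = k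
      · subst hjk
        exact (confluent_chain hw ih1 ih2 h h').symm
      exact (confluent_disjoint hw ih1 h h' hik hil hjk hjl).symm
    intro w hw hk
    refine ⟨rule w hw hk, fun σ hσ hk' => ?_⟩
    by_cases h : ∃ p : Fin N × Fin N, Redex p.1 p.2 w
    · obtain ⟨⟨i, j⟩, h⟩ := h
      rw [rule w hw hk i j h, rule _ hσ hk' _ _ (h.relabel σ.injective)]
      refine (ruleSum_relabel σ.injective fun v hv => ?_).symm
      have h1 := hv.good hw h
      have h2 := (hv.relabel σ.injective).good hσ (h.relabel σ.injective)
      exact ((ih v h1.1 (by omega)).2 σ h2.1 (by omega)).symm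
    · have h' : ¬ ∃ p : Fin N × Fin N, Redex p.1 p.2 (relabel σ w) := by
        rintro ⟨⟨i, j⟩, h'⟩
        have := h'.relabel σ.symm.injective
        rw [relabel_symm] at this
        exact h ⟨(_, _), this⟩
      rw [normalOrder_irred hw h, normalOrder_irred hσ h', cls_relabel hw σ hσ]

/-- Normal ordering satisfies the reordering rule at every place where it can be applied. -/
theorem normalOrder_rule {n N : ℕ} {w : Fin n → List (Letter N)} (hw : Good w) {i j : Fin N}
    (h : Redex i j w) : normalOrder w = ruleSum normalOrder i j w :=
  (normalOrder_main (weight w + 1) w hw (Nat.lt_succ_self _)).1 i j h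

/-- Normal ordering is invariant under relabelling. -/
theorem normalOrder_relabel {n N : ℕ} {w : Fin n → List (Letter N)} (hw : Good w)
    (σ : Equiv.Perm (Fin N)) (hσ : Good (relabel σ w)) :
    normalOrder (relabel σ w) = normalOrder w :=
  (normalOrder_main (weight w + weight (relabel σ w) + 1) w hw (by omega)).2 σ hσ (by omega)

/-! ### The product -/

/-- Slotwise concatenation of words, the labels of the second word being shifted. -/
def catWord {n N M : ℕ} (w : Fin n → List (Letter N)) (z : Fin n → List (Letter M)) :
    Fin n → List (Letter (N + M)) :=
  fun s => (w s).map (Letter.map (Fin.castAdd M)) ++ (z s).map (Letter.map (Fin.natAdd N))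

/-- The normally ordered word attached to a pair of tuples of words: in each slot the letters `a`
are to the left of the letters `b`. -/
def pairWord {n N : ℕ} (u v : MWord n N) : Fin n → List (Letter N) :=
  fun s => (u.1 s).map .a ++ (v.1 s).map .b

theorem Letter.a_injective {N : ℕ} : Function.Injective (Letter.a : Fin N → Letter N) :=
  fun _ _ h => Letter.a.inj h

theorem Letter.b_injective {N : ℕ} : Function.Injective (Letter.b : Fin N → Letter N) :=
  fun _ _ h => Letter.b.inj h

theorem good_pairWord {n N : ℕ} (u v : MWord n N) : Good (pairWord u v) := by
  refine ⟨fun x => ?_, fun s i j h => ?_⟩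
  · cases x with
    | a i =>
      rw [← u.2 i]
      refine Finset.sum_congr rfl fun s _ => ?_
      have h0 : ((v.1 s).map Letter.b).count (.a i) = 0 := List.count_eq_zero.2 (by simp)
      rw [pairWord, List.count_append, List.count_map_of_injective _ _ Letter.a_injective,
        h0, add_zero]
    | b i =>
      rw [← v.2 i]
      refine Finset.sum_congr rfl fun s _ => ?_
      have h0 : ((u.1 s).map Letter.a).count (.b i) = 0 := List.count_eq_zero.2 (by simp)
      rw [pairWord, List.count_append, List.count_map_of_injective _ _ Letter.b_injective,
        h0, zero_add]
  · rcases pair_sublist_append h with h | ⟨h, -⟩ | h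
    · have := h.subset (List.mem_cons_self)
      simp at this
    · simp at h
    · have := h.subset (List.mem_cons_of_mem _ List.mem_cons_self)
      simp at this

theorem pairWord_irred {n N : ℕ} (u v : MWord n N) :
    ¬ ∃ p : Fin N × Fin N, Redex p.1 p.2 (pairWord u v) := by
  rintro ⟨p, hp⟩
  obtain ⟨s, hs⟩ := mem_inv.1 (hp.mem_inv (good_pairWord u v))
  rcases pair_sublist_append hs with h | ⟨h, -⟩ | h
  · have := h.subset (List.mem_cons_self)
    simp at this
  · simp at h
  · have := h.subset (List.mem_cons_of_mem _ List.mem_cons_self)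
    simp at this

theorem aPart_pairWord {n N : ℕ} (u v : MWord n N) : aPart (pairWord u v) = u.1 := by
  funext s
  simp [aPart, pairWord, List.filterMap_map]

theorem bPart_pairWord {n N : ℕ} (u v : MWord n N) : bPart (pairWord u v) = v.1 := by
  funext s
  simp [bPart, pairWord, List.filterMap_map]

theorem normalOrder_pairWord {n N : ℕ} (u v : MWord n N) :
    normalOrder (pairWord u v) = cls u v := by
  rw [normalOrder_irred (good_pairWord u v) (pairWord_irred u v)]
  congr 1
  · exact Subtype.ext (aPart_pairWord u v)
  · exact Subtype.ext (bPart_pairWord u v)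

theorem split_of_no_ba {N : ℕ} : ∀ l : List (Letter N),
    (∀ u v i j, l ≠ u ++ .b i :: .a j :: v) →
    l = (l.filterMap fun | .a i => some i | .b _ => none).map .a ++
      (l.filterMap fun | .a _ => none | .b i => some i).map .b
  | [], _ => rfl
  | .a i :: l, h => by
    have := split_of_no_ba l (fun u v i' j hl => h (.a i :: u) v i' j (by rw [hl]; rfl))
    simpa using this
  | .b i :: l, h => by
    have ih := split_of_no_ba l (fun u v i' j hl => h (.b i :: u) v i' j (by rw [hl]; rfl))
    have hA : (l.filterMap fun | .a i => some i | .b _ => none) = [] := by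
      cases l with
      | nil => rfl
      | cons x l =>
        cases x with
        | a j => exact absurd rfl (h [] l i j)
        | b j =>
          by_contra hne
          obtain ⟨y, t, ht⟩ := List.exists_cons_of_ne_nil hne
          rw [ht] at ih
          simp at ih
    rw [hA, List.map_nil, List.nil_append] at ih
    simp only [List.filterMap_cons, hA, List.map_nil, List.nil_append, List.map_cons]
    exact congrArg (Letter.b i :: ·) ih

theorem eq_pairWord {n N : ℕ} {w : Fin n → List (Letter N)} (hw : Good w)
    (h : ¬ ∃ p : Fin N × Fin N, Redex p.1 p.2 w) :
    w = pairWord ⟨aPart w, hw.aPart⟩ ⟨bPart w, hw.bPart⟩ := by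
  funext s
  exact split_of_no_ba (w s) fun u v i j hs => h ⟨(i, j), hw.redex_of_adjacent hs⟩

theorem Good.cat {n N M : ℕ} {w : Fin n → List (Letter N)} {z : Fin n → List (Letter M)}
    (hw : Good w) (hz : Good z) : Good (catWord w z) := by
  have i1 := Letter.map_injective (Fin.castAdd_injective N M)
  have i2 := Letter.map_injective (Fin.natAdd_injective M N)
  have c1 : ∀ x, ∑ s, ((w s).map (Letter.map (Fin.castAdd M))).count
      (Letter.map (Fin.castAdd M) x) = 1 := by
    intro x
    rw [← hw.count x]
    exact Finset.sum_congr rfl fun s _ => List.count_map_of_injective _ _ i1 _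
  have c2 : ∀ x, ∑ s, ((z s).map (Letter.map (Fin.natAdd N))).count
      (Letter.map (Fin.natAdd N) x) = 1 := by
    intro x
    rw [← hz.count x]
    exact Finset.sum_congr rfl fun s _ => List.count_map_of_injective _ _ i2 _
  have ne : ∀ x y, Letter.map (Fin.castAdd M) x ≠ Letter.map (Fin.natAdd N) y := by
    intro x y h
    cases x <;> cases y <;> simp [Letter.map, Fin.ext_iff] at h <;> omega
  have d1 : ∀ s x, ((z s).map (Letter.map (Fin.natAdd N))).count
      (Letter.map (Fin.castAdd M) x) = 0 := by
    intro s x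
    refine List.count_eq_zero.2 fun h => ?_
    obtain ⟨y, -, hy⟩ := List.mem_map.1 h
    exact ne _ _ hy.symm
  have d2 : ∀ s x, ((w s).map (Letter.map (Fin.castAdd M))).count
      (Letter.map (Fin.natAdd N) x) = 0 := by
    intro s x
    refine List.count_eq_zero.2 fun h => ?_
    obtain ⟨y, -, hy⟩ := List.mem_map.1 h
    exact ne _ _ hy
  have cover : ∀ x : Letter (N + M), (∃ y, x = Letter.map (Fin.castAdd M) y) ∨
      ∃ y, x = Letter.map (Fin.natAdd N) y := by
    intro x
    cases x with
    | a i =>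
      induction i using Fin.addCases with
      | left i => exact Or.inl ⟨.a i, rfl⟩
      | right i => exact Or.inr ⟨.a i, rfl⟩
    | b i =>
      induction i using Fin.addCases with
      | left i => exact Or.inl ⟨.b i, rfl⟩
      | right i => exact Or.inr ⟨.b i, rfl⟩
  refine ⟨fun x => ?_, fun s i j h => ?_⟩
  · rcases cover x with ⟨y, rfl⟩ | ⟨y, rfl⟩
    · simp only [catWord, List.count_append, d1, add_zero, c1]
    · simp only [catWord, List.count_append, d2, zero_add, c2]
  · have key : ∀ {K : ℕ} {f : Fin K → Fin (N + M)} {l : List (Letter K)},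
        List.Sublist [.b i, .a j] (l.map (Letter.map f)) →
        ∃ i' j', i = f i' ∧ j = f j' ∧ List.Sublist [.b i', .a j'] l := by
      intro K f l h
      obtain ⟨l', hl, e⟩ := List.sublist_map_iff.1 h
      match l', e with
      | [.b i', .a j'], e =>
        simp [Letter.map] at e
        exact ⟨i', j', e.1, e.2, hl⟩
      | [.a i', _], e => simp [Letter.map] at e
      | [.b i', .b j'], e => simp [Letter.map] at e
      | [], e => simp at e
      | [_], e => simp at e
      | _ :: _ :: _ :: _, e => simp at e
    rcases pair_sublist_append h with h | ⟨h1, h2⟩ | h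
    · obtain ⟨i', j', hi, hj, h3⟩ := key h
      subst hi hj
      have := Fin.lt_def.1 (hw.order _ _ _ h3)
      rw [Fin.lt_def]
      simpa only [Fin.val_castAdd] using this
    · obtain ⟨x, -, hx⟩ := List.mem_map.1 h1
      obtain ⟨y, -, hy⟩ := List.mem_map.1 h2
      cases x <;> cases y <;> simp [Letter.map] at hx hy
      subst hx hy
      simp only [Fin.lt_def, Fin.val_castAdd, Fin.val_natAdd]
      omega
    · obtain ⟨i', j', hi, hj, h3⟩ := key h
      subst hi hj
      have := Fin.lt_def.1 (hz.order _ _ _ h3)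
      rw [Fin.lt_def]
      simp only [Fin.val_natAdd]
      omega

theorem cat_replace_left {n N M : ℕ} (w : Fin n → List (Letter N)) (z : Fin n → List (Letter M))
    (x y : Letter N) (t : List (Letter N)) :
    replace (Letter.map (Fin.castAdd M) x) (Letter.map (Fin.castAdd M) y)
      (t.map (Letter.map (Fin.castAdd M))) (catWord w z) = catWord (replace x y t w) z := by
  funext s
  simp only [replace, expand, catWord, List.flatMap_append]
  rw [replace_map (Letter.map_injective (Fin.castAdd_injective N M))]
  congr 1
  refine flatMap_eq_self fun v hv => ?_
  obtain ⟨v, -, rfl⟩ := List.mem_map.1 hv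
  have ne : ∀ x, Letter.map (Fin.natAdd N) v ≠ Letter.map (Fin.castAdd M) x := by
    intro x h
    cases x <;> cases v <;> simp [Letter.map, Fin.ext_iff] at h <;> omega
  rw [if_neg (ne _), if_neg (ne _)]

theorem cat_replace_right {n N M : ℕ} (w : Fin n → List (Letter N)) (z : Fin n → List (Letter M))
    (x y : Letter M) (t : List (Letter M)) :
    replace (Letter.map (Fin.natAdd N) x) (Letter.map (Fin.natAdd N) y)
      (t.map (Letter.map (Fin.natAdd N))) (catWord w z) = catWord w (replace x y t z) := by
  funext s
  simp only [replace, expand, catWord, List.flatMap_append]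
  rw [replace_map (Letter.map_injective (Fin.natAdd_injective M N))]
  congr 1
  refine flatMap_eq_self fun v hv => ?_
  obtain ⟨v, -, rfl⟩ := List.mem_map.1 hv
  have ne : ∀ x, Letter.map (Fin.castAdd M) v ≠ Letter.map (Fin.natAdd N) x := by
    intro x h
    cases x <;> cases v <;> simp [Letter.map, Fin.ext_iff] at h <;> omega
  rw [if_neg (ne _), if_neg (ne _)]

/-- The permutation `σ ⊔ τ` of `{1, …, N + M}`. -/
def sumPerm {N M : ℕ} (σ : Equiv.Perm (Fin N)) (τ : Equiv.Perm (Fin M)) :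
    Equiv.Perm (Fin (N + M)) :=
  (finSumFinEquiv.symm.trans (Equiv.sumCongr σ τ)).trans finSumFinEquiv

theorem relabel_cat {n N M : ℕ} (σ : Equiv.Perm (Fin N)) (τ : Equiv.Perm (Fin M))
    (w : Fin n → List (Letter N)) (z : Fin n → List (Letter M)) :
    relabel (sumPerm σ τ) (catWord w z) = catWord (relabel σ w) (relabel τ z) := by
  funext s
  simp only [relabel, catWord, List.map_append, List.map_map]
  congr 1
  · refine List.map_congr_left fun x _ => ?_
    cases x <;> simp [Letter.map, sumPerm]
  · refine List.map_congr_left fun x _ => ?_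
    cases x <;> simp [Letter.map, sumPerm]

theorem relabel_pairWord {n N : ℕ} (σ : Equiv.Perm (Fin N)) (u v : MWord n N) :
    relabel σ (pairWord u v) = pairWord (u.perm σ) (v.perm σ) := by
  funext s
  simp [relabel, pairWord, MWord.perm, Letter.map, Function.comp_def]

theorem relabel_one {n N : ℕ} (w : Fin n → List (Letter N)) :
    relabel (1 : Equiv.Perm (Fin N)) w = w := by
  funext s
  refine List.map_id'' (fun x => ?_) _
  cases x <;> rfl

theorem normalOrder_cat_perm {n N M : ℕ} (σ : Equiv.Perm (Fin N)) (τ : Equiv.Perm (Fin M))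
    (u v : MWord n N) (u' v' : MWord n M) :
    normalOrder (catWord (pairWord (u.perm σ) (v.perm σ)) (pairWord (u'.perm τ) (v'.perm τ))) =
      normalOrder (catWord (pairWord u v) (pairWord u' v')) := by
  have h := ((good_pairWord (u.perm σ) (v.perm σ)).cat (good_pairWord (u'.perm τ) (v'.perm τ)))
  rw [← relabel_pairWord, ← relabel_pairWord, ← relabel_cat] at h ⊢
  exact normalOrder_relabel ((good_pairWord u v).cat (good_pairWord u' v')) _ h

theorem MWord.perm_one {n N : ℕ} (u : MWord n N) : u.perm 1 = u :=
  Subtype.ext (funext fun s => by simp [MWord.perm])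

/-- The product of `U_n^univ`: concatenate slot by slot and put into normal order. -/
noncomputable def mulUniv (n : ℕ) : Univ n →ₗ[ℚ] Univ n →ₗ[ℚ] Univ n :=
  liftUniv
    (fun _ u v => liftUniv
      (fun _ u' v' => normalOrder (catWord (pairWord u v) (pairWord u' v')))
      (fun _ τ u' v' => by
        simpa only [MWord.perm_one] using normalOrder_cat_perm 1 τ u v u' v'))
    (fun _ σ u v => Univ.hom_ext fun _ u' v' => by
      rw [liftUniv_cls, liftUniv_cls]
      simpa only [MWord.perm_one] using normalOrder_cat_perm σ 1 u v u' v')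

theorem mulUniv_cls {n N M : ℕ} (u v : MWord n N) (u' v' : MWord n M) :
    mulUniv n (cls u v) (cls u' v') = normalOrder (catWord (pairWord u v) (pairWord u' v')) := by
  rw [mulUniv, liftUniv_cls, liftUniv_cls]

theorem mulUniv_normalOrder {n N M : ℕ} (k : ℕ) : ∀ (w : Fin n → List (Letter N))
    (z : Fin n → List (Letter M)), Good w → Good z → weight w + weight z < k →
    mulUniv n (normalOrder w) (normalOrder z) = normalOrder (catWord w z) := by
  induction k with
  | zero => intro _ _ _ _ h; omega
  | succ k ih =>
    intro w z hw hz hk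
    by_cases h : ∃ p : Fin N × Fin N, Redex p.1 p.2 w
    · obtain ⟨⟨i, j⟩, h⟩ := h
      have h' : Redex (Fin.castAdd M i) (Fin.castAdd M j) (catWord w z) :=
        (cat_replace_left w z (.b i) (.a j) [.b i, .a j]).trans (congrArg (catWord · z) h)
      rw [normalOrder_rule hw h, normalOrder_rule (hw.cat hz) h']
      have e : mulUniv n (ruleSum normalOrder i j w) (normalOrder z) =
          ruleSum (fun v => mulUniv n (normalOrder v) (normalOrder z)) i j w := by
        simp only [ruleSum, map_sub, LinearMap.sub_apply]
      rw [e]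
      refine ruleSum_congr (catWord · z) (cat_replace_left w z _ _ [_, _]).symm
        (cat_replace_left w z _ _ [_, _]).symm (cat_replace_left w z _ _ [_, _]).symm
        (cat_replace_left w z _ _ [_, _]).symm (cat_replace_left w z _ _ [_, _]).symm
        fun v hv => ?_
      have := hv.good hw h
      exact ih v z this.1 hz (by omega)
    by_cases h1 : ∃ p : Fin M × Fin M, Redex p.1 p.2 z
    · obtain ⟨⟨i, j⟩, h1⟩ := h1
      have h' : Redex (Fin.natAdd N i) (Fin.natAdd N j) (catWord w z) :=
        (cat_replace_right w z (.b i) (.a j) [.b i, .a j]).trans (congrArg (catWord w) h1)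
      rw [normalOrder_rule hz h1, normalOrder_rule (hw.cat hz) h']
      have e : mulUniv n (normalOrder w) (ruleSum normalOrder i j z) =
          ruleSum (fun v => mulUniv n (normalOrder w) (normalOrder v)) i j z := by
        simp only [ruleSum, map_sub]
      rw [e]
      refine ruleSum_congr (catWord w) (cat_replace_right w z _ _ [_, _]).symm
        (cat_replace_right w z _ _ [_, _]).symm (cat_replace_right w z _ _ [_, _]).symm
        (cat_replace_right w z _ _ [_, _]).symm (cat_replace_right w z _ _ [_, _]).symm
        fun v hv => ?_
      have := hv.good hz h1
      exact ih w v hw this.1 (by omega)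
    rw [eq_pairWord hw h, eq_pairWord hz h1, normalOrder_pairWord, normalOrder_pairWord,
      mulUniv_cls]

theorem mulUniv_normalOrder' {n N M : ℕ} {w : Fin n → List (Letter N)}
    {z : Fin n → List (Letter M)} (hw : Good w) (hz : Good z) :
    mulUniv n (normalOrder w) (normalOrder z) = normalOrder (catWord w z) :=
  mulUniv_normalOrder _ w z hw hz (Nat.lt_succ_self _)

theorem normalOrder_cast {n N N' : ℕ} (h : N = N') (w : Fin n → List (Letter N)) :
    normalOrder (relabel (Fin.cast h) w) = normalOrder w := by
  subst h
  congr 1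
  exact relabel_one w

theorem catWord_assoc {n N M K : ℕ} (w : Fin n → List (Letter N)) (z : Fin n → List (Letter M))
    (y : Fin n → List (Letter K)) :
    relabel (Fin.cast (Nat.add_assoc N M K)) (catWord (catWord w z) y) =
      catWord w (catWord z y) := by
  funext s
  simp only [catWord, relabel, List.map_append, List.map_map, List.append_assoc]
  congr 1
  · refine List.map_congr_left fun x _ => ?_
    cases x <;> rfl
  congr 1
  · refine List.map_congr_left fun x _ => ?_
    cases x <;> rfl
  · refine List.map_congr_left fun x _ => ?_
    cases x <;> simp [Letter.map, Fin.ext_iff, Nat.add_assoc]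

theorem mulUniv_assoc {n : ℕ} (x y z : Univ n) :
    mulUniv n (mulUniv n x y) z = mulUniv n x (mulUniv n y z) := by
  have h3 : ∀ {N M K : ℕ} (u v : MWord n N) (u' v' : MWord n M) (u'' v'' : MWord n K),
      mulUniv n (mulUniv n (cls u v) (cls u' v')) (cls u'' v'') =
        mulUniv n (cls u v) (mulUniv n (cls u' v') (cls u'' v'')) := by
    intro N M K u v u' v' u'' v''
    have g := good_pairWord u v
    have g' := good_pairWord u' v'
    have g'' := good_pairWord u'' v''
    rw [← normalOrder_pairWord u v, ← normalOrder_pairWord u' v', ← normalOrder_pairWord u'' v'',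
      mulUniv_normalOrder' g g', mulUniv_normalOrder' (g.cat g') g'',
      mulUniv_normalOrder' g' g'', mulUniv_normalOrder' g (g'.cat g''), ← catWord_assoc,
      normalOrder_cast]
  have h2 : ∀ {N M : ℕ} (u v : MWord n N) (u' v' : MWord n M) (z : Univ n),
      mulUniv n (mulUniv n (cls u v) (cls u' v')) z =
        mulUniv n (cls u v) (mulUniv n (cls u' v') z) := fun u v u' v' z =>
    LinearMap.congr_fun (f := mulUniv n (mulUniv n (cls u v) (cls u' v')))
      (g := mulUniv n (cls u v) ∘ₗ mulUniv n (cls u' v'))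
      (Univ.hom_ext fun _ u'' v'' => h3 u v u' v' u'' v'') z
  have h1 : ∀ {N : ℕ} (u v : MWord n N) (y z : Univ n),
      mulUniv n (mulUniv n (cls u v) y) z = mulUniv n (cls u v) (mulUniv n y z) :=
    fun u v y z =>
    LinearMap.congr_fun (f := (mulUniv n).flip z ∘ₗ mulUniv n (cls u v))
      (g := mulUniv n (cls u v) ∘ₗ (mulUniv n).flip z)
      (Univ.hom_ext fun _ u' v' => h2 u v u' v' z) y
  exact LinearMap.congr_fun (f := (mulUniv n).flip z ∘ₗ (mulUniv n).flip y)
    (g := (mulUniv n).flip (mulUniv n y z))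
    (Univ.hom_ext fun _ u v => h1 u v y z) x

/-- The unit of `U_n^univ`. -/
noncomputable def oneUniv (n : ℕ) : Univ n :=
  cls (N := 0) ⟨fun _ => [], fun i => i.elim0⟩ ⟨fun _ => [], fun i => i.elim0⟩

theorem oneUniv_mul {n : ℕ} (x : Univ n) : mulUniv n (oneUniv n) x = x := by
  have h : mulUniv n (oneUniv n) = LinearMap.id := by
    refine Univ.hom_ext fun N u v => ?_
    rw [oneUniv, mulUniv_cls, LinearMap.id_apply, ← normalOrder_pairWord,
      ← normalOrder_cast (Nat.zero_add N).symm]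
    congr 1
    funext s
    simp only [catWord, pairWord, relabel, List.map_nil, List.append_nil, List.nil_append]
    refine List.map_congr_left fun x _ => ?_
    cases x <;> simp [Letter.map]
  rw [h, LinearMap.id_apply]

theorem mul_oneUniv {n : ℕ} (x : Univ n) : mulUniv n x (oneUniv n) = x := by
  have h : (mulUniv n).flip (oneUniv n) = LinearMap.id := by
    refine Univ.hom_ext fun N u v => ?_
    rw [LinearMap.flip_apply, oneUniv, mulUniv_cls, LinearMap.id_apply, ← normalOrder_pairWord]
    congr 1
    funext s
    simp only [catWord, pairWord, List.map_nil, List.append_nil]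
    refine List.map_id'' (fun x => ?_) _
    cases x <;> rfl
  exact LinearMap.congr_fun h x

noncomputable instance (n : ℕ) : Ring (Univ n) :=
  { (inferInstance : AddCommGroup (Univ n)) with
    mul := fun x y => mulUniv n x y
    one := oneUniv n
    mul_assoc := mulUniv_assoc
    one_mul := oneUniv_mul
    mul_one := mul_oneUniv
    left_distrib := fun x y z => map_add (mulUniv n x) y z
    right_distrib := fun x y z => by
      change mulUniv n (x + y) z = mulUniv n x z + mulUniv n y z
      rw [map_add, LinearMap.add_apply]
    zero_mul := fun x => by
      change mulUniv n 0 x = 0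
      rw [map_zero, LinearMap.zero_apply]
    mul_zero := fun x => map_zero (mulUniv n x) }

noncomputable instance (n : ℕ) : Algebra ℚ (Univ n) :=
  Algebra.ofModule
    (fun c x y => by
      change mulUniv n (c • x) y = c • mulUniv n x y
      rw [map_smul, LinearMap.smul_apply])
    (fun c x y => map_smul (mulUniv n x) c y)

/-! ### The Lie algebra `𝔱𝔯_n` and the elements `r_{ij}^{univ}` -/

theorem isMultilinear_single {n : ℕ} (i : Fin n) :
    IsMultilinear (N := 1) fun s => if s = i then [0] else [] := by
  intro x
  rw [Finset.sum_eq_single i]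
  · simp [Subsingleton.elim x 0]
  · intro s _ hs
    simp [hs]
  · simp

/-- `x_1` in the slot `i` and `1` in all other slots. -/
def single {n : ℕ} (i : Fin n) : MWord n 1 :=
  ⟨fun s => if s = i then [0] else [], isMultilinear_single i⟩

/-- The element `r_{ij}^{univ}` of `U_n^univ`: the class of `x_1^{(i)} ⊗ x_1^{(j)}`, in degree 1. -/
noncomputable def rUniv {n : ℕ} (i j : Fin n) : Univ n :=
  cls (single i) (single j)

/-- The symbols `r_{ij}` with `1 ≤ i ≠ j ≤ n`. -/
abbrev TrGen (n : ℕ) : Type := {p : Fin n × Fin n // p.1 ≠ p.2}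

/-- The generator `r_{ij}` of the free Lie algebra. -/
noncomputable def freeR {n : ℕ} (i j : Fin n) (h : i ≠ j) : FreeLieAlgebra ℚ (TrGen n) :=
  FreeLieAlgebra.of ℚ ⟨(i, j), h⟩

/-- The defining relations of `𝔱𝔯_n`: the Yang-Baxter relations, the commutation of `r_{ij}` and
`r_{kl}` for distinct `i, j, k, l`, and `r_{ij} = -r_{ji}`. -/
inductive TrRel (n : ℕ) : FreeLieAlgebra ℚ (TrGen n) → Prop
  | yangBaxter (i j k : Fin n) (hij : i ≠ j) (hik : i ≠ k) (hjk : j ≠ k) :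
    TrRel n (⁅freeR i j hij, freeR i k hik⁆ + ⁅freeR i j hij, freeR j k hjk⁆
      + ⁅freeR i k hik, freeR j k hjk⁆)
  | comm (i j k l : Fin n) (hij : i ≠ j) (hkl : k ≠ l) (hik : i ≠ k) (hil : i ≠ l)
    (hjk : j ≠ k) (hjl : j ≠ l) : TrRel n ⁅freeR i j hij, freeR k l hkl⁆
  | antisymm (i j : Fin n) (hij : i ≠ j) : TrRel n (freeR i j hij + freeR j i hij.symm)

/-- The ideal generated by the relations. -/
noncomputable def trIdeal (n : ℕ) : LieIdeal ℚ (FreeLieAlgebra ℚ (TrGen n)) :=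
  LieSubmodule.lieSpan ℚ (FreeLieAlgebra ℚ (TrGen n)) {x | TrRel n x}

/-- The Lie algebra `𝔱𝔯_n` over `ℚ`. -/
abbrev Tr (n : ℕ) : Type := FreeLieAlgebra ℚ (TrGen n) ⧸ trIdeal n

/-- The generator `r_{ij}` of `𝔱𝔯_n`. -/
noncomputable def Tr.r {n : ℕ} (i j : Fin n) (h : i ≠ j) : Tr n :=
  LieSubmodule.Quotient.mk (freeR i j h)

end UnivYB

/-! The algebra $U(\mathfrak{tr}_n)$ is generated by the $r_{ij}$ with $i<j$, viewed as edges from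
$i$ to $j$. It is filtered by giving $r_{ij}$ the weight $2n-(j-i)$. For $i<j<k$ the Yang–Baxter
relation reads $[r_{ij},r_{jk}]=[r_{ik},r_{ij}]+[r_{jk},r_{ik}]$, and every word on the right has
smaller weight than $r_{ij}r_{jk}$, because $r_{ik}$ is longer than both other edges. Hence, up to
lower weight, two edges commute unless they share their source or their target (`commute_mem`). A
word is then determined up to lower weight by its key: at every vertex, the ordered list of the
targets of the edges leaving it and of the sources of the edges entering it (`edgeProd_sub_mem`).

The key can be read off in $U_n^{\mathrm{univ}}$: each $a_i$ is replaced by the slot of $b_i$ and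
conversely. This does not depend on the labels, so it gives a linear map `keyMap`. The image of a
word of edges is the normal ordering of a word of letters in which $a_i$ stands in the source and
$b_i$ in the target of the $i$-th edge. When $b_ia_j$ is reordered, the slots satisfy
$S(a_i)<S(b_i)=S(a_j)<S(b_j)$. The main term keeps the key; the corrections move $a_j$ down to the
slot of $a_i$, or $b_i$ up to the slot of $b_j$. Both moves lower the weight and keep every $a$ in
an earlier slot than its $b$. So the leading key of the image is the key of the word
(`keyMap_normalOrder`, `keyMap_toUniv`).

Choosing one word for every key gives a linear map back to $U(\mathfrak{tr}_n)$ which inverts the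
homomorphism up to lower weight (`sub_linearCombination_mem`). An element of the kernel therefore
descends through the whole filtration and is zero.

The homomorphism exists because the relations hold among the $r_{ij}^{\mathrm{univ}}$: the
Yang–Baxter relation is one application of the reordering rule (`rUniv_yangBaxter`), and
antisymmetry is imposed by definition (`altUniv`). -/

namespace UnivYB

/-! ### Algebra homomorphisms from `U(𝔱𝔯_n)` -/

section Presentation

attribute [local instance] LieRing.ofAssociativeRing

/-- The defining relations of `𝔱𝔯_n` for elements of an associative algebra. -/
structure TrRelations {n : ℕ} {A : Type*} [Ring A] (g : ∀ i j : Fin n, i ≠ j → A) : Prop where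
  yangBaxter : ∀ i j k (hij : i ≠ j) (hik : i ≠ k) (hjk : j ≠ k),
    ⁅g i j hij, g i k hik⁆ + ⁅g i j hij, g j k hjk⁆ + ⁅g i k hik, g j k hjk⁆ = 0
  comm : ∀ i j k l (hij : i ≠ j) (hkl : k ≠ l), i ≠ k → i ≠ l → j ≠ k → j ≠ l →
    ⁅g i j hij, g k l hkl⁆ = 0
  antisymm : ∀ i j (hij : i ≠ j), g i j hij + g j i hij.symm = 0

/-- It suffices to check the relations of `𝔱𝔯_n` for increasing indices. -/
theorem trRelations_of_lt {n : ℕ} {A : Type*} [Ring A] (g : ∀ i j : Fin n, i ≠ j → A)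
    (h1 : ∀ i j k (hij : i < j) (hjk : j < k),
      ⁅g i j hij.ne, g i k (hij.trans hjk).ne⁆ + ⁅g i j hij.ne, g j k hjk.ne⁆
        + ⁅g i k (hij.trans hjk).ne, g j k hjk.ne⁆ = 0)
    (h2 : ∀ i j k l (hij : i < j) (hkl : k < l), i ≠ k → i ≠ l → j ≠ k → j ≠ l →
      ⁅g i j hij.ne, g k l hkl.ne⁆ = 0)
    (h3 : ∀ i j (hij : i ≠ j), g j i hij.symm = - g i j hij) : TrRelations g := by
  refine ⟨fun i j k hij hik hjk => ?_, fun i j k l hij hkl hik hil hjk hjl => ?_,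
    fun i j hij => by rw [h3 i j hij, add_neg_cancel]⟩
  -- Given antisymmetry, permuting $i,j,k$ multiplies the Yang–Baxter expression by the sign of the
  -- permutation. Of the eight order patterns, the two closed by `omega` are cyclic and cannot
  -- occur.
  · rcases hij.lt_or_gt with h | h <;> rcases hik.lt_or_gt with h' | h' <;>
      rcases hjk.lt_or_gt with h'' | h''
    · exact h1 i j k h h''
    · have := h1 i k j h' h''
      rw [h3 j k hjk] at this
      simp only [lie_neg] at this
      rw [← neg_eq_zero, ← this, ← lie_skew (g i j hij) (g i k hik)]
      abel
    · omega
    · have := h1 k i j h' h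
      rw [h3 i k hik, h3 j k hjk] at this
      simp only [lie_neg, neg_lie] at this
      rw [← this, ← lie_skew (g i k hik) (g i j hij), ← lie_skew (g j k hjk) (g i j hij)]
      abel
    · have := h1 j i k h h'
      rw [h3 i j hij] at this
      simp only [neg_lie] at this
      rw [← neg_eq_zero, ← this, ← lie_skew (g j k hjk) (g i k hik)]
      abel
    · omega
    · have := h1 j k i h'' h'
      rw [h3 i j hij, h3 i k hik] at this
      simp only [lie_neg, neg_lie] at this
      rw [← this, ← lie_skew (g j k hjk) (g i k hik), ← lie_skew (g j k hjk) (g i j hij)]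
      abel
    · have := h1 k j i h'' h
      rw [h3 i j hij, h3 i k hik, h3 j k hjk] at this
      simp only [lie_neg, neg_lie] at this
      rw [← neg_eq_zero, ← this, ← lie_skew (g j k hjk) (g i k hik),
        ← lie_skew (g j k hjk) (g i j hij), ← lie_skew (g i k hik) (g i j hij)]
      abel
  · have h4 (k l : Fin n) (hij : i < j) (hkl : k ≠ l) (hik : i ≠ k) (hil : i ≠ l) (hjk : j ≠ k)
        (hjl : j ≠ l) : ⁅g i j hij.ne, g k l hkl⁆ = 0 := by
      rcases hkl.lt_or_gt with h | h
      · exact h2 i j k l hij h hik hil hjk hjl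
      · rw [h3 l k hkl.symm, lie_neg, h2 i j l k hij h hil hik hjl hjk, neg_zero]
    rcases hij.lt_or_gt with h | h
    · exact h4 k l h hkl hik hil hjk hjl
    · rw [h3 j i hij.symm, neg_lie, neg_eq_zero]
      rcases hkl.lt_or_gt with h' | h'
      · exact h2 j i k l h h' hjk hjl hik hil
      · rw [h3 l k hkl.symm, lie_neg, h2 j i l k h h' hjl hjk hil hik, neg_zero]

variable {n : ℕ} {A : Type*} [Ring A] [Algebra ℚ A]

/-- The Lie algebra homomorphism from `𝔱𝔯_n` given by elements satisfying the relations. -/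
noncomputable def Tr.lift (g : ∀ i j : Fin n, i ≠ j → A) (hg : TrRelations g) : Tr n →ₗ⁅ℚ⁆ A :=
  let F : FreeLieAlgebra ℚ (TrGen n) →ₗ⁅ℚ⁆ A := FreeLieAlgebra.lift ℚ fun p => g p.1.1 p.1.2 p.2
  have hF : trIdeal n ≤ F.ker := by
    have h (i j : Fin n) (h : i ≠ j) : F (freeR i j h) = g i j h :=
      FreeLieAlgebra.lift_of_apply ..
    refine LieSubmodule.lieSpan_le.2 fun x hx => ?_
    rw [SetLike.mem_coe, LieHom.mem_ker]
    cases hx with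
    | yangBaxter i j k hij hik hjk =>
      simpa only [map_add, LieHom.map_lie, h] using hg.yangBaxter i j k hij hik hjk
    | comm i j k l hij hkl hik hil hjk hjl =>
      simpa only [LieHom.map_lie, h] using hg.comm i j k l hij hkl hik hil hjk hjl
    | antisymm i j hij => simpa only [map_add, h] using hg.antisymm i j hij
  { (trIdeal n).toSubmodule.liftQ (F : FreeLieAlgebra ℚ (TrGen n) →ₗ[ℚ] A) hF with
    map_lie' := by
      intro x y
      obtain ⟨x, rfl⟩ := LieSubmodule.Quotient.surjective_mk' _ x
      obtain ⟨y, rfl⟩ := LieSubmodule.Quotient.surjective_mk' _ y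
      exact F.map_lie x y }

theorem Tr.lift_r (g : ∀ i j : Fin n, i ≠ j → A) (hg : TrRelations g) (i j : Fin n) (h : i ≠ j) :
    Tr.lift g hg (Tr.r i j h) = g i j h :=
  FreeLieAlgebra.lift_of_apply (fun p : TrGen n => g p.1.1 p.1.2 p.2) ⟨(i, j), h⟩

/-- The generator `r_{ij}` of `U(𝔱𝔯_n)`. -/
noncomputable def uR (i j : Fin n) (h : i ≠ j) : UniversalEnvelopingAlgebra ℚ (Tr n) :=
  UniversalEnvelopingAlgebra.ι ℚ (Tr.r i j h)

/-- Two universal properties in a row: that of the enveloping algebra, then that of the free Lie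
algebra above its quotient. -/
theorem tr_algHom_ext {f g : UniversalEnvelopingAlgebra ℚ (Tr n) →ₐ[ℚ] A}
    (h : ∀ i j h, f (uR i j h) = g (uR i j h)) : f = g := by
  refine UniversalEnvelopingAlgebra.hom_ext ℚ (LieHom.ext fun x => ?_)
  obtain ⟨x, rfl⟩ := LieSubmodule.Quotient.surjective_mk' _ x
  let q : FreeLieAlgebra ℚ (TrGen n) →ₗ⁅ℚ⁆ Tr n :=
    { (LieSubmodule.Quotient.mk' (trIdeal n) : _ →ₗ[ℚ] Tr n) with map_lie' := rfl }
  exact LieHom.congr_fun (FreeLieAlgebra.hom_ext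
    (F₁ := ((f.toLieHom.comp (UniversalEnvelopingAlgebra.ι ℚ)).comp q))
    (F₂ := ((g.toLieHom.comp (UniversalEnvelopingAlgebra.ι ℚ)).comp q))
    fun p => h p.1.1 p.1.2 p.2) x

/-- Together with `trAlgHom` and `tr_algHom_ext` this presents $U(\mathfrak{tr}_n)$ as an
associative algebra; the quotient of the free Lie algebra is not needed afterwards. -/
theorem trRelations_uR (n : ℕ) : TrRelations (uR (n := n)) := by
  have h {x : FreeLieAlgebra ℚ (TrGen n)} (hx : TrRel n x) :
      UniversalEnvelopingAlgebra.ι ℚ (LieSubmodule.Quotient.mk x : Tr n) = 0 := by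
    rw [(LieSubmodule.Quotient.mk_eq_zero' (N := trIdeal n)).2 (LieSubmodule.subset_lieSpan hx),
      map_zero]
  refine ⟨fun i j k hij hik hjk => ?_, fun i j k l hij hkl hik hil hjk hjl => ?_,
    fun i j hij => ?_⟩
  · rw [← h (.yangBaxter i j k hij hik hjk)]
    simp only [uR, ← LieHom.map_lie, ← map_add]
    rfl
  · rw [← h (.comm i j k l hij hkl hik hil hjk hjl)]
    simp only [uR, ← LieHom.map_lie]
    rfl
  · rw [← h (.antisymm i j hij)]
    simp only [uR, ← map_add]
    rfl

/-- The algebra homomorphism from `U(𝔱𝔯_n)` given by elements satisfying the relations. -/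
noncomputable def trAlgHom (g : ∀ i j : Fin n, i ≠ j → A) (hg : TrRelations g) :
    UniversalEnvelopingAlgebra ℚ (Tr n) →ₐ[ℚ] A :=
  UniversalEnvelopingAlgebra.lift ℚ (Tr.lift g hg)

theorem trAlgHom_uR (g : ∀ i j : Fin n, i ≠ j → A) (hg : TrRelations g) (i j : Fin n)
    (h : i ≠ j) : trAlgHom g hg (uR i j h) = g i j h := by
  rw [trAlgHom, uR, UniversalEnvelopingAlgebra.lift_ι_apply, Tr.lift_r]

end Presentation

/-! ### The relations between the elements `r_{ij}^{univ}` -/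

theorem univ_mul_def {n : ℕ} (x y : Univ n) : x * y = mulUniv n x y := rfl

/-- The word of `r_{ij}^{univ} r_{kl}^{univ}`. -/
abbrev pairProd {n : ℕ} (i j k l : Fin n) : Fin n → List (Letter 2) :=
  catWord (pairWord (single i) (single j)) (pairWord (single k) (single l))

theorem good_pairProd {n : ℕ} (i j k l : Fin n) : Good (pairProd i j k l) :=
  (good_pairWord _ _).cat (good_pairWord _ _)

theorem pairProd_apply {n : ℕ} (i j k l s : Fin n) : pairProd i j k l s =
    (if s = i then [.a 0] else []) ++ (if s = j then [.b 0] else []) ++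
      (if s = k then [.a 1] else []) ++ (if s = l then [.b 1] else []) := by
  simp only [catWord, pairWord, single]
  split_ifs <;> simp [Letter.map]

theorem rUniv_mul {n : ℕ} (i j k l : Fin n) :
    rUniv i j * rUniv k l = normalOrder (pairProd i j k l) := by
  rw [univ_mul_def, rUniv, rUniv, mulUniv_cls]

/-- A permutation of the labels preserves multiplicities and can violate goodness only through the
order condition, which is vacuous when no $b$ stands to the left of an $a$. -/
theorem Good.relabel {n N : ℕ} {w : Fin n → List (Letter N)} (hw : Good w)
    (hba : ∀ s i j, ¬ List.Sublist [.b i, .a j] (w s)) (σ : Equiv.Perm (Fin N)) :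
    Good (UnivYB.relabel σ w) := by
  refine ⟨fun x => ?_, fun s i j h => ?_⟩
  · have hx : Letter.map σ (Letter.map σ.symm x) = x := by cases x <;> simp [Letter.map]
    rw [← hw.count (Letter.map σ.symm x)]
    refine Finset.sum_congr rfl fun s _ => ?_
    conv_lhs => rw [← hx]
    exact List.count_map_of_injective _ _ (Letter.map_injective σ.injective) _
  · have := h.map (Letter.map σ.symm)
    rw [show (UnivYB.relabel σ w s).map (Letter.map σ.symm) = w s from
      congrFun (relabel_symm σ w) s] at this
    exact absurd this (hba s _ _)

/-- The letters are written in the order $a_0,b_0,a_1,b_1$, so the only possible inversion is $b_0$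
before $a_1$. These stand in the slots $j$ and $k$. -/
theorem pairProd_noInv {n : ℕ} {i j k l : Fin n} (hjk : j ≠ k) (hij : i ≠ j) (hkl : k ≠ l)
    (s : Fin n) (p q : Fin 2) : ¬ List.Sublist [.b p, .a q] (pairProd i j k l s) := by
  rw [pairProd_apply]
  intro h
  have h1 := h.count_le (.b p)
  have h2 := h.count_le (.a q)
  by_cases h3 : s = j
  · subst h3
    simp only [hij.symm, hjk, if_false, if_true, List.nil_append, List.append_nil,
      List.count_append] at h2
    split_ifs at h2 <;> simp at h2
  · have hb : ([] : List (Letter 2)) = if s = j then [.b 0] else [] := by rw [if_neg h3]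
    by_cases h4 : s = l
    · subst h4
      simp only [h3, hkl.symm, if_false, if_true, List.append_nil] at h
      split_ifs at h
      · rcases pair_sublist_append h with h | ⟨h, -⟩ | h
        · exact absurd h.length_le (by simp)
        · simp at h
        · exact absurd h.length_le (by simp)
      · exact absurd h.length_le (by simp)
    · simp only [h3, h4, if_false, List.append_nil, List.count_append] at h1
      split_ifs at h1 <;> simp at h1

/-- Products of two generators in opposite orders carry their labels in opposite orders. Exchanging
the labels makes their words comparable, and is legitimate when the word has no inversion. -/
theorem rUniv_mul_swap {n : ℕ} {i j k l : Fin n} (hij : i ≠ j) (hjk : j ≠ k) (hkl : k ≠ l) :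
    rUniv i j * rUniv k l = normalOrder (relabel (Equiv.swap 0 1) (pairProd i j k l)) := by
  rw [rUniv_mul]
  exact (normalOrder_relabel (good_pairProd i j k l) _
    ((good_pairProd i j k l).relabel (pairProd_noInv hjk hij hkl) _)).symm

/-- With four distinct slots no slot contains two letters, so after exchanging the labels the two
words coincide. -/
theorem rUniv_commute {n : ℕ} {i j k l : Fin n} (hij : i ≠ j) (hkl : k ≠ l) (hik : i ≠ k)
    (hil : i ≠ l) (hjk : j ≠ k) (hjl : j ≠ l) :
    rUniv i j * rUniv k l = rUniv k l * rUniv i j := by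
  rw [rUniv_mul_swap hij hjk hkl, rUniv_mul]
  congr 1
  funext s
  simp only [relabel, pairProd_apply]
  by_cases h1 : s = i <;> by_cases h2 : s = j <;> by_cases h3 : s = k <;> by_cases h4 : s = l <;>
    first
    | (exfalso; omega)
    | simp [*, hij.symm, hkl.symm, hik.symm, hil.symm, hjk.symm, hjl.symm, Letter.map]

/-- In the word of $r_{ij}r_{jk}$ the slot $j$ contains $b_0a_1$. The reordering rule at this place
yields $a_1b_0$ in slot $j$, the commutator of $a_0,a_1$ in slot $i$ and that of $b_0,b_1$ in slot
$k$, which are the five products on the right. -/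
theorem rUniv_yangBaxter {n : ℕ} {i j k : Fin n} (hij : i ≠ j) (hik : i ≠ k) (hjk : j ≠ k) :
    rUniv i j * rUniv j k = rUniv j k * rUniv i j
      - (rUniv i j * rUniv i k - rUniv i k * rUniv i j)
      - (rUniv i k * rUniv j k - rUniv j k * rUniv i k) := by
  have h : Redex 0 1 (pairProd i j j k) := by
    refine (good_pairProd i j j k).redex_of_adjacent (s := j) (u := []) (v := []) ?_
    simp [pairProd_apply, hij.symm, hjk]
  -- The products $r_{jk}r_{ij}$, $r_{ik}r_{ij}$ and $r_{jk}r_{ik}$ come out of the rule with label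
  -- 1 on the first factor, hence the exchange of labels in these three.
  rw [rUniv_mul_swap hjk hik.symm hij, rUniv_mul i j j k, rUniv_mul i j i k,
    rUniv_mul_swap hik hik.symm hij, rUniv_mul i k j k, rUniv_mul_swap hjk hik.symm hik,
    normalOrder_rule (good_pairProd i j j k) h, ruleSum]
  congr 3 <;> (try congr 1)
  all_goals
    funext s
    simp only [relabel, pairProd_apply, replace, expand]
    by_cases h1 : s = i <;> by_cases h2 : s = j <;> by_cases h3 : s = k <;>
    first
    | (exfalso; omega)
    | simp [*, hij.symm, hik.symm, hjk.symm, Letter.map]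

/-- The elements `r_{ij}^{univ}` for `i < j`, and `-r_{ji}^{univ}` for `i > j`. -/
noncomputable def altUniv {n : ℕ} (i j : Fin n) (_ : i ≠ j) : Univ n :=
  if i < j then rUniv i j else -rUniv j i

theorem altUniv_of_lt {n : ℕ} {i j : Fin n} (h : i < j) : altUniv i j h.ne = rUniv i j :=
  if_pos h

/-- In $U_n^{\mathrm{univ}}$ the class $r_{ji}^{\mathrm{univ}}$ is not $-r_{ij}^{\mathrm{univ}}$.
Since `altUniv` has the sign built in, only increasing indices remain to be checked. -/
theorem trRelations_altUniv (n : ℕ) : TrRelations (altUniv (n := n)) := by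
  refine trRelations_of_lt _ (fun i j k hij hjk => ?_) (fun i j k l hij hkl hik hil hjk hjl => ?_)
    (fun i j hij => ?_)
  · simp only [altUniv_of_lt hij, altUniv_of_lt hjk, altUniv_of_lt (hij.trans hjk),
      LieRing.of_associative_ring_bracket, rUniv_yangBaxter hij.ne (hij.trans hjk).ne hjk.ne]
    abel
  · rw [altUniv_of_lt hij, altUniv_of_lt hkl, LieRing.of_associative_ring_bracket,
      rUniv_commute hij.ne hkl.ne hik hil hjk hjl, sub_self]
  · rcases hij.lt_or_gt with h | h
    · rw [altUniv_of_lt h, altUniv, if_neg h.asymm]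
    · rw [altUniv_of_lt h, altUniv, if_neg h.asymm, neg_neg]

/-- The algebra homomorphism `U(𝔱𝔯_n) → U_n^univ`. -/
noncomputable def toUniv (n : ℕ) : UniversalEnvelopingAlgebra ℚ (Tr n) →ₐ[ℚ] Univ n :=
  trAlgHom altUniv (trRelations_altUniv n)

theorem toUniv_uR {n : ℕ} {i j : Fin n} (h : i < j) : toUniv n (uR i j h.ne) = rUniv i j := by
  rw [toUniv, trAlgHom_uR, altUniv_of_lt h]

/-! ### The weight filtration of `U(𝔱𝔯_n)` -/

/-- The pairs `i < j`. -/
abbrev Edge (n : ℕ) : Type := {p : Fin n × Fin n // p.1 < p.2}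

/-- The generator `r_{ij}` with `i < j`. -/
noncomputable def Edge.gen {n : ℕ} (e : Edge n) : UniversalEnvelopingAlgebra ℚ (Tr n) :=
  uR e.1.1 e.1.2 e.2.ne

/-- The weight of an edge decreases with its length. -/
def Edge.wt {n : ℕ} (e : Edge n) : ℕ := (n + e.1.1) + (n - e.1.2)

/-- The product of the generators in a word. -/
noncomputable def edgeProd {n : ℕ} (L : List (Edge n)) : UniversalEnvelopingAlgebra ℚ (Tr n) :=
  (L.map Edge.gen).prod

def edgeWt {n : ℕ} (L : List (Edge n)) : ℕ := (L.map Edge.wt).sum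

theorem edgeProd_append {n : ℕ} (L L' : List (Edge n)) :
    edgeProd (L ++ L') = edgeProd L * edgeProd L' := by
  simp [edgeProd]

theorem edgeProd_cons {n : ℕ} (e : Edge n) (L : List (Edge n)) :
    edgeProd (e :: L) = e.gen * edgeProd L := by
  simp [edgeProd]

theorem edgeProd_nil {n : ℕ} : edgeProd ([] : List (Edge n)) = 1 := rfl

theorem edgeWt_append {n : ℕ} (L L' : List (Edge n)) :
    edgeWt (L ++ L') = edgeWt L + edgeWt L' := by
  simp [edgeWt]

theorem edgeWt_cons {n : ℕ} (e : Edge n) (L : List (Edge n)) :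
    edgeWt (e :: L) = e.wt + edgeWt L := by
  simp [edgeWt]

/-- The span of the words of weight less than `m`. -/
noncomputable def wtFilt (n m : ℕ) : Submodule ℚ (UniversalEnvelopingAlgebra ℚ (Tr n)) :=
  Submodule.span ℚ {x | ∃ L, edgeWt L < m ∧ x = edgeProd L}

theorem wtFilt_mono {n m k : ℕ} (h : m ≤ k) : wtFilt n m ≤ wtFilt n k :=
  Submodule.span_mono fun _ ⟨L, hL, e⟩ => ⟨L, hL.trans_le h, e⟩

theorem edgeProd_mem {n m : ℕ} {L : List (Edge n)} (h : edgeWt L < m) :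
    edgeProd L ∈ wtFilt n m :=
  Submodule.subset_span ⟨L, h, rfl⟩

/-- Weight is additive under concatenation. The two-sided form serves to put an error term back
between the unchanged ends of a word. -/
theorem wtFilt_mul {n m k : ℕ} {x : UniversalEnvelopingAlgebra ℚ (Tr n)} (hx : x ∈ wtFilt n m)
    {L L' : List (Edge n)} (hk : edgeWt L + edgeWt L' + m ≤ k) :
    edgeProd L * x * edgeProd L' ∈ wtFilt n k := by
  induction hx using Submodule.span_induction with
  | mem x hx =>
    obtain ⟨L1, h1, rfl⟩ := hx
    rw [← edgeProd_append, ← edgeProd_append]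
    refine edgeProd_mem ?_
    simp only [edgeWt_append]
    omega
  | zero => simp
  | add x y _ _ h1 h2 => rw [mul_add, add_mul]; exact add_mem h1 h2
  | smul c x _ h => rw [mul_smul_comm, smul_mul_assoc]; exact Submodule.smul_mem _ _ h

/-- The elements $r_{ij}$ satisfy their relations already inside the subalgebra generated by those
with $i<j$, so the identity of $U(\mathfrak{tr}_n)$ factors through that subalgebra. -/
theorem exists_mem_wtFilt {n : ℕ} (x : UniversalEnvelopingAlgebra ℚ (Tr n)) :
    ∃ m, x ∈ wtFilt n m := by
  let S := Algebra.adjoin ℚ (Set.range (Edge.gen (n := n)))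
  have hgen (i j : Fin n) (h : i ≠ j) : uR i j h ∈ S := by
    rcases h.lt_or_gt with h' | h'
    · exact Algebra.subset_adjoin ⟨⟨(i, j), h'⟩, rfl⟩
    · rw [eq_neg_of_add_eq_zero_left ((trRelations_uR n).antisymm i j h)]
      exact S.neg_mem (Algebra.subset_adjoin ⟨⟨(j, i), h'⟩, rfl⟩)
  have hS : TrRelations fun i j h => (⟨uR i j h, hgen i j h⟩ : S) := by
    refine ⟨fun i j k hij hik hjk => Subtype.ext ?_,
      fun i j k l hij hkl hik hil hjk hjl => Subtype.ext ?_, fun i j hij => Subtype.ext ?_⟩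
    · exact (trRelations_uR n).yangBaxter i j k hij hik hjk
    · exact (trRelations_uR n).comm i j k l hij hkl hik hil hjk hjl
    · exact (trRelations_uR n).antisymm i j hij
  have hid : S.val.comp (trAlgHom _ hS) = AlgHom.id ℚ _ :=
    tr_algHom_ext fun i j h => by simp [trAlgHom_uR]
  have hx : x ∈ S := by
    rw [← AlgHom.id_apply (R := ℚ) x, ← hid]
    exact (trAlgHom _ hS x).2
  -- The subalgebra is the linear span of the monoid generated by the edges, whose elements are the
  -- products `edgeProd L`.
  rw [← Subalgebra.mem_toSubmodule, Algebra.adjoin_eq_span] at hx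
  induction hx using Submodule.span_induction with
  | mem x hx =>
    obtain ⟨l, hl, rfl⟩ := Submonoid.exists_list_of_mem_closure hx
    obtain ⟨L, rfl⟩ : ∃ L : List (Edge n), L.map Edge.gen = l := by
      rwa [← Set.mem_range, Set.range_list_map]
    exact ⟨_, edgeProd_mem (Nat.lt_succ_self _)⟩
  | zero => exact ⟨0, zero_mem _⟩
  | add x y _ _ h1 h2 =>
    obtain ⟨m, h1⟩ := h1
    obtain ⟨k, h2⟩ := h2
    exact ⟨max m k, add_mem (wtFilt_mono (le_max_left _ _) h1) (wtFilt_mono (le_max_right _ _) h2)⟩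
  | smul c x _ h => exact h.imp fun m h => Submodule.smul_mem _ _ h

/-! ### Commutation up to lower weight. -/

theorem edgeProd_pair {n : ℕ} (e e' : Edge n) : edgeProd [e, e'] = e.gen * e'.gen := by
  simp [edgeProd]

/-- Each of the four words on the other side of the relation has $r_{ik}$ in place of $r_{ij}$ or
$r_{jk}$, and $k-i$ exceeds both $j-i$ and $k-j$. The free bound `m` allows the two weights to be
added in either order. -/
theorem yangBaxter_mem {n : ℕ} {i j k : Fin n} (hij : i < j) (hjk : j < k) {m : ℕ}
    (hm : Edge.wt ⟨(i, j), hij⟩ + Edge.wt ⟨(j, k), hjk⟩ ≤ m) :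
    Edge.gen ⟨(i, j), hij⟩ * Edge.gen ⟨(j, k), hjk⟩
      - Edge.gen ⟨(j, k), hjk⟩ * Edge.gen ⟨(i, j), hij⟩ ∈ wtFilt n m := by
  have hik := hij.trans hjk
  have h := (trRelations_uR n).yangBaxter i j k hij.ne hik.ne hjk.ne
  simp only [LieRing.of_associative_ring_bracket] at h
  have e : Edge.gen ⟨(i, j), hij⟩ * Edge.gen ⟨(j, k), hjk⟩
      - Edge.gen ⟨(j, k), hjk⟩ * Edge.gen ⟨(i, j), hij⟩ =
      (edgeProd [⟨(i, k), hik⟩, ⟨(i, j), hij⟩] - edgeProd [⟨(i, j), hij⟩, ⟨(i, k), hik⟩])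
      + (edgeProd [⟨(j, k), hjk⟩, ⟨(i, k), hik⟩] - edgeProd [⟨(i, k), hik⟩, ⟨(j, k), hjk⟩]) := by
    simp only [edgeProd_pair, Edge.gen]
    rw [← sub_eq_zero, ← h]
    abel
  rw [e]
  have hk := k.2
  rw [Fin.lt_def] at hij hjk
  simp only [Edge.wt] at hm
  refine add_mem (sub_mem ?_ ?_) (sub_mem ?_ ?_) <;> refine edgeProd_mem ?_ <;>
    simp only [edgeWt, Edge.wt, List.map_cons, List.map_nil, List.sum_cons, List.sum_nil] <;> omega

/-- Generators with different sources and different targets commute up to lower weight. -/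
theorem commute_mem {n : ℕ} (e e' : Edge n) (h1 : e.1.1 ≠ e'.1.1) (h2 : e.1.2 ≠ e'.1.2) :
    e.gen * e'.gen - e'.gen * e.gen ∈ wtFilt n (e.wt + e'.wt) := by
  obtain ⟨⟨i, j⟩, hij⟩ := e
  obtain ⟨⟨k, l⟩, hkl⟩ := e'
  dsimp only at h1 h2 hij hkl
  -- If the target of one edge is the source of the other, the Yang–Baxter relation applies.
  -- Otherwise all four ends are distinct and the commutator vanishes.
  by_cases hjk : j = k
  · subst hjk
    exact yangBaxter_mem hij hkl le_rfl
  by_cases hil : i = l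
  · subst hil
    rw [← neg_sub]
    exact neg_mem (yangBaxter_mem hkl hij (add_comm _ _).le)
  have h := (trRelations_uR n).comm i j k l hij.ne hkl.ne h1 hil hjk h2
  rw [LieRing.of_associative_ring_bracket] at h
  simp only [Edge.gen, h]
  exact zero_mem _

/-- Telescoping: `e` passes the edges of `P` one at a time, and each exchange costs a commutator of
lower weight, multiplied by the remaining edges. -/
theorem move_front_mem {n : ℕ} (e : Edge n) : ∀ P : List (Edge n),
    (∀ e' ∈ P, e'.1.1 ≠ e.1.1 ∧ e'.1.2 ≠ e.1.2) →
    e.gen * edgeProd P - edgeProd P * e.gen ∈ wtFilt n (edgeWt (e :: P))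
  | [], _ => by simp [edgeProd]
  | e' :: P, h => by
    have ih := move_front_mem e P fun x hx => h x (List.mem_cons_of_mem _ hx)
    have h1 := commute_mem e e' (h e' List.mem_cons_self).1.symm (h e' List.mem_cons_self).2.symm
    have : e.gen * edgeProd (e' :: P) - edgeProd (e' :: P) * e.gen =
        edgeProd [] * (e.gen * e'.gen - e'.gen * e.gen) * edgeProd P
          + edgeProd [e'] * (e.gen * edgeProd P - edgeProd P * e.gen) * edgeProd [] := by
      simp only [edgeProd_cons, edgeProd_nil]
      noncomm_ring
    rw [this]
    refine add_mem (wtFilt_mul h1 ?_) (wtFilt_mul ih ?_) <;>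
      simp only [edgeWt, List.map_cons, List.map_nil, List.sum_cons, List.sum_nil] <;> omega

/-! ### Keys of words in the generators. -/

/-- For every vertex, the targets of the edges starting there and the sources of the edges
ending there, in the order in which they occur. -/
def edgeKey {n : ℕ} (L : List (Edge n)) : (Fin n → List ℕ) × (Fin n → List ℕ) :=
  (fun s => L.flatMap fun e => if s = e.1.1 then [(e.1.2 : ℕ)] else [],
    fun s => L.flatMap fun e => if s = e.1.2 then [(e.1.1 : ℕ)] else [])

theorem edgeKey_cons_fst {n : ℕ} (e : Edge n) (L : List (Edge n)) (s : Fin n) :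
    (edgeKey (e :: L)).1 s = (if s = e.1.1 then [(e.1.2 : ℕ)] else []) ++ (edgeKey L).1 s := by
  simp only [edgeKey, List.flatMap_cons]

theorem edgeKey_cons_snd {n : ℕ} (e : Edge n) (L : List (Edge n)) (s : Fin n) :
    (edgeKey (e :: L)).2 s = (if s = e.1.2 then [(e.1.1 : ℕ)] else []) ++ (edgeKey L).2 s := by
  simp only [edgeKey, List.flatMap_cons]

/-- The first edge of `L` that shares an end of the same kind with `e` must be `e`. If it has the
same source, the first list forces its target; if it had only the same target, the second list would
force its source to be that of `e` as well. -/
theorem exists_split_of_edgeKey {n : ℕ} (e : Edge n) (t t' : List ℕ) : ∀ L : List (Edge n),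
    (edgeKey L).1 e.1.1 = (e.1.2 : ℕ) :: t → (edgeKey L).2 e.1.2 = (e.1.1 : ℕ) :: t' →
    ∃ P Q, L = P ++ e :: Q ∧ ∀ e' ∈ P, e'.1.1 ≠ e.1.1 ∧ e'.1.2 ≠ e.1.2
  | [], h, _ => by simp [edgeKey] at h
  | x :: L, h, h' => by
    rw [edgeKey_cons_fst] at h
    rw [edgeKey_cons_snd] at h'
    by_cases h1 : e.1.1 = x.1.1
    · rw [if_pos h1] at h
      have : e = x := Subtype.ext (Prod.ext h1 (Fin.ext (List.cons.inj h).1.symm))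
      exact ⟨[], L, by rw [this]; rfl, by simp⟩
    by_cases h2 : e.1.2 = x.1.2
    · rw [if_pos h2] at h'
      exact absurd (Fin.ext (List.cons.inj h').1.symm) h1
    rw [if_neg h1] at h
    rw [if_neg h2] at h'
    obtain ⟨P, Q, rfl, hP⟩ := exists_split_of_edgeKey e t t' L h h'
    refine ⟨x :: P, Q, rfl, fun e' he' => ?_⟩
    rcases List.mem_cons.1 he' with rfl | he'
    · exact ⟨Ne.symm h1, Ne.symm h2⟩
    · exact hP e' he'

theorem edgeKey_append_fst {n : ℕ} (L L' : List (Edge n)) (s : Fin n) :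
    (edgeKey (L ++ L')).1 s = (edgeKey L).1 s ++ (edgeKey L').1 s :=
  List.flatMap_append ..

theorem edgeKey_append_snd {n : ℕ} (L L' : List (Edge n)) (s : Fin n) :
    (edgeKey (L ++ L')).2 s = (edgeKey L).2 s ++ (edgeKey L').2 s :=
  List.flatMap_append ..

/-- The edges of `P` contribute nothing to the two lists in which `e` is recorded. -/
theorem edgeKey_move {n : ℕ} (e : Edge n) (P Q : List (Edge n))
    (h : ∀ e' ∈ P, e'.1.1 ≠ e.1.1 ∧ e'.1.2 ≠ e.1.2) :
    edgeKey (P ++ e :: Q) = edgeKey (e :: (P ++ Q)) := by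
  refine Prod.ext (funext fun s => ?_) (funext fun s => ?_)
  · rw [edgeKey_append_fst, edgeKey_cons_fst, edgeKey_cons_fst, edgeKey_append_fst]
    split_ifs with hs
    · have : (edgeKey P).1 s = [] := List.flatMap_eq_nil_iff.2 fun x hx => by
        rw [if_neg (by rw [hs]; exact (h x hx).1.symm)]
      simp [this]
    · simp
  · rw [edgeKey_append_snd, edgeKey_cons_snd, edgeKey_cons_snd, edgeKey_append_snd]
    split_ifs with hs
    · have : (edgeKey P).2 s = [] := List.flatMap_eq_nil_iff.2 fun x hx => by
        rw [if_neg (by rw [hs]; exact (h x hx).2.symm)]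
      simp [this]
    · simp

/-- Words with the same key are equal up to lower weight. -/
theorem edgeProd_sub_mem {n : ℕ} : ∀ L L' : List (Edge n), edgeKey L = edgeKey L' →
    edgeWt L' = edgeWt L ∧ edgeProd L - edgeProd L' ∈ wtFilt n (edgeWt L)
  | [], [], _ => by simp
  | [], x :: L', h => by
    have := congrFun (congrArg Prod.fst h) x.1.1
    rw [edgeKey_cons_fst, if_pos rfl] at this
    simp [edgeKey] at this
  | e :: L, L', h => by
    have h1 := congrFun (congrArg Prod.fst h) e.1.1
    have h2 := congrFun (congrArg Prod.snd h) e.1.2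
    rw [edgeKey_cons_fst, if_pos rfl] at h1
    rw [edgeKey_cons_snd, if_pos rfl] at h2
    -- The equality of keys shows that `e` occurs in the second word behind edges with which it
    -- commutes up to lower weight. Once it is moved to the front, the remaining words again have
    -- equal keys.
    obtain ⟨P, Q, rfl, hP⟩ := exists_split_of_edgeKey e _ _ L' h1.symm h2.symm
    rw [edgeKey_move e P Q hP] at h
    have h3 : edgeKey L = edgeKey (P ++ Q) := by
      refine Prod.ext (funext fun s => ?_) (funext fun s => ?_)
      · have := congrFun (congrArg Prod.fst h) s
        rwa [edgeKey_cons_fst, edgeKey_cons_fst, List.append_cancel_left_eq] at this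
      · have := congrFun (congrArg Prod.snd h) s
        rwa [edgeKey_cons_snd, edgeKey_cons_snd, List.append_cancel_left_eq] at this
    obtain ⟨hw, ih⟩ := edgeProd_sub_mem L (P ++ Q) h3
    have hm := move_front_mem e P hP
    have e1 : edgeProd (e :: L) - edgeProd (P ++ e :: Q) =
        edgeProd [e] * (edgeProd L - edgeProd (P ++ Q)) * edgeProd []
          + edgeProd [] * (e.gen * edgeProd P - edgeProd P * e.gen) * edgeProd Q := by
      simp only [edgeProd_cons, edgeProd_append, edgeProd_nil]
      noncomm_ring
    rw [edgeWt_append] at hw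
    refine ⟨?_, ?_⟩
    · rw [edgeWt_append, edgeWt_cons, edgeWt_cons]
      omega
    · rw [e1]
      refine add_mem (wtFilt_mul ih ?_) (wtFilt_mul hm ?_) <;>
        simp only [edgeWt_cons, show edgeWt ([] : List (Edge n)) = 0 from rfl] <;> omega

/-! ### Leading terms of normally ordered expressions -/

/-- The slot that contains the letter `x`, if it occurs exactly once. -/
def slot {n : ℕ} {α : Type} [DecidableEq α] (u : Fin n → List α) (x : α) : ℕ :=
  ∑ s, (u s).count x * s

/-- Replace every label by the slot in which it occurs in the other tuple. -/
def wordKey {n N : ℕ} (u v : Fin n → List (Fin N)) : (Fin n → List ℕ) × (Fin n → List ℕ) :=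
  (fun s => (u s).map (slot v), fun s => (v s).map (slot u))

/-- An entry of the first family in slot $s$ comes from a letter $a$, or an edge leaving $s$; an
entry of the second comes from a letter $b$, or an edge entering $s$. The coefficients are those of
`Edge.wt`, and $n-s$ is not truncated since $s<n$. -/
def keyWt {n : ℕ} (K : (Fin n → List ℕ) × (Fin n → List ℕ)) : ℕ :=
  ∑ s, (K.1 s).length * (n + s) + ∑ s : Fin n, (K.2 s).length * (n - s)

theorem slot_perm {n N : ℕ} (σ : Equiv.Perm (Fin N)) (u : Fin n → List (Fin N)) (i : Fin N) :
    slot (fun s => (u s).map σ) (σ i) = slot u i :=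
  Finset.sum_congr rfl fun s _ => by rw [List.count_map_of_injective _ _ σ.injective]

/-- A key mentions slots and no labels, so it is well defined on coinvariants. It does not separate
all classes, since it forgets how parallel edges are matched, but it separates enough for leading
terms. -/
theorem wordKey_perm {n N : ℕ} (σ : Equiv.Perm (Fin N)) (u v : MWord n N) :
    wordKey (u.perm σ).1 (v.perm σ).1 = wordKey u.1 v.1 := by
  simp only [wordKey, MWord.perm, List.map_map, Function.comp_def, slot_perm]

/-- The linear map that sends the class of a pair of tuples of words to its key. -/
noncomputable def keyMap (n : ℕ) :
    Univ n →ₗ[ℚ] ((Fin n → List ℕ) × (Fin n → List ℕ)) →₀ ℚ :=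
  liftUniv (fun _ u v => Finsupp.single (wordKey u.1 v.1) 1)
    fun _ σ u v => by rw [wordKey_perm]

theorem keyMap_cls {n N : ℕ} (u v : MWord n N) :
    keyMap n (cls u v) = Finsupp.single (wordKey u.1 v.1) 1 :=
  liftUniv_cls ..

/-- The span of the keys of weight less than `m`. -/
noncomputable def keyFilt (n m : ℕ) :
    Submodule ℚ (((Fin n → List ℕ) × (Fin n → List ℕ)) →₀ ℚ) :=
  Finsupp.supported ℚ ℚ {K | keyWt K < m}

theorem keyFilt_mono {n m k : ℕ} (h : m ≤ k) : keyFilt n m ≤ keyFilt n k :=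
  Finsupp.supported_mono fun _ hK => lt_of_lt_of_le hK h

theorem single_mem_keyFilt {n m : ℕ} {K : (Fin n → List ℕ) × (Fin n → List ℕ)}
    (h : keyWt K < m) : Finsupp.single K 1 ∈ keyFilt n m :=
  Finsupp.single_mem_supported ℚ 1 h

/-- This also applies to words that are not normally ordered: it is the key that would result if
every $a$ commuted with every $b$. -/
def letterKey {n N : ℕ} (w : Fin n → List (Letter N)) :
    (Fin n → List ℕ) × (Fin n → List ℕ) :=
  wordKey (aPart w) (bPart w)

/-! ### Slots of letters and the effect of the reordering rule on the weight. -/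

/-- Every letter `x` occurs exactly once, in the slot `S x`. -/
def HasSlots {n N : ℕ} (w : Fin n → List (Letter N)) (S : Letter N → Fin n) : Prop :=
  ∀ x s, (w s).count x = if s = S x then 1 else 0

theorem Good.exists_hasSlots {n N : ℕ} {w : Fin n → List (Letter N)} (hw : Good w) :
    ∃ S, HasSlots w S := by
  choose S hS using hw.exists_mem
  refine ⟨S, fun x s => ?_⟩
  split_ifs with h
  · subst h
    exact le_antisymm (hw.count_le x _) (List.count_pos_iff.2 (hS x))
  · exact List.count_eq_zero.2 fun hx => h (hw.slot_unique hx (hS x))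

/-- All old copies of `y` are deleted and a new one is inserted beside each `x`; the other letters
are untouched. -/
theorem count_replace_slot {n N : ℕ} (w : Fin n → List (Letter N)) {x y : Letter N} (hxy : x ≠ y)
    {t : List (Letter N)} (ht : t = [x, y] ∨ t = [y, x]) (z : Letter N) (s : Fin n) :
    (replace x y t w s).count z = if z = y then (w s).count x else (w s).count z := by
  simp only [replace, expand]
  induction w s with
  | nil => simp
  | cons v l ih =>
    rw [List.flatMap_cons, List.count_append, ih]
    rw [List.count_cons, List.count_cons]
    simp only [beq_iff_eq]
    by_cases hv : v = y
    · subst hv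
      rw [if_pos rfl, List.count_nil, zero_add, if_neg hxy.symm, add_zero]
      split_ifs with hz hz'
      · rfl
      · exact absurd hz'.symm hz
      · rfl
    rw [if_neg hv]
    by_cases hv' : v = x
    · subst hv'
      have htc : t.count z = (if v = z then 1 else 0) + (if y = z then 1 else 0) := by
        rcases ht with rfl | rfl <;> simp [List.count_cons, add_comm]
      rw [if_pos rfl, if_pos rfl, htc]
      by_cases hz : z = y
      · subst hz
        simp [hv, add_comm]
      · simp [hz, Ne.symm hz, add_comm]
    · rw [if_neg hv', if_neg hv', List.count_singleton]
      by_cases hz : z = y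
      · subst hz
        simp [hv]
      · simp [hz, add_comm]

theorem HasSlots.replace {n N : ℕ} {w : Fin n → List (Letter N)} {S : Letter N → Fin n}
    (h : HasSlots w S) {x y : Letter N} (hxy : x ≠ y)
    {t : List (Letter N)} (ht : t = [x, y] ∨ t = [y, x]) :
    HasSlots (replace x y t w) (Function.update S y (S x)) := by
  intro z s
  rw [count_replace_slot w hxy ht, h, h]
  by_cases hz : z = y
  · subst hz
    simp
  · simp [hz]

theorem length_aPart {n N : ℕ} (w : Fin n → List (Letter N)) (s : Fin n) :
    (aPart w s).length = ∑ i, (w s).count (.a i) := by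
  unfold aPart
  induction w s with
  | nil => simp
  | cons x l ih =>
    cases x <;> simp [List.count_cons, ih, Finset.sum_add_distrib]

theorem length_bPart {n N : ℕ} (w : Fin n → List (Letter N)) (s : Fin n) :
    (bPart w s).length = ∑ i, (w s).count (.b i) := by
  unfold bPart
  induction w s with
  | nil => simp
  | cons x l ih =>
    cases x <;> simp [List.count_cons, ih, Finset.sum_add_distrib]

/-- The weight of a key involves only the lengths of its lists, so each letter contributes through
its slot alone. -/
theorem keyWt_letterKey {n N : ℕ} {w : Fin n → List (Letter N)} {S : Letter N → Fin n}
    (h : HasSlots w S) : keyWt (letterKey w) =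
      ∑ i, (n + (S (.a i) : ℕ)) + ∑ i, (n - (S (.b i) : ℕ)) := by
  simp only [keyWt, letterKey, wordKey, List.length_map, length_aPart, length_bPart,
    Finset.sum_mul]
  congr 1 <;> rw [Finset.sum_comm] <;> refine Finset.sum_congr rfl fun i _ => ?_ <;>
    simp only [h _ _, ite_mul, one_mul, zero_mul, Finset.sum_ite_eq', Finset.mem_univ, if_true]

/-- Used for the correction $\{a_i\mapsto[a_i,a_j]\}$, with $s$ the slot of $a_i$. -/
theorem keyWt_move_a {n N : ℕ} {w w' : Fin n → List (Letter N)} {S : Letter N → Fin n}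
    (h : HasSlots w S) {j : Fin N} {s : Fin n} (hs : s < S (.a j))
    (h' : HasSlots w' (Function.update S (.a j) s)) :
    keyWt (letterKey w') < keyWt (letterKey w) := by
  rw [keyWt_letterKey h, keyWt_letterKey h']
  refine add_lt_add_of_lt_of_le (Finset.sum_lt_sum (fun i _ => ?_) ⟨j, Finset.mem_univ _, ?_⟩)
    (Finset.sum_le_sum fun i _ => by simp)
  · by_cases hi : i = j
    · subst hi
      simpa using hs.le
    · simp [hi]
  · simpa using hs

/-- Used for the correction $\{b_j\mapsto[b_i,b_j]\}$, in which $b_i$ moves up to the slot of $b_j$.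
-/
theorem keyWt_move_b {n N : ℕ} {w w' : Fin n → List (Letter N)} {S : Letter N → Fin n}
    (h : HasSlots w S) {j : Fin N} {s : Fin n} (hs : S (.b j) < s)
    (h' : HasSlots w' (Function.update S (.b j) s)) :
    keyWt (letterKey w') < keyWt (letterKey w) := by
  rw [keyWt_letterKey h, keyWt_letterKey h']
  have hs' : n - (s : ℕ) < n - (S (.b j) : ℕ) := by
    have := s.2
    rw [Fin.lt_def] at hs
    omega
  refine add_lt_add_of_le_of_lt (Finset.sum_le_sum fun i _ => by simp)
    (Finset.sum_lt_sum (fun i _ => ?_) ⟨j, Finset.mem_univ _, ?_⟩)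
  · by_cases hi : i = j
    · subst hi
      simpa using hs'.le
    · simp [hi]
  · simpa using hs'

/-- Exchanging an adjacent pair $b_ia_j$ changes neither the order of the letters $a$ nor that of
the letters $b$ in any slot. -/
theorem Redex.letterKey_putBefore {n N : ℕ} {w : Fin n → List (Letter N)} {i j : Fin N}
    (h : Redex i j w) : letterKey (putBefore (.b i) (.a j) w) = letterKey w := by
  have ha : aPart (putBefore (.b i) (.a j) w) = aPart w := by
    conv_rhs => rw [← h]
    funext s
    simp only [aPart, UnivYB.replace, expand, List.filterMap_flatMap]
    refine List.flatMap_congr fun z _ => ?_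
    split_ifs <;> rfl
  have hb : bPart (putBefore (.b i) (.a j) w) = bPart w := by
    conv_rhs => rw [← h]
    funext s
    simp only [bPart, UnivYB.replace, expand, List.filterMap_flatMap]
    refine List.flatMap_congr fun z _ => ?_
    split_ifs <;> rfl
  rw [letterKey, letterKey, ha, hb]

theorem Redex.slot_eq {n N : ℕ} {w : Fin n → List (Letter N)} {S : Letter N → Fin n}
    {i j : Fin N} (h : Redex i j w) (hS : HasSlots w S) : S (.a j) = S (.b i) := by
  have h1 := count_replace_slot w (x := .b i) (y := .a j) (by simp) (Or.inl rfl) (.a j) (S (.b i))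
  rw [show UnivYB.replace (.b i) (.a j) [.b i, .a j] w = w from h, if_pos rfl, hS, hS,
    if_pos rfl] at h1
  by_contra hne
  rw [if_neg (Ne.symm hne)] at h1
  exact zero_ne_one h1

/-- If every `a_i` stands in an earlier slot than `b_i`, then the normal ordering of `w` is the class
obtained by letting all `a` commute with all `b`, up to terms of lower weight. -/
theorem keyMap_normalOrder {n N : ℕ} (k : ℕ) : ∀ (w : Fin n → List (Letter N))
    (S : Letter N → Fin n), Good w → HasSlots w S → (∀ i, S (.a i) < S (.b i)) → weight w < k →
    keyMap n (normalOrder w) - Finsupp.single (letterKey w) 1 ∈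
      keyFilt n (keyWt (letterKey w)) := by
  induction k with
  | zero => intro _ _ _ _ _ h; omega
  | succ k ih =>
    intro w S hw hS hasc hk
    by_cases h : ∃ p : Fin N × Fin N, Redex p.1 p.2 w
    swap
    · rw [normalOrder_irred hw h, keyMap_cls]
      simp [letterKey]
    obtain ⟨⟨i, j⟩, h⟩ := h
    dsimp only at h
    -- Together with `hasc` this gives $S(a_i)<S(b_i)=S(a_j)<S(b_j)$, which controls all correction
    -- terms.
    have hab := h.slot_eq hS
    have hij : i ≠ j := by
      rintro rfl
      exact (hasc i).ne hab
    -- By induction a correction term equals its own leading key plus still lower terms, and already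
    -- its leading key has weight below that of `w`.
    have low {w' : Fin n → List (Letter N)} {S' : Letter N → Fin n} (hs : Step i j w w')
        (hS' : HasSlots w' S') (hasc' : ∀ i, S' (.a i) < S' (.b i))
        (hlt : keyWt (letterKey w') < keyWt (letterKey w)) :
        keyMap n (normalOrder w') ∈ keyFilt n (keyWt (letterKey w)) := by
      have hg := hs.good hw h
      rw [← sub_add_cancel (keyMap n (normalOrder w')) (Finsupp.single (letterKey w') 1)]
      exact add_mem (keyFilt_mono hlt.le (ih w' S' hg.1 hS' hasc' (by omega)))
        (single_mem_keyFilt hlt)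
    have lowa {w' : Fin n → List (Letter N)} (hs : Step i j w w')
        (hS' : HasSlots w' (Function.update S (.a j) (S (.a i)))) :
        keyMap n (normalOrder w') ∈ keyFilt n (keyWt (letterKey w)) := by
      have hlt : S (.a i) < S (.a j) := hab ▸ hasc i
      refine low hs hS' (fun l => ?_) (keyWt_move_a hS hlt hS')
      by_cases hl : l = j
      · subst hl
        simpa using hlt.trans (hasc l)
      · simpa [hl] using hasc l
    have lowb {w' : Fin n → List (Letter N)} (hs : Step i j w w')
        (hS' : HasSlots w' (Function.update S (.b i) (S (.b j)))) :
        keyMap n (normalOrder w') ∈ keyFilt n (keyWt (letterKey w)) := by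
      have hlt : S (.b i) < S (.b j) := hab ▸ hasc j
      refine low hs hS' (fun l => ?_) (keyWt_move_b hS hlt hS')
      by_cases hl : l = i
      · subst hl
        simpa using (hasc l).trans hlt
      · simpa [hl] using hasc l
    have top : keyMap n (normalOrder (putBefore (.b i) (.a j) w))
        - Finsupp.single (letterKey w) 1 ∈ keyFilt n (keyWt (letterKey w)) := by
      have hg := step_swap hw h
      have hS' := hS.replace (x := .b i) (y := .a j) (by simp) (Or.inr rfl)
      -- The two letters share a slot, so exchanging them leaves the slot function unchanged.
      rw [← hab, Function.update_eq_self] at hS'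
      have := ih _ S hg.1 hS' hasc (by omega)
      rwa [h.letterKey_putBefore] at this
    have haa : Letter.a i ≠ Letter.a j := by simpa using hij
    have hbb : Letter.b j ≠ Letter.b i := by simpa using hij.symm
    have h2 := lowa (Or.inr (Or.inl rfl)) (hS.replace haa (Or.inl rfl))
    have h3 := lowa (Or.inr (Or.inr (Or.inl rfl))) (hS.replace haa (Or.inr rfl))
    have h4 := lowb (Or.inr (Or.inr (Or.inr (Or.inl rfl)))) (hS.replace hbb (Or.inr rfl))
    have h5 := lowb (Or.inr (Or.inr (Or.inr (Or.inr rfl)))) (hS.replace hbb (Or.inl rfl))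
    rw [normalOrder_rule hw h, ruleSum]
    simp only [map_sub]
    rw [sub_right_comm, sub_right_comm _ _ (Finsupp.single _ _)]
    exact sub_mem (sub_mem top (sub_mem h2 h3)) (sub_mem h4 h5)

/-! ### Images of words in the generators -/

theorem slot_letter_a {n N : ℕ} (w : Fin n → List (Letter N)) (i : Fin N) :
    slot (aPart w) i = slot w (.a i) := by
  refine Finset.sum_congr rfl fun s _ => ?_
  congr 1
  unfold aPart
  induction w s with
  | nil => rfl
  | cons x l ih => cases x <;> simp [List.count_cons, ih]

theorem slot_letter_b {n N : ℕ} (w : Fin n → List (Letter N)) (i : Fin N) :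
    slot (bPart w) i = slot w (.b i) := by
  refine Finset.sum_congr rfl fun s _ => ?_
  congr 1
  unfold bPart
  induction w s with
  | nil => rfl
  | cons x l ih => cases x <;> simp [List.count_cons, ih]

theorem Letter.map_castAdd_ne_natAdd {N M : ℕ} (x : Letter N) (y : Letter M) :
    Letter.map (Fin.castAdd M) x ≠ Letter.map (Fin.natAdd N) y := by
  intro h
  cases x <;> cases y <;> simp [Letter.map, Fin.ext_iff] at h <;> omega

theorem count_catWord_castAdd {n N M : ℕ} (w : Fin n → List (Letter N))
    (z : Fin n → List (Letter M)) (x : Letter N) (s : Fin n) :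
    (catWord w z s).count (Letter.map (Fin.castAdd M) x) = (w s).count x := by
  rw [catWord, List.count_append,
    List.count_map_of_injective _ _ (Letter.map_injective (Fin.castAdd_injective N M)),
    Nat.add_eq_left, List.count_eq_zero]
  intro h
  obtain ⟨y, -, hy⟩ := List.mem_map.1 h
  exact Letter.map_castAdd_ne_natAdd _ _ hy.symm

theorem count_catWord_natAdd {n N M : ℕ} (w : Fin n → List (Letter N))
    (z : Fin n → List (Letter M)) (x : Letter M) (s : Fin n) :
    (catWord w z s).count (Letter.map (Fin.natAdd N) x) = (z s).count x := by
  rw [catWord, List.count_append,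
    List.count_map_of_injective _ _ (Letter.map_injective (Fin.natAdd_injective M N)),
    Nat.add_eq_right, List.count_eq_zero]
  intro h
  obtain ⟨y, -, hy⟩ := List.mem_map.1 h
  exact Letter.map_castAdd_ne_natAdd _ _ hy

theorem slot_catWord_castAdd {n N M : ℕ} (w : Fin n → List (Letter N))
    (z : Fin n → List (Letter M)) (x : Letter N) :
    slot (catWord w z) (Letter.map (Fin.castAdd M) x) = slot w x := by
  simp only [slot, count_catWord_castAdd]

theorem slot_catWord_natAdd {n N M : ℕ} (w : Fin n → List (Letter N))
    (z : Fin n → List (Letter M)) (x : Letter M) :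
    slot (catWord w z) (Letter.map (Fin.natAdd N) x) = slot z x := by
  simp only [slot, count_catWord_natAdd]

/-- Written letter by letter, the key can be compared across a concatenation. -/
theorem letterKey_fst {n N : ℕ} (w : Fin n → List (Letter N)) (s : Fin n) :
    (letterKey w).1 s = (w s).flatMap fun | .a i => [slot w (.b i)] | .b _ => [] := by
  simp only [letterKey, wordKey, aPart, List.filterMap_eq_flatMap_toList, List.map_flatMap]
  refine List.flatMap_congr fun x _ => ?_
  cases x
  · simp [slot_letter_b]
  · rfl

theorem letterKey_snd {n N : ℕ} (w : Fin n → List (Letter N)) (s : Fin n) :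
    (letterKey w).2 s = (w s).flatMap fun | .a _ => [] | .b i => [slot w (.a i)] := by
  simp only [letterKey, wordKey, bPart, List.filterMap_eq_flatMap_toList, List.map_flatMap]
  refine List.flatMap_congr fun x _ => ?_
  cases x
  · rfl
  · simp [slot_letter_a]

/-- After the shift of labels, $a_i$ and $b_i$ still come from the same factor, so each entry of the
key can be computed in that factor. -/
theorem letterKey_catWord_fst {n N M : ℕ} (w : Fin n → List (Letter N))
    (z : Fin n → List (Letter M)) (s : Fin n) :
    (letterKey (catWord w z)).1 s = (letterKey w).1 s ++ (letterKey z).1 s := by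
  simp only [letterKey_fst]
  conv_lhs => enter [2]; rw [catWord]
  rw [List.flatMap_append, List.flatMap_map, List.flatMap_map]
  congr 1 <;> refine List.flatMap_congr fun x _ => ?_ <;> cases x
  · exact congrArg (fun m => [m]) (slot_catWord_castAdd w z (.b _))
  · rfl
  · exact congrArg (fun m => [m]) (slot_catWord_natAdd w z (.b _))
  · rfl

theorem letterKey_catWord_snd {n N M : ℕ} (w : Fin n → List (Letter N))
    (z : Fin n → List (Letter M)) (s : Fin n) :
    (letterKey (catWord w z)).2 s = (letterKey w).2 s ++ (letterKey z).2 s := by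
  simp only [letterKey_snd]
  conv_lhs => enter [2]; rw [catWord]
  rw [List.flatMap_append, List.flatMap_map, List.flatMap_map]
  congr 1 <;> refine List.flatMap_congr fun x _ => ?_ <;> cases x
  · rfl
  · exact congrArg (fun m => [m]) (slot_catWord_castAdd w z (.a _))
  · rfl
  · exact congrArg (fun m => [m]) (slot_catWord_natAdd w z (.a _))

theorem HasSlots.cat {n N M : ℕ} {w : Fin n → List (Letter N)} {z : Fin n → List (Letter M)}
    {S : Letter N → Fin n} {T : Letter M → Fin n} (hS : HasSlots w S) (hT : HasSlots z T) :
    HasSlots (catWord w z) fun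
      | .a i => Fin.addCases (fun i => S (.a i)) (fun i => T (.a i)) i
      | .b i => Fin.addCases (fun i => S (.b i)) (fun i => T (.b i)) i := by
  intro x s
  cases x with
  | a i =>
    induction i using Fin.addCases with
    | left i => exact (count_catWord_castAdd w z (.a i) s).trans ((hS _ _).trans (by simp))
    | right i => exact (count_catWord_natAdd w z (.a i) s).trans ((hT _ _).trans (by simp))
  | b i =>
    induction i using Fin.addCases with
    | left i => exact (count_catWord_castAdd w z (.b i) s).trans ((hS _ _).trans (by simp))
    | right i => exact (count_catWord_natAdd w z (.b i) s).trans ((hT _ _).trans (by simp))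

theorem pairWord_single {n : ℕ} (i j s : Fin n) : pairWord (single i) (single j) s =
    (if s = i then [.a 0] else []) ++ (if s = j then [.b 0] else []) := by
  simp only [pairWord, single]
  split_ifs <;> rfl

/-- Since normal ordering turns concatenation into the product (`mulUniv_normalOrder'`), one can
concatenate the words of all the factors and reorder only at the end. The $a$ of an edge stands in
its source and the $b$ in its target, and source < target is the hypothesis that
`keyMap_normalOrder` needs. -/
theorem exists_word_toUniv {n : ℕ} : ∀ L : List (Edge n),
    ∃ (N : ℕ) (w : Fin n → List (Letter N)) (S : Letter N → Fin n), Good w ∧ HasSlots w S ∧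
      (∀ i, S (.a i) < S (.b i)) ∧ toUniv n (edgeProd L) = normalOrder w ∧
      letterKey w = edgeKey L
  | [] => by
    have h := good_pairWord (n := n) (N := 0)
      ⟨fun _ => [], fun i => i.elim0⟩ ⟨fun _ => [], fun i => i.elim0⟩
    obtain ⟨S, hS⟩ := h.exists_hasSlots
    refine ⟨0, _, S, h, hS, fun i => i.elim0, ?_, rfl⟩
    rw [edgeProd_nil, map_one, normalOrder_pairWord]
    rfl
  | e :: L => by
    obtain ⟨M, z, T, hz, hT, hasc, hzL, hkey⟩ := exists_word_toUniv L
    have hg := good_pairWord (single e.1.1) (single e.1.2)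
    have hS : HasSlots (pairWord (single e.1.1) (single e.1.2))
        (fun | .a _ => e.1.1 | .b _ => e.1.2) := by
      intro x s
      cases x with
      | a i =>
        obtain rfl := Subsingleton.elim i 0
        rw [pairWord_single]
        split_ifs <;> simp
      | b i =>
        obtain rfl := Subsingleton.elim i 0
        rw [pairWord_single]
        split_ifs <;> simp
    refine ⟨_, catWord (pairWord (single e.1.1) (single e.1.2)) z, _, hg.cat hz, hS.cat hT,
      fun i => ?_, ?_, ?_⟩
    · induction i using Fin.addCases with
      | left i => simpa using e.2
      | right i => simpa using hasc i
    · rw [edgeProd_cons, map_mul, hzL, Edge.gen, toUniv_uR e.2, rUniv, ← normalOrder_pairWord,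
        univ_mul_def, mulUniv_normalOrder' hg hz]
    · have hslot (x : Letter 1) : slot (pairWord (single e.1.1) (single e.1.2)) x =
          match x with | .a _ => (e.1.1 : ℕ) | .b _ => e.1.2 := by
        simp only [slot, hS x]
        cases x <;> simp
      refine Prod.ext (funext fun s => ?_) (funext fun s => ?_)
      · rw [letterKey_catWord_fst, edgeKey_cons_fst, hkey, letterKey_fst]
        congr 1
        simp only [hslot, pairWord_single]
        split_ifs <;> simp
      · rw [letterKey_catWord_snd, edgeKey_cons_snd, hkey, letterKey_snd]
        congr 1
        simp only [hslot, pairWord_single]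
        split_ifs <;> simp

/-- An edge from $i$ to $j$ adds one entry at $i$ to the first family and one at $j$ to the second,
contributing $n+i$ and $n-j$. -/
theorem keyWt_edgeKey {n : ℕ} (L : List (Edge n)) : keyWt (edgeKey L) = edgeWt L := by
  induction L with
  | nil => simp [keyWt, edgeKey, edgeWt]
  | cons e L ih =>
    rw [edgeWt_cons, ← ih]
    simp only [keyWt, edgeKey_cons_fst, edgeKey_cons_snd, List.length_append, add_mul,
      Finset.sum_add_distrib, apply_ite List.length, List.length_singleton, List.length_nil,
      ite_mul, one_mul, zero_mul, Finset.sum_ite_eq', Finset.mem_univ, if_true, Edge.wt]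
    omega

theorem keyMap_toUniv {n : ℕ} (L : List (Edge n)) :
    keyMap n (toUniv n (edgeProd L)) - Finsupp.single (edgeKey L) 1 ∈ keyFilt n (edgeWt L) := by
  obtain ⟨N, w, S, hw, hS, hasc, h1, h2⟩ := exists_word_toUniv L
  rw [h1, ← h2, ← keyWt_edgeKey, ← h2]
  exact keyMap_normalOrder _ w S hw hS hasc (Nat.lt_succ_self _)

/-! ### Injectivity -/

open Classical in
/-- A product of generators with the given key, if there is one. -/
noncomputable def keyRep (n : ℕ) (K : (Fin n → List ℕ) × (Fin n → List ℕ)) :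
    UniversalEnvelopingAlgebra ℚ (Tr n) :=
  -- Not every key comes from a word of edges, because the orders prescribed at the vertices may be
  -- cyclic. Such keys can occur only among lower terms, where the value 0 does no harm.
  if h : ∃ L : List (Edge n), edgeKey L = K then edgeProd h.choose else 0

theorem keyRep_mem {n m : ℕ} {K : (Fin n → List ℕ) × (Fin n → List ℕ)} (h : keyWt K < m) :
    keyRep n K ∈ wtFilt n m := by
  unfold keyRep
  split_ifs with hK
  · refine edgeProd_mem ?_
    rwa [← keyWt_edgeKey, hK.choose_spec]
  · exact zero_mem _

theorem linearCombination_keyRep_mem {n m : ℕ} {c : ((Fin n → List ℕ) × (Fin n → List ℕ)) →₀ ℚ}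
    (hc : c ∈ keyFilt n m) : Finsupp.linearCombination ℚ (keyRep n) c ∈ wtFilt n m := by
  rw [Finsupp.linearCombination_apply]
  exact Submodule.sum_mem _ fun K hK => Submodule.smul_mem _ _ (keyRep_mem (hc hK))

/-- The choice made in `keyRep` is immaterial up to lower weight, by `edgeProd_sub_mem`. -/
theorem edgeProd_sub_keyRep_mem {n : ℕ} (L : List (Edge n)) :
    edgeProd L - keyRep n (edgeKey L) ∈ wtFilt n (edgeWt L) := by
  have h : ∃ L' : List (Edge n), edgeKey L' = edgeKey L := ⟨L, rfl⟩
  rw [keyRep, dif_pos h]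
  exact (edgeProd_sub_mem _ _ h.choose_spec.symm).2

/-- The leading term of `x` can be recovered from the image of `x` in `U_n^univ`. -/
theorem sub_linearCombination_mem {n m : ℕ} {x : UniversalEnvelopingAlgebra ℚ (Tr n)}
    (hx : x ∈ wtFilt n (m + 1)) :
    x - Finsupp.linearCombination ℚ (keyRep n) (keyMap n (toUniv n x)) ∈ wtFilt n m := by
  induction hx using Submodule.span_induction with
  | mem x hx =>
    obtain ⟨L, hL, rfl⟩ := hx
    -- The word and the element recovered from its image both agree with `keyRep n (edgeKey L)`
    -- modulo `wtFilt n (edgeWt L)`, hence with each other; and `edgeWt L` is at most `m`.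
    have h1 := linearCombination_keyRep_mem (keyMap_toUniv L)
    rw [map_sub, Finsupp.linearCombination_single, one_smul] at h1
    have h2 := sub_mem (edgeProd_sub_keyRep_mem L) h1
    rw [sub_sub_sub_cancel_right] at h2
    exact wtFilt_mono (Nat.lt_succ_iff.1 hL) h2
  | zero => simp
  | add x y _ _ h1 h2 =>
    simp only [map_add]
    rw [add_sub_add_comm]
    exact add_mem h1 h2
  | smul c x _ h =>
    simp only [map_smul]
    rw [← smul_sub]
    exact Submodule.smul_mem _ _ h

theorem toUniv_injective (n : ℕ) : Function.Injective (toUniv n) := by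
  rw [injective_iff_map_eq_zero]
  intro x hx
  -- For $x$ in the kernel the recovered leading term is zero, so $x$ itself drops one step in the
  -- filtration. The bottom step `wtFilt n 0` is the span of the empty set.
  have key (m : ℕ) : x ∈ wtFilt n m → x = 0 := by
    induction m with
    | zero => simp [wtFilt]
    | succ m ih =>
      intro h
      have := sub_linearCombination_mem h
      rw [hx, map_zero, map_zero, sub_zero] at this
      exact ih this
  obtain ⟨m, hm⟩ := exists_mem_wtFilt x
  exact key m hm

end UnivYB

theorem mainTheorem9 (n : ℕ) :
    ∃ f : UniversalEnvelopingAlgebra ℚ (UnivYB.Tr n) →ₐ[ℚ] UnivYB.Univ n,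
      (∀ (i j : Fin n) (h : i < j),
        f (UniversalEnvelopingAlgebra.ι ℚ (UnivYB.Tr.r i j h.ne)) = UnivYB.rUniv i j) ∧
      Function.Injective f :=
  ⟨UnivYB.toUniv n, fun _ _ h => UnivYB.toUniv_uR h, UnivYB.toUniv_injective n⟩
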